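/- Let $\mathsf L$ and $\mathsf J$ be irreducible reduced (crystallographic, finite) root systems in real vector spaces, with sets of simple roots $\Delta_{\mathsf L}$ and $\Delta_{\mathsf J}$, and assume that $\mathsf L$ has rank at least $2$. Write $\langle\chi,\alpha\rangle=2(\chi,\alpha)/(\alpha,\alpha)$. Definitions. A simple root is *extremal* if it is connected to exactly one other simple root in the Dynkin diagram. For a simple root $\alpha$, the fundamental weight $\varpi_\alpha$ is defined by $\langle\varpi_\alpha,\beta\rangle=\delta_{\alpha\beta}$ for all simple roots $\beta$. A set $S$ of weights is *saturated* if for all $\chi\in S$ and all roots $\alpha$ it contains $\chi-k\alpha$ for every integer $k$ between $0$ and $\langle\chi,\alpha\rangle$. For a dominant weight $\chi$, the Hasse diagram $\mathcal H(\mathsf L,\chi)$ has as vertices the elements of the smallest saturated set of weights containing $\chi$ (the weights of the irreducible representation with highest weight $\chi$), with an edge labeled $\sigma\in\Delta_{\mathsf L}$ from $\psi_0$ down to $\psi_1$ whenever $\psi_0-\psi_1=\sigma$. Given $f:\Delta_{\mathsf L}\to\Delta_{\mathsf J}$, a *diagram map with labeling $f$* is a map $T:\mathcal H(\mathsf L,\chi)\to\mathcal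 H(\mathsf J,\chi')$ of vertex sets such that $\psi_0-\psi_1=\sigma\in\Delta_{\mathsf L}$ implies $T(\psi_0)-T(\psi_1)=f(\sigma)$. Lemma. Let $f:\Delta_{\mathsf L}\to\Delta_{\mathsf J}$ be a map such that $f(\alpha)$ is extremal for every extremal $\alpha\in\Delta_{\mathsf L}$, and such that for every extremal $\alpha\in\Delta_{\mathsf L}$ there is a surjective diagram map $\mathcal H(\mathsf L,\varpi_\alpha)\to\mathcal H(\mathsf J,\varpi_{f(\alpha)})$ with labeling $f$. Then either $f$ is an isomorphism of Dynkin diagrams (i.e. $\mathsf L$ and $\mathsf J$ have the same type and, after identifying them suitably, $f$ is the identity), or, for suitable enumerations $\sigma_1,\sigma_2,\dots$ of $\Delta_{\mathsf L}$ and $\tau_1,\tau_2,\dots$ of $\Delta_{\mathsf J}$ that realize the standard Dynkin diagrams (Bourbaki's numbering; in $\mathsf G_2$ we let $\tau_1$ be the long and $\tau_2$ the short root), one of the following holds: 1. $\mathsf L=\mathsf A_{2n}$, $\mathsf J=\mathsf B_n$, $n\ge2$, and $f(\sigma_i)=f(\sigma_{2n+1-i})=\tau_i$ for $1\le i\le n$;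 2. $\mathsf L=\mathsf A_6$, $\mathsf J=\mathsf G_2$, and $f(\sigma_1)=f(\sigma_3)=f(\sigma_4)=f(\sigma_6)=\tau_2$, $f(\sigma_2)=f(\sigma_5)=\tau_1$; 3. $\mathsf L=\mathsf A_{2n-1}$, $\mathsf J=\mathsf C_n$, $n\ge2$, and $f(\sigma_i)=f(\sigma_{2n-i})=\tau_i$ for $1\le i\le n$; 4. $\mathsf L=\mathsf B_3$, $\mathsf J=\mathsf G_2$, and $f(\sigma_1)=f(\sigma_3)=\tau_2$, $f(\sigma_2)=\tau_1$; 5. $\mathsf L=\mathsf D_n$, $\mathsf J=\mathsf B_{n-1}$, $n\ge3$, and $f(\sigma_i)=\tau_i$ for $i\le n-1$, $f(\sigma_n)=\tau_{n-1}$ (where $\mathsf D_3=\mathsf A_3$ is numbered with middle node $\sigma_1$); 6. $\mathsf L=\mathsf D_4$, $\mathsf J=\mathsf B_3$, and $f(\sigma_1)=f(\sigma_4)=\tau_3$, $f(\sigma_2)=\tau_2$, $f(\sigma_3)=\tau_1$; 7. $\mathsf L=\mathsf D_4$, $\mathsf J=\mathsf G_2$, and $f(\sigma_1)=f(\sigma_3)=f(\sigma_4)=\tau_2$,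 $f(\sigma_2)=\tau_1$; 8. $\mathsf L=\mathsf E_6$, $\mathsf J=\mathsf F_4$, and $f(\sigma_1)=f(\sigma_6)=\tau_4$, $f(\sigma_3)=f(\sigma_5)=\tau_3$, $f(\sigma_4)=\tau_2$, $f(\sigma_2)=\tau_1$. -/

import Mathlib

namespace RootHasse

open Module

/-- The integrality condition defining the weight lattice: `⟨χ, α⟩ ∈ ℤ` for every root `α`. -/
def weightLattice {ι M N : Type*} [AddCommGroup M] [Module ℝ M] [AddCommGroup N] [Module ℝ N]
    (P : RootPairing ι ℝ M N) : Set M :=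
  {χ | ∀ i, ∃ k : ℤ, P.toLinearMap χ (P.coroot i) = (k : ℝ)}

/-- A set `S` of weights is saturated if, for every `χ ∈ S` and every root `α`, it contains the
string `χ - k α`, with `k` any integer between `0` and `⟨χ, α⟩`. -/
def IsSaturated {ι M N : Type*} [AddCommGroup M] [Module ℝ M] [AddCommGroup N] [Module ℝ N]
    (P : RootPairing ι ℝ M N) (S : Set M) : Prop :=
  S ⊆ weightLattice P ∧
    ∀ χ ∈ S, ∀ i, ∀ k : ℤ, (k : ℝ) ∈ Set.uIcc 0 (P.toLinearMap χ (P.coroot i)) →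
      χ - (k : ℝ) • P.root i ∈ S

/-- The vertices of the Hasse diagram with highest weight `χ` (a dominant weight): the smallest
saturated set of weights containing `χ`. This is the saturated set with highest weight `χ`, that
is, the set of weights of the irreducible representation with highest weight `χ`. -/
def hasseVertices {ι M N : Type*} [AddCommGroup M] [Module ℝ M] [AddCommGroup N] [Module ℝ N]
    (P : RootPairing ι ℝ M N) (χ : M) : Set M :=
  ⋂₀ {S : Set M | IsSaturated P S ∧ χ ∈ S}

/-- The fundamental weight `ϖ_σ` of the simple root `σ`: the vector with `⟨ϖ_σ, τ⟩ = δ_{στ}` for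
all simple roots `τ`. -/
noncomputable def fundWeight {ι M N : Type*} [AddCommGroup M] [Module ℝ M] [AddCommGroup N]
    [Module ℝ N] {P : RootPairing ι ℝ M N} [P.IsRootSystem] (b : P.Base) (σ : b.support) : M :=
  P.toLinearMap.toPerfPair.symm (b.toCoweightBasis.coord σ)

theorem fundWeight_coroot {ι M N : Type*} [AddCommGroup M] [Module ℝ M] [AddCommGroup N]
    [Module ℝ N] [DecidableEq ι] {P : RootPairing ι ℝ M N} [P.IsRootSystem] (b : P.Base)
    (σ τ : b.support) :
    P.toLinearMap (fundWeight b σ) (P.coroot τ) = if σ = τ then 1 else 0 := by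
  rw [fundWeight, LinearMap.apply_symm_toPerfPair_self, Basis.coord_apply,
    RootPairing.Base.toCoweightBasis_repr_coroot, Finsupp.single_apply]
  simp only [eq_comm]

/-- The underlying graph of the Dynkin diagram: distinct simple roots `σ`, `τ` are connected when
the number `⟨σ, τ⟩⟨τ, σ⟩` of edges joining them is not zero. -/
def dynkinGraph {ι M N : Type*} [AddCommGroup M] [Module ℝ M] [AddCommGroup N] [Module ℝ N]
    {P : RootPairing ι ℝ M N} (b : P.Base) : SimpleGraph b.support where
  Adj σ τ := σ ≠ τ ∧ P.coxeterWeight σ τ ≠ 0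
  symm := ⟨fun σ τ h => ⟨h.1.symm, by rw [P.coxeterWeight_swap]; exact h.2⟩⟩
  loopless := ⟨fun _ h => h.1 rfl⟩

/-- A simple root is extremal if it is connected to exactly one simple root in the Dynkin
diagram. -/
def IsExtremal {ι M N : Type*} [AddCommGroup M] [Module ℝ M] [AddCommGroup N] [Module ℝ N]
    {P : RootPairing ι ℝ M N} (b : P.Base) (σ : b.support) : Prop :=
  ∃! τ, (dynkinGraph b).Adj σ τ

/-- `T` is a diagram map with labeling `f`, from the Hasse diagram with highest weight `χ` to the
one with highest weight `χ'`: an edge labeled by the simple root `σ` goes to an edge labeled by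
`f σ`, in the same direction. -/
def IsDiagramMap {ι M N ι' M' N' : Type*} [AddCommGroup M] [Module ℝ M] [AddCommGroup N]
    [Module ℝ N] [AddCommGroup M'] [Module ℝ M'] [AddCommGroup N'] [Module ℝ N']
    {P : RootPairing ι ℝ M N} {P' : RootPairing ι' ℝ M' N'} {b : P.Base} {b' : P'.Base}
    (f : b.support → b'.support) (χ : M) (χ' : M')
    (T : hasseVertices P χ → hasseVertices P' χ') : Prop :=
  ∀ (ψ₀ ψ₁ : hasseVertices P χ) (σ : b.support),
    (ψ₀ : M) - (ψ₁ : M) = P.root σ → (T ψ₀ : M') - (T ψ₁ : M') = P'.root (f σ)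

/-- `f` is an isomorphism of Dynkin diagrams, i.e. the identity once both root systems are
identified with the standard one of their common type. -/
def IsDynkinIso {ι M N ι' M' N' : Type*} [AddCommGroup M] [Module ℝ M] [AddCommGroup N]
    [Module ℝ N] [AddCommGroup M'] [Module ℝ M'] [AddCommGroup N'] [Module ℝ N']
    {P : RootPairing ι ℝ M N} {P' : RootPairing ι' ℝ M' N'}
    [P.IsCrystallographic] [P'.IsCrystallographic] {b : P.Base} {b' : P'.Base}
    (f : b.support → b'.support) : Prop :=
  Function.Bijective f ∧ ∀ σ τ, b'.cartanMatrix (f σ) (f τ) = b.cartanMatrix σ τ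

/-- The simple roots can be enumerated as `σ_0, …, σ_(n-1)` and `τ_0, …, τ_(m-1)`, with Cartan
matrices `A` and `A'`, in such a way that `f` sends `σ_i` to `τ_(g i)`. The enumerations of the
standard Cartan matrices are those of Bourbaki (starting from `0`), with entries
`A i j = ⟨σ_i, σ_j⟩`, except that in type `G₂` the first root is the long one. -/
def HasForm {ι M N ι' M' N' : Type*} [AddCommGroup M] [Module ℝ M] [AddCommGroup N]
    [Module ℝ N] [AddCommGroup M'] [Module ℝ M'] [AddCommGroup N'] [Module ℝ N']
    {P : RootPairing ι ℝ M N} {P' : RootPairing ι' ℝ M' N'}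
    [P.IsCrystallographic] [P'.IsCrystallographic] {b : P.Base} {b' : P'.Base}
    (f : b.support → b'.support) {n m : ℕ} (A : Matrix (Fin n) (Fin n) ℤ)
    (A' : Matrix (Fin m) (Fin m) ℤ) (g : Fin n → ℕ) : Prop :=
  ∃ (e : Fin n ≃ b.support) (e' : Fin m ≃ b'.support),
    (∀ i j, b.cartanMatrix (e i) (e j) = A i j) ∧
    (∀ i j, b'.cartanMatrix (e' i) (e' j) = A' i j) ∧
    ∀ i, ((e'.symm (f (e i)) : Fin m) : ℕ) = g i

/-- The table of exceptional labelings `f : Δ_L → Δ_J`: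
`A_{2n} → B_n`, `A_6 → G₂`, `A_{2n-1} → C_n`, `B_3 → G₂`, `D_n → B_{n-1}`, `D_4 → B_3`,
`D_4 → G₂`, `E_6 → F_4`. -/
def IsFolding {ι M N ι' M' N' : Type*} [AddCommGroup M] [Module ℝ M] [AddCommGroup N]
    [Module ℝ N] [AddCommGroup M'] [Module ℝ M'] [AddCommGroup N'] [Module ℝ N']
    {P : RootPairing ι ℝ M N} {P' : RootPairing ι' ℝ M' N'}
    [P.IsCrystallographic] [P'.IsCrystallographic] {b : P.Base} {b' : P'.Base}
    (f : b.support → b'.support) : Prop :=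
  (∃ n, 2 ≤ n ∧ HasForm f (CartanMatrix.A (2 * n)) (CartanMatrix.B n)
    (fun i => min (i : ℕ) (2 * n - 1 - i))) ∨
  HasForm f (CartanMatrix.A 6) CartanMatrix.G₂ ![1, 0, 1, 1, 0, 1] ∨
  (∃ n, 2 ≤ n ∧ HasForm f (CartanMatrix.A (2 * n - 1)) (CartanMatrix.C n)
    (fun i => min (i : ℕ) (2 * n - 2 - i))) ∨
  HasForm f (CartanMatrix.B 3) CartanMatrix.G₂ ![1, 0, 1] ∨
  (∃ n, 3 ≤ n ∧ HasForm f (CartanMatrix.D n) (CartanMatrix.B (n - 1))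
    (fun i => min (i : ℕ) (n - 2))) ∨
  HasForm f (CartanMatrix.D 4) (CartanMatrix.B 3) ![2, 1, 0, 2] ∨
  HasForm f (CartanMatrix.D 4) CartanMatrix.G₂ ![1, 0, 1, 1] ∨
  HasForm f CartanMatrix.E₆ CartanMatrix.F₄ ![3, 0, 2, 1, 2, 3]

end RootHasse

/-! A weight of the representation with highest weight `ϖ_α` is recorded by its depth vector `d`,
the weight being `ϖ_α - ∑ d_k σ_k`. A surjective diagram map must send `ϖ_α` to `ϖ_{f α}` and push
depth vectors forward along `f` (`IsDiagramMap.depth_iff`). The hypothesis for a leaf `α` thus says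
exactly that the depth vectors over `f α` are the push-forwards of those over `α`. From there on
only Cartan matrices occur, through the properties collected in `IsFiniteCartan`. Three constraints
on depth vectors are used throughout: their coefficients remain nonnegative under every simple
reflection; their support is connected to the starting node (`exists_boundary`); and no weight is
longer than the highest one (`normGap_nonneg`, made decidable by `wordGap`). Growing a subdiagram
from a leaf on which `f` is an isomorphism, one finds that every edge leaving the image lifts, with
entries of the Cartan matrix at least as large (`exists_lift`). If the entries always agree, `f` is
an isomorphism; this settles the simply laced targets. Otherwise the target has a multiple edge, so
it is a path of type B, C, F₄ or G₂, and `f` can fail to be an isomorphism only by replacing the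
multiple edge by a weaker one (`exists_fold`). For B and G₂ seen from one end, and for C seen from
the simple end, the weights over `f α` form a single chain. The label of a step is then a function
of its depth, so each fork or multiple edge of `L` forces a coincidence in the sequence of labels.
Few coincidences exist, and each of them gives a row of the table; if none is used, `L` is a path of
type A with as many nodes as the chain has steps. The remaining starting nodes are treated by
lifting well chosen weights. They yield an isomorphism (`isIso_typeG`, `isIso_typeC`) or another
leaf over the better end (`exists_leaf_typeB`, `exists_leaf_typeF`). Over the short end of F₄ the
diagram E₆ is built node by node, and a word for the lowest weight shows that nothing more can be
attached. -/

namespace RootHasse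

set_option linter.unusedSectionVars false

/-! ### Depth vectors: connected support, bounded length, words. -/

section Depth

variable {I I' : Type*} [Fintype I] [DecidableEq I] [Fintype I'] [DecidableEq I']

/-- The pairing of the weight `ϖ_α - ∑ d_k σ_k` with the simple coroot `σ_i^∨`. -/
def wt (A : Matrix I I ℤ) (α : I) (d : I → ℤ) (i : I) : ℤ :=
  (if i = α then 1 else 0) - ∑ k, d k * A k i

/-- The depth vectors `d` of the weights `ϖ_α - ∑ d_k σ_k` that can be reached from `ϖ_α` by moving
along strings of simple roots. -/
inductive Depth (A : Matrix I I ℤ) (α : I) : (I → ℤ) → Prop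
  | zero : Depth A α 0
  | step {d : I → ℤ} (i : I) (k : ℤ) (hd : Depth A α d) (hk : k ∈ Set.uIcc 0 (wt A α d i)) :
      Depth A α (d + Pi.single i k)

/-- The push-forward of a vector along a map of index sets. -/
def push (f : I → I') (d : I → ℤ) : I' → ℤ := fun j => ∑ i, if f i = j then d i else 0

/-- The properties of the Cartan matrix of an irreducible finite root system that are used below. -/
structure IsFiniteCartan (A : Matrix I I ℤ) : Prop where
  diag : ∀ i, A i i = 2
  off : ∀ i j, i ≠ j → A i j ≤ 0
  zero : ∀ i j, A i j = 0 → A j i = 0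
  symm : ∃ δ : I → ℤ, (∀ i, 0 < δ i) ∧ ∀ i j, A i j * δ j = A j i * δ i
  pos : ∀ v : I → ℤ, (∀ i, 0 ≤ v i) → v ≠ 0 → ∃ i, 0 < v i ∧ 0 < ∑ k, v k * A k i
  conn : ∀ p : I → Prop, (∃ i, p i) → (∀ i j, p i → A i j ≠ 0 → p j) → ∀ j, p j
  nonneg : ∀ α d, Depth A α d → ∀ i, 0 ≤ d i
  finite : ∀ α, {d | Depth A α d}.Finite

variable {A : Matrix I I ℤ} {A' : Matrix I' I' ℤ} {α : I} {β : I'} {d : I → ℤ} {f : I → I'}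

@[simp] lemma wt_zero (i : I) : wt A α 0 i = if i = α then 1 else 0 := by simp [wt]

@[simp] lemma wt_add_single (i : I) (k : ℤ) (t : I) :
    wt A α (d + Pi.single i k) t = wt A α d t - k * A i t := by
  simp [wt, add_mul, Finset.sum_add_distrib, Pi.single_apply, ite_mul]
  ring

@[simp] lemma push_zero : push f 0 = 0 := by ext; simp [push]

@[simp] lemma push_add_single (i : I) (k : ℤ) :
    push f (d + Pi.single i k) = push f d + Pi.single (f i) k := by
  ext j
  have h : ∀ x, (if f x = j then (d + Pi.single i k : I → ℤ) x else 0) =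
      (if f x = j then d x else 0) + if x = i then (if f i = j then k else 0) else 0 := by
    intro x
    by_cases h : x = i
    · subst h; by_cases h' : f x = j <;> simp [h']
    · simp [h]
  have e : push f (d + Pi.single i k) j =
      ∑ x, if f x = j then (d + Pi.single i k : I → ℤ) x else 0 := rfl
  rw [e, Finset.sum_congr rfl fun x _ => h x]
  simp only [push, Finset.sum_add_distrib, Finset.sum_ite_eq', Finset.mem_univ, if_true,
    Pi.add_apply, Pi.single_apply]
  simp only [eq_comm]

lemma le_push (hd : ∀ i, 0 ≤ d i) (i : I) : d i ≤ push f d (f i) := by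
  have := Finset.single_le_sum (f := fun x => if f x = f i then d x else 0)
    (fun x _ => by split_ifs <;> simp [hd]) (Finset.mem_univ i)
  simpa [push] using this

lemma exists_of_push_pos {j : I'} (h : 0 < push f d j) : ∃ i, f i = j ∧ 0 < d i := by
  by_contra! hc
  refine absurd h (not_lt.2 (Finset.sum_nonpos fun i _ => ?_))
  split_ifs with hi
  · exact hc i hi
  · exact le_rfl

lemma Depth.add (hd : Depth A α d) (i : I) {k : ℤ} (h0 : 0 ≤ k) (hk : k ≤ wt A α d i) :
    Depth A α (d + Pi.single i k) :=
  .step i k hd (by rw [Set.uIcc_of_le (h0.trans hk)]; exact ⟨h0, hk⟩)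

lemma Depth.reflect (hd : Depth A α d) (i : I) : Depth A α (d + Pi.single i (wt A α d i)) :=
  .step i _ hd Set.right_mem_uIcc

/-- The right-hand side is the coefficient of `i` after the reflection in `i`. -/
lemma IsFiniteCartan.le_add_wt (hA : IsFiniteCartan A) (hd : Depth A α d) (i : I) :
    0 ≤ d i + wt A α d i := by
  simpa using hA.nonneg α _ (hd.reflect i) i

lemma IsFiniteCartan.ne_zero_symm (hA : IsFiniteCartan A) {i j : I} (h : A i j ≠ 0) : A j i ≠ 0 :=
  fun h' => h (hA.zero _ _ h')

lemma IsFiniteCartan.le_neg_one (hA : IsFiniteCartan A) {i j : I} (hij : i ≠ j) (h : A i j ≠ 0) :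
    A i j ≤ -1 := by
  have := hA.off i j hij
  omega

/-- The support of a nonzero depth vector cannot leave a set containing `α` except along an edge. -/
lemma IsFiniteCartan.exists_boundary (hA : IsFiniteCartan A) {X : Set I} (hα : α ∈ X)
    (hd : Depth A α d) {t₀ : I} (ht₀ : t₀ ∉ X) (hdt : 0 < d t₀) :
    ∃ x ∈ X, ∃ t, t ∉ X ∧ 0 < d x ∧ 0 < d t ∧ A x t ≠ 0 := by
  classical
  by_contra! hc
  obtain ⟨n, hn⟩ : ∃ n : ℕ, ∑ t, (if t ∈ X then 0 else d t) = n :=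
    ⟨_, (Int.toNat_of_nonneg (Finset.sum_nonneg fun t _ => by
      split_ifs <;> simp [hA.nonneg α d hd])).symm⟩
  induction n using Nat.strong_induction_on generalizing d t₀ with
  | _ n ih =>
    have hnn := hA.nonneg α d hd
    obtain ⟨v, hv⟩ : ∃ v : I → ℤ, v = fun t => if t ∈ X then 0 else d t := ⟨_, rfl⟩
    obtain ⟨i, hi, hi'⟩ := hA.pos v (fun t => by simp only [hv]; split_ifs <;> simp [hnn])
      (fun h => by have := congrFun h t₀; simp [hv, ht₀] at this; omega)
    have hiX : i ∉ X := fun h => by simp [hv, h] at hi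
    have hdi : 0 < d i := by simpa [hv, hiX] using hi
    have hsum : ∑ k, d k * A k i = ∑ k, v k * A k i := by
      refine Finset.sum_congr rfl fun k _ => ?_
      by_cases hk : k ∈ X
      · rcases (hnn k).eq_or_lt with h | h
        · simp [hv, ← h]
        · simp [hv, hk, hc k hk i hiX h hdi]
      · simp [hv, hk]
    have hiα : i ≠ α := fun h => hiX (h ▸ hα)
    -- The nodes of `X` do not contribute to this pairing, since no edge is available. So the
    -- reflection in `i` lowers `d i`, changes nothing in `X`, and permits induction on the total
    -- outside `X`.
    have hw : wt A α d i < 0 := by simp only [wt, hiα, if_false, hsum]; omega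
    set d' := d + Pi.single i (wt A α d i) with hd'
    have hD' : Depth A α d' := hd.reflect i
    have hnn' := hA.nonneg α d' hD'
    have hle : ∀ t, d' t ≤ d t := by
      intro t
      by_cases ht : t = i
      · subst ht; simp [hd']; omega
      · simp [hd', ht]
    have hX : ∀ t ∈ X, d' t = d t := by
      intro t ht
      simp [hd', show t ≠ i from fun h => hiX (h ▸ ht)]
    have hlt : ∑ t, (if t ∈ X then 0 else d' t) < ∑ t, (if t ∈ X then 0 else d t) := by
      refine Finset.sum_lt_sum (fun t _ => ?_) ⟨i, Finset.mem_univ _, ?_⟩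
      · split_ifs; exacts [le_rfl, hle t]
      · simp [hiX, hd', hw]
    have hn0 : 0 ≤ ∑ t, (if t ∈ X then 0 else d' t) :=
      Finset.sum_nonneg fun t _ => by split_ifs <;> simp [hnn']
    -- If the reflection emptied the complement of `X`, then `i` was the only node of the support
    -- there, and its new coefficient would be `d i - 2 * d i < 0`.
    obtain ⟨t₁, ht₁, hdt₁⟩ : ∃ t, t ∉ X ∧ 0 < d' t := by
      by_contra! h0
      have hz : ∀ k, k ≠ i → k ∉ X → d k = 0 := by
        intro k hk hkX
        have h1 := h0 k hkX
        have h2 := hnn k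
        simp [hd', hk] at h1
        omega
      have : ∑ k, v k * A k i = 2 * d i := by
        rw [Finset.sum_eq_single i]
        · simp [hv, hiX, hA.diag]; ring
        · intro k _ hk
          by_cases hkX : k ∈ X
          · simp [hv, hkX]
          · simp [hv, hkX, hz k hk hkX]
        · simp
      have h3 := hnn' i
      have h4 : wt A α d i = - (2 * d i) := by simp only [wt, hiα, if_false, hsum, this]; ring
      simp [hd', h4] at h3
      omega
    refine ih (∑ t, (if t ∈ X then 0 else d' t)).toNat ?_ hD' ht₁ hdt₁ ?_ ?_
    · omega
    · intro x hx t ht h1 h2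
      exact hc x hx t ht (hX x hx ▸ h1) (h2.trans_le (hle t))
    · omega

/-- The difference of the squared lengths of `ϖ_α` and `ϖ_α - ∑ d_k σ_k`. -/
def normGap (A : Matrix I I ℤ) (δ : I → ℤ) (α : I) (d : I → ℤ) : ℤ :=
  2 * (d α * δ α) - ∑ i, d i * δ i * ∑ k, d k * A k i

/-- The correction vanishes for `k = 0` and for the reflection `k = wt A α d i`, and is nonnegative
in between: the interior of a root string is shorter than its ends. -/
lemma normGap_add_single (hdiag : ∀ i, A i i = 2) {δ : I → ℤ}
    (hδ : ∀ i j, A i j * δ j = A j i * δ i) (i : I) (k : ℤ) :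
    normGap A δ α (d + Pi.single i k) =
      normGap A δ α d + 2 * δ i * k * (wt A α d i - k) := by
  have h1 : ∀ t, ∑ s, (d + Pi.single i k : I → ℤ) s * A s t = ∑ s, d s * A s t + k * A i t := by
    intro t
    simp [add_mul, Finset.sum_add_distrib, Pi.single_apply, ite_mul]
  have h2 : ∑ t, d t * δ t * (k * A i t) = k * δ i * ∑ s, d s * A s i := by
    rw [Finset.mul_sum]
    refine Finset.sum_congr rfl fun t _ => ?_
    linear_combination d t * k * hδ i t
  have h3 : ∑ t, (d + Pi.single i k : I → ℤ) t * δ t *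
      ∑ s, (d + Pi.single i k : I → ℤ) s * A s t =
      ∑ t, d t * δ t * (∑ s, d s * A s t + k * A i t) +
        k * δ i * (∑ s, d s * A s i + k * A i i) := by
    simp_rw [h1]
    simp [add_mul, Finset.sum_add_distrib, Pi.single_apply, ite_mul]
  have h4 : ((d + Pi.single i k : I → ℤ) α) * δ α = d α * δ α + (if i = α then 1 else 0) * k * δ i := by
    by_cases h : i = α
    · subst h; simp; ring
    · simp [h, Ne.symm h]
  simp only [normGap, h3, h4, mul_add, Finset.sum_add_distrib, h2, hdiag, wt]
  ring

lemma normGap_nonneg (hdiag : ∀ i, A i i = 2) {δ : I → ℤ} (hpos : ∀ i, 0 < δ i)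
    (hδ : ∀ i j, A i j * δ j = A j i * δ i) (hd : Depth A α d) : 0 ≤ normGap A δ α d := by
  induction hd with
  | zero => simp [normGap]
  | @step d i k _ hk ih =>
    rw [normGap_add_single hdiag hδ]
    have : 0 ≤ k * (wt A α d i - k) := by
      rcases Set.mem_uIcc.1 hk with h | h
      · exact mul_nonneg h.1 (by omega)
      · exact mul_nonneg_of_nonpos_of_nonpos h.2 (by omega)
    have := mul_nonneg (hpos i).le this
    nlinarith

/-- The vector counting the occurrences of each index in a word. -/
def vec (l : List I) : I → ℤ := fun i => l.count i

@[simp] lemma vec_nil : vec ([] : List I) = 0 := by ext; simp [vec]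

lemma vec_cons (x : I) (l : List I) : vec (x :: l) = vec l + Pi.single x 1 := by
  ext i
  by_cases h : i = x
  · subst h; simp [vec]
  · simp [vec, h, Ne.symm h]

lemma vec_nonneg (l : List I) (i : I) : 0 ≤ vec l i := by simp [vec]

lemma vec_pos {l : List I} {i : I} : 0 < vec l i ↔ i ∈ l := by simp [vec]

lemma vec_eq_zero {l : List I} {i : I} : vec l i = 0 ↔ i ∉ l := by simp [vec, List.count_eq_zero]

lemma push_vec (l : List I) : push f (vec l) = vec (l.map f) := by
  induction l with
  | nil => simp
  | cons x l ih => simp [vec_cons, ih]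

lemma wt_vec (l : List I) (i : I) :
    wt A α (vec l) i = (if i = α then 1 else 0) - (l.map (A · i)).sum := by
  induction l with
  | nil => simp
  | cons x l ih => rw [vec_cons, wt_add_single, ih]; simp; ring

lemma Depth.cons {l : List I} (hl : Depth A α (vec l)) (x : I)
    (h : 1 ≤ (if x = α then 1 else 0) - (l.map (A · x)).sum) : Depth A α (vec (x :: l)) := by
  rw [vec_cons]
  exact hl.add x one_pos.le (by rwa [wt_vec])

lemma Depth.replicate {l : List I} (hl : Depth A α (vec l)) (x : I) (n : ℕ)
    (h : (n : ℤ) ≤ (if x = α then 1 else 0) - (l.map (A · x)).sum) :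
    Depth A α (vec (List.replicate n x ++ l)) := by
  have : vec (List.replicate n x ++ l) = vec l + Pi.single x (n : ℤ) := by
    ext i
    by_cases h : i = x
    · subst h; simp [vec, add_comm]
    · simp [vec, h, List.count_replicate, Ne.symm h]
  rw [this]
  exact hl.add x (by positivity) (by rwa [wt_vec])

/-- Words that list the elements of a connected set, starting from `α`. -/
inductive Conn (A : Matrix I I ℤ) (α : I) : List I → Prop
  | base : Conn A α [α]
  | cons {l : List I} {z s : I} (hl : Conn A α l) (hz : z ∈ l) (hs : s ∉ l) (h : A z s ≠ 0) :
      Conn A α (s :: l)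

lemma Conn.mem {l : List I} (hl : Conn A α l) : α ∈ l := by
  induction hl with
  | base => simp
  | cons _ _ _ _ ih => simp [ih]

lemma Conn.nodup {l : List I} (hl : Conn A α l) : l.Nodup := by
  induction hl with
  | base => simp
  | cons _ _ hs _ ih => simp [hs, ih]

omit [Fintype I] [DecidableEq I] in
lemma map_sum_le_of_mem (hoff : ∀ i j : I, i ≠ j → A i j ≤ 0) {l : List I} {z s : I} (hz : z ∈ l)
    (hs : s ∉ l) : (l.map (A · s)).sum ≤ A z s := by
  induction l with
  | nil => simp at hz
  | cons x l ih =>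
    simp only [List.mem_cons, not_or] at hz hs
    have hnonpos : (l.map (A · s)).sum ≤ 0 := by
      clear ih hz
      induction l with
      | nil => simp
      | cons y l ih =>
        simp only [List.mem_cons, not_or] at hs
        have := ih ⟨hs.1, hs.2.2⟩
        have := hoff y s (Ne.symm hs.2.1)
        simp only [List.map_cons, List.sum_cons]
        linarith
    rw [List.map_cons, List.sum_cons]
    rcases hz with rfl | hz
    · linarith
    · have := ih hz hs.2
      have := hoff x s (Ne.symm hs.1)
      linarith

/-- A neighbour that has not been used yet pairs positively with the weight, because all its terms
in the sum are nonpositive and one of them is at most `-1`. -/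
lemma IsFiniteCartan.depth_cons (hA : IsFiniteCartan A) {l : List I} (hl : Depth A α (vec l))
    (hα : α ∈ l) {z s : I} (hz : z ∈ l) (hs : s ∉ l) (h : A z s ≠ 0) :
    Depth A α (vec (s :: l)) := by
  refine hl.cons s ?_
  have h1 := map_sum_le_of_mem hA.off hz hs
  have h2 := hA.le_neg_one (fun e : z = s => hs (e ▸ hz)) h
  simp [show s ≠ α from fun e => hs (e ▸ hα)]
  linarith

lemma depth_singleton : Depth A α (vec [α]) :=
  (show Depth A α (vec []) by simpa using Depth.zero).cons α (by simp)

lemma Conn.depth (hA : IsFiniteCartan A) {l : List I} (hl : Conn A α l) : Depth A α (vec l) := by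
  induction hl with
  | base => exact depth_singleton
  | cons hl hz hs h ih => exact hA.depth_cons ih hl.mem hz hs h

/-- Only a word that contains every index can have a maximal image. -/
lemma IsFiniteCartan.mem_of_maximal (hA : IsFiniteCartan A)
    (hf : ∀ d, Depth A α d → Depth A' β (push f d)) {l : List I} (hl : Depth A α (vec l))
    (hα : α ∈ l) (hmax : ∀ y, ¬ Depth A' β (vec (y :: l.map f))) (i : I) : i ∈ l := by
  refine hA.conn (· ∈ l) ⟨α, hα⟩ (fun x t hx h => ?_) i
  by_contra ht
  have := hf _ (hA.depth_cons hl hα hx ht h)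
  rw [push_vec] at this
  exact hmax (f t) this

end Depth

/-! ### Acyclicity and the growth of a local isomorphism. -/

section Growth

variable {I I' : Type*} [Fintype I] [DecidableEq I] [Fintype I'] [DecidableEq I']
  {A : Matrix I I ℤ} {A' : Matrix I' I' ℤ} {α : I} {β : I'} {d : I → ℤ} {f : I → I'}

/-- The number of ordered pairs of connected elements of `C`. -/
def edgeCount (A : Matrix I I ℤ) (C : Finset I) : ℕ :=
  ∑ i ∈ C, (C.filter fun k => k ≠ i ∧ A k i ≠ 0).card

lemma IsFiniteCartan.edgeCount_insert (hA : IsFiniteCartan A) {C : Finset I} {i : I} (hi : i ∉ C) :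
    edgeCount A (insert i C) = edgeCount A C + 2 * (C.filter fun k => A k i ≠ 0).card := by
  have h1 : ((insert i C).filter fun k => k ≠ i ∧ A k i ≠ 0) = C.filter fun k => A k i ≠ 0 := by
    ext k
    simp only [Finset.mem_filter, Finset.mem_insert]
    constructor
    · rintro ⟨rfl | h, h1, h2⟩
      · exact absurd rfl h1
      · exact ⟨h, h2⟩
    · rintro ⟨h, h2⟩
      exact ⟨.inr h, fun e => hi (e ▸ h), h2⟩
  have h2 : ∀ j ∈ C, ((insert i C).filter fun k => k ≠ j ∧ A k j ≠ 0).card =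
      (C.filter fun k => k ≠ j ∧ A k j ≠ 0).card + if A j i ≠ 0 then 1 else 0 := by
    intro j hj
    have hij : i ≠ j := fun e => hi (e ▸ hj)
    rw [Finset.filter_insert]
    by_cases h : A j i = 0
    · simp [h, hA.zero _ _ h]
    · have h' : A i j ≠ 0 := hA.ne_zero_symm h
      rw [if_pos ⟨hij, h'⟩, Finset.card_insert_of_notMem (by simp [hi])]
      simp [h]
  rw [edgeCount, Finset.sum_insert hi, h1, Finset.sum_congr rfl h2, Finset.sum_add_distrib,
    ← Finset.card_filter, edgeCount]
  ring

/-- Positivity applied to the indicator function of `C` finds a node with at most one neighbour in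
`C`. Removing it and inducting gives the edge bound of a forest; edges are counted twice. -/
lemma IsFiniteCartan.edgeCount_le (hA : IsFiniteCartan A) {C : Finset I} (hC : C.Nonempty) :
    edgeCount A C + 2 ≤ 2 * C.card := by
  induction hn : C.card generalizing C with
  | zero => simp_all
  | succ n ih =>
    obtain ⟨i, hi, hi'⟩ := hA.pos (fun k => if k ∈ C then 1 else 0)
      (fun k => by split_ifs <;> simp) (fun h => by
        obtain ⟨x, hx⟩ := hC
        simpa [hx] using congrFun h x)
    have hiC : i ∈ C := by
      by_contra h
      simp [h] at hi
    clear hi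
    obtain ⟨C, hi, rfl⟩ : ∃ C', i ∉ C' ∧ C = insert i C' :=
      ⟨C.erase i, by simp, (Finset.insert_erase hiC).symm⟩
    have hdeg : (C.filter fun k => A k i ≠ 0).card ≤ 1 := by
      simp only [ite_mul, one_mul, zero_mul, Finset.sum_ite_mem, Finset.univ_inter,
        Finset.sum_insert hi, hA.diag] at hi'
      have : ∑ k ∈ C, A k i ≤ ∑ k ∈ C, -(if A k i ≠ 0 then 1 else 0) := by
        refine Finset.sum_le_sum fun k hk => ?_
        have hki : k ≠ i := fun e => hi (e ▸ hk)
        split_ifs with h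
        · exact hA.le_neg_one hki h
        · simpa using hA.off k i hki
      rw [Finset.sum_neg_distrib] at this
      rw [Finset.card_filter]
      zify
      linarith
    rw [hA.edgeCount_insert hi]
    rw [Finset.card_insert_of_notMem hi] at hn
    rcases C.eq_empty_or_nonempty with rfl | hne
    · simp [edgeCount]
    · have := ih hne (by omega)
      omega

/-- Each new letter brings at least one edge. With the forest bound this makes a second edge from a
new node to the same connected set impossible. -/
lemma Conn.le_edgeCount (hA : IsFiniteCartan A) {l : List I} (hl : Conn A α l) :
    2 * l.toFinset.card ≤ edgeCount A l.toFinset + 2 := by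
  induction hl with
  | base => simp
  | @cons l z s hl hz hs h ih =>
    have hs' : s ∉ l.toFinset := by simpa using hs
    have : 0 < (l.toFinset.filter fun k => A k s ≠ 0).card :=
      Finset.card_pos.2 ⟨z, by simp [hz, h]⟩
    rw [List.toFinset_cons, hA.edgeCount_insert hs', Finset.card_insert_of_notMem hs']
    omega

/-- The Dynkin diagram has no cycles. -/
lemma Conn.eq_of_adj (hA : IsFiniteCartan A) {l : List I} (hl : Conn A α l) {s x z : I}
    (hs : s ∉ l) (hx : x ∈ l) (hz : z ∈ l) (hxs : A x s ≠ 0) (hzs : A z s ≠ 0) : x = z := by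
  by_contra hne
  have hs' : s ∉ l.toFinset := by simpa using hs
  have h1 := hl.le_edgeCount hA
  have h2 := hA.edgeCount_le (C := insert s l.toFinset) (by simp)
  have h3 : 2 ≤ (l.toFinset.filter fun k => A k s ≠ 0).card := by
    rw [← Finset.card_pair hne]
    refine Finset.card_le_card fun k hk => ?_
    rcases Finset.mem_insert.1 hk with rfl | hk
    · simp [hx, hxs]
    · rw [Finset.mem_singleton] at hk
      subst hk
      simp [hz, hzs]
  rw [hA.edgeCount_insert hs', Finset.card_insert_of_notMem hs'] at h2
  omega

/-- `f` identifies the connected set listed by `l` with its image. -/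
structure IsLocalIso (A : Matrix I I ℤ) (A' : Matrix I' I' ℤ) (f : I → I') (α : I) (l : List I) :
    Prop where
  conn : Conn A α l
  inj : ∀ x ∈ l, ∀ y ∈ l, f x = f y → x = y
  mat : ∀ x ∈ l, ∀ y ∈ l, A' (f x) (f y) = A x y

lemma IsLocalIso.map_conn {l₀ l : List I} (hl : IsLocalIso A A' f α l) (h₀ : Conn A α l₀)
    (hsub : ∀ x ∈ l₀, x ∈ l) : Conn A' (f α) (l₀.map f) := by
  induction h₀ with
  | base => exact .base
  | @cons l₀ z s h₀ hz hs h ih =>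
    simp only [List.mem_cons, forall_eq_or_imp] at hsub
    refine (ih hsub.2).cons (List.mem_map_of_mem hz) (fun hm => ?_) ?_
    · obtain ⟨y, hy, hys⟩ := List.mem_map.1 hm
      exact hs (hl.inj y (hsub.2 y hy) s hsub.1 hys ▸ hy)
    · rwa [hl.mat z (hsub.2 z hz) s hsub.1]

lemma sum_push (d : I → ℤ) (g : I' → ℤ) : ∑ j, push f d j * g j = ∑ i, d i * g (f i) := by
  simp only [push, Finset.sum_mul]
  rw [Finset.sum_comm]
  refine Finset.sum_congr rfl fun i _ => ?_
  simp [ite_mul]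

lemma IsLocalIso.wt_push {l : List I} (hl : IsLocalIso A A' f α l) (hd : ∀ i, i ∉ l → d i = 0)
    {i : I} (hi : i ∈ l) : wt A' (f α) (push f d) (f i) = wt A α d i := by
  have h1 : (f i = f α) ↔ i = α := ⟨hl.inj i hi α hl.conn.mem, fun h => h ▸ rfl⟩
  have h2 : ∑ k, d k * A' (f k) (f i) = ∑ k, d k * A k i := by
    refine Finset.sum_congr rfl fun k _ => ?_
    by_cases hk : k ∈ l
    · rw [hl.mat k hk i hi]
    · simp [hd k hk]
  simp only [wt, h1, sum_push d (fun j => A' j (f i)), h2]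

lemma IsFiniteCartan.le_wt (hA : IsFiniteCartan A) (hd : ∀ i, 0 ≤ d i) {s : I} (hs : d s = 0)
    (z : I) : (if s = α then 1 else 0) - d z * A z s ≤ wt A α d s := by
  have hnonpos : ∀ k, d k * A k s ≤ 0 := by
    intro k
    by_cases hk : k = s
    · simp [hk, hs]
    · exact mul_nonpos_of_nonneg_of_nonpos (hd k) (hA.off k s hk)
  have h : d z * A z s + ∑ k ∈ Finset.univ.erase z, d k * A k s = ∑ k, d k * A k s :=
    Finset.add_sum_erase Finset.univ (fun k => d k * A k s) (Finset.mem_univ z)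
  have h' : ∑ k ∈ Finset.univ.erase z, d k * A k s ≤ 0 := Finset.sum_nonpos fun k _ => hnonpos k
  simp only [wt]
  linarith

/-- A neighbour of a set on which `f` is a local isomorphism has a label outside of the image. -/
lemma IsLocalIso.notMem_of_adj (hA : IsFiniteCartan A) (hA' : IsFiniteCartan A')
    (hf : ∀ d, Depth A α d → Depth A' (f α) (push f d)) {l : List I}
    (hl : IsLocalIso A A' f α l) {x t : I} (hx : x ∈ l) (ht : t ∉ l) (h : A x t ≠ 0) :
    f t ∉ l.map f := by
  obtain ⟨δ, hδ, hsymm⟩ := hA'.symm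
  -- Take a deepest vector supported on `l` whose image is as long as the highest weight.
  -- Reflections in `l` preserve these conditions, so no pairing on `l` is positive.
  obtain ⟨d, ⟨hd, hdl, hdn⟩, hmax⟩ := Set.exists_max_image
    {d | Depth A α d ∧ (∀ i, i ∉ l → d i = 0) ∧ normGap A' δ (f α) (push f d) = 0}
    (fun d => ∑ i, d i) ((hA.finite α).subset fun d hd => hd.1)
    ⟨0, .zero, by simp, by simp [normGap]⟩
  have hnn := hA.nonneg α d hd
  have hw : ∀ i ∈ l, wt A α d i ≤ 0 := by
    intro i hi
    have := hmax (d + Pi.single i (wt A α d i)) ⟨hd.reflect i, fun j hj => ?_, ?_⟩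
    · simpa [Finset.sum_add_distrib] using this
    · simp [hdl j hj, show j ≠ i from fun e => hj (e ▸ hi)]
    · rw [push_add_single, normGap_add_single hA'.diag hsymm, hdn, hl.wt_push hdl hi]
      ring
  -- The support is all of `l`: a missing letter next to a present one would have a positive
  -- pairing.
  have hsupp : ∀ l₀, Conn A α l₀ → (∀ x ∈ l₀, x ∈ l) → ∀ x ∈ l₀, 0 < d x := by
    intro l₀ h₀
    induction h₀ with
    | base =>
      intro hsub x hx
      obtain rfl : x = α := by simpa using hx
      refine (hnn x).lt_of_ne fun h0 => ?_
      have h1 := hA.le_wt (α := x) hnn h0.symm x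
      have h2 := hw x (hsub x hx)
      simp [← h0] at h1
      omega
    | @cons l₀ z s h₀ hz hs hzs ih =>
      intro hsub x hx
      simp only [List.mem_cons, forall_eq_or_imp] at hsub
      rcases List.mem_cons.1 hx with rfl | hx
      · refine (hnn x).lt_of_ne fun h0 => ?_
        have h1 := hA.le_wt (α := α) hnn h0.symm z
        have h2 := hw x hsub.1
        have h3 := ih hsub.2 z hz
        have h4 := hA.le_neg_one (fun e : z = x => hs (e ▸ hz)) hzs
        have : 0 ≤ (if x = α then 1 else 0 : ℤ) := by split_ifs <;> simp
        nlinarith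
      · exact ih hsub.2 x hx
  intro hm
  obtain ⟨i, hi, hit⟩ := List.mem_map.1 hm
  have h1 := hA.le_wt (α := α) hnn (hdl t ht) x
  have h2 := hsupp l hl.conn (fun _ h => h) x hx
  have h3 := hA.le_neg_one (fun e : x = t => ht (e ▸ hx)) h
  have h4 : 0 ≤ (if t = α then 1 else 0 : ℤ) := by split_ifs <;> simp
  -- A step along `t` is possible, but its image is a step along `f i`, where the pairing is
  -- nonpositive. It would lead to a weight longer than the highest one.
  have h5 := normGap_nonneg hA'.diag hδ hsymm (hf _ (hd.add t zero_le_one (by nlinarith)))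
  rw [push_add_single, normGap_add_single hA'.diag hsymm, hdn, ← hit, hl.wt_push hdl hi] at h5
  have := hw i hi
  have := hδ (f i)
  nlinarith

/-- The head of a word is its newest letter, so every letter is the head of some tail of the word.
This provides a connected set in which `x` is the last node to be added. -/
lemma Conn.exists_initial {l : List I} (hl : Conn A α l) {x : I} (hx : x ∈ l) :
    ∃ l₀, (∀ y ∈ x :: l₀, y ∈ l) ∧ Conn A α (x :: l₀) ∧ (l₀ = [] ∨ Conn A α l₀) := by
  induction hl with
  | base =>
    obtain rfl : x = α := by simpa using hx
    exact ⟨[], by simp, .base, .inl rfl⟩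
  | @cons l z s hl hz hs h ih =>
    rcases List.mem_cons.1 hx with rfl | hx
    · exact ⟨l, fun y hy => hy, hl.cons hz hs h, .inr hl⟩
    · obtain ⟨l₀, h1, h2⟩ := ih hx
      exact ⟨l₀, fun y hy => List.mem_cons_of_mem _ (h1 y hy), h2⟩

lemma map_sum_eq_of_unique {l : List I} (hl : l.Nodup) {x : I} (hx : x ∈ l) {g : I → ℤ}
    (h : ∀ z ∈ l, z ≠ x → g z = 0) : (l.map g).sum = g x := by
  rw [← List.sum_toFinset g hl]
  exact Finset.sum_eq_single x (fun z hz hzx => h z (by simpa using hz) hzx)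
    (fun h => absurd (by simpa using hx) h)

/-- The growth step: an edge from the image to the outside lifts to an edge with at most as large
entries of the Cartan matrix. -/
lemma IsLocalIso.exists_lift (hA : IsFiniteCartan A) (hA' : IsFiniteCartan A')
    (hf : ∀ d', Depth A' (f α) d' ↔ ∃ d, Depth A α d ∧ push f d = d') {l : List I}
    (hl : IsLocalIso A A' f α l) {x : I} (hx : x ∈ l) {τ : I'} (hτ : τ ∉ l.map f)
    (hxτ : A' (f x) τ ≠ 0) :
    ∃ s, s ∉ l ∧ f s = τ ∧ A x s ≠ 0 ∧ (∀ z ∈ l, z ≠ x → A z s = 0) ∧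
      A' (f x) τ ≤ A x s ∧ A' τ (f x) ≤ A s x := by
  have hf' : ∀ d, Depth A α d → Depth A' (f α) (push f d) := fun d hd => (hf _).2 ⟨d, hd, rfl⟩
  obtain ⟨l₀, hsub, hx₀, hl₀⟩ := hl.conn.exists_initial hx
  have hxl₀ : x ∉ l₀ := (List.nodup_cons.1 hx₀.nodup).1
  have hQ : Conn A' (f α) ((x :: l₀).map f) := hl.map_conn hx₀ hsub
  have hmapconn := hl.map_conn hl.conn fun _ h => h
  have hτQ : τ ∉ (x :: l₀).map f := fun h => hτ (by
    obtain ⟨y, hy, rfl⟩ := List.mem_map.1 h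
    exact List.mem_map_of_mem (hsub y hy))
  have hfx : f x ∈ (x :: l₀).map f := by simp
  have hfx' : f x ∈ l.map f := List.mem_map_of_mem hx
  have huniq : ∀ u ∈ l.map f, A' u τ ≠ 0 → u = f x := fun u hu h =>
    hmapconn.eq_of_adj hA' hτ hu hfx' h hxτ
  -- Lift the weight given by the image word extended by `τ`. The support of the lift has to leave
  -- `l` through some edge from `z` to `s`.
  obtain ⟨d, hd, hdp⟩ := (hf _).1 ((hQ.cons hfx hτQ hxτ).depth hA')
  have hnn := hA.nonneg α d hd
  have hlab : ∀ t, 0 < d t → f t ∈ τ :: (x :: l₀).map f := by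
    intro t ht
    have := le_push (f := f) hnn t
    rw [hdp] at this
    exact vec_pos.1 (ht.trans_le this)
  obtain ⟨t₀, ht₀, hdt₀⟩ := exists_of_push_pos (f := f) (d := d) (j := τ) (by
    rw [hdp]; exact vec_pos.2 (by simp))
  obtain ⟨z, hz, s, hs, hdz, hds, hzs⟩ := hA.exists_boundary (X := {y | y ∈ l}) hl.conn.mem hd
    (t₀ := t₀) (fun h => hτ (ht₀ ▸ List.mem_map_of_mem h)) hdt₀
  simp only [Set.mem_ofPred_eq] at hz hs
  have hfs : f s = τ := by
    have h1 := hl.notMem_of_adj hA hA' hf' hz hs hzs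
    rcases List.mem_cons.1 (hlab s hds) with h | h
    · exact h
    · obtain ⟨y, hy, hy'⟩ := List.mem_map.1 h
      exact absurd (hy' ▸ List.mem_map_of_mem (hsub y hy)) h1
  -- If the edge left from an earlier letter, `s` could be attached before `x`. In the image, `τ`
  -- would then be linked to a letter other than `f x`, against acyclicity.
  have hzx : z = x := by
    rcases List.mem_cons.1 (hlab z hdz) with h | h
    · exact absurd (h ▸ List.mem_map_of_mem hz) hτ
    obtain ⟨y, hy, hy'⟩ := List.mem_map.1 h
    obtain rfl := hl.inj y (hsub y hy) z hz hy'
    rcases List.mem_cons.1 hy with h | hy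
    · exact h
    exfalso
    have hl₀' : Conn A α l₀ := hl₀.resolve_left (fun e => by simp [e] at hy)
    have h1 := hf' _ ((hl₀'.cons hy (fun h => hs (hsub s (List.mem_cons_of_mem _ h))) hzs).depth hA)
    rw [push_vec, List.map_cons, hfs] at h1
    obtain ⟨u, hu, v, hv, -, hdv, huv⟩ := hA'.exists_boundary (X := {y | y ∈ l₀.map f})
      (List.mem_map_of_mem hl₀'.mem) h1 (t₀ := τ)
      (fun h => hτQ (by simp only [List.map_cons, List.mem_cons]; exact .inr h))
      (vec_pos.2 (by simp))
    simp only [Set.mem_ofPred_eq] at hu hv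
    have hv' : v = τ := by simpa [hv] using vec_pos.1 hdv
    subst hv'
    obtain ⟨w, hw, rfl⟩ := List.mem_map.1 hu
    have hwl := hsub w (List.mem_cons_of_mem _ hw)
    have := hl.inj w hwl x hx (huniq (f w) (List.mem_map_of_mem hwl) huv)
    exact hxl₀ (this ▸ hw)
  subst hzx
  have hsα : s ≠ α := fun e => hs (e ▸ hl.conn.mem)
  have hτα : τ ≠ f α := fun e => hτ (e ▸ List.mem_map_of_mem hl.conn.mem)
  have hun : ∀ w ∈ l, w ≠ z → A w s = 0 := by
    intro w hw hwz
    by_contra hws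
    exact hwz (hl.conn.eq_of_adj hA hs hw hx hws hzs)
  have hsum : ((z :: l₀).map (A · s)).sum = A z s :=
    map_sum_eq_of_unique hx₀.nodup (by simp) fun w hw hwz => hun w (hsub w hw) hwz
  have hsum' : (((z :: l₀).map f).map (A' · τ)).sum = A' (f z) τ := by
    refine map_sum_eq_of_unique hQ.nodup hfx fun u hu huz => ?_
    by_contra hne
    obtain ⟨w, hw, rfl⟩ := List.mem_map.1 hu
    exact huz (huniq _ (List.mem_map_of_mem (hsub w hw)) hne)
  have hneg := hA.le_neg_one (fun e : z = s => hs (e ▸ hx)) hzs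
  refine ⟨s, hs, hfs, hzs, hun, ?_, ?_⟩
  -- Descend along `s` as far as possible and reflect the image in `τ`: the coefficient becomes `A z
  -- s - A' (f z) τ`, which has to be nonnegative.
  · have h1 := hf' _ ((hx₀.depth hA).add s (k := - A z s) (by omega)
      (by rw [wt_vec, hsum]; simp [hsα]))
    rw [push_add_single, push_vec, hfs] at h1
    have h2 := hA'.le_add_wt h1 τ
    rw [wt_add_single, wt_vec, hsum', hA'.diag] at h2
    rw [Pi.add_apply, vec_eq_zero.2 hτQ, Pi.single_eq_same, if_neg hτα] at h2
    omega
  -- Attach `s`, reflect in `z`, and then reflect the image in `f z`. Nonnegativity leaves only the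
  -- case that `f z` disappears from the support, while `τ` stays; but `f z` is the only link of `τ`
  -- to the image of `l`.
  · by_contra! hlt
    have hsz := hA.le_neg_one (fun e : s = z => hs (e ▸ hx)) (hA.ne_zero_symm hzs)
    have h0 := hA.le_add_wt (hx₀.depth hA) z
    have hwz : wt A' (f α) (vec ((z :: l₀).map f)) (f z) = wt A α (vec (z :: l₀)) z := by
      rw [← push_vec]
      exact hl.wt_push (fun i hi => vec_eq_zero.2 fun h => hi (hsub i h)) hx
    have h1z : vec (z :: l₀) z = 1 := by
      simp [vec, List.count_eq_zero.2 hxl₀]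
    have hzQ : vec ((z :: l₀).map f) (f z) = 1 := by
      simp only [vec, List.count_eq_one_of_mem hQ.nodup hfx, Nat.cast_one]
    have hzτ : f z ≠ τ := fun e => hτ (e ▸ hfx')
    set w := wt A α (vec (z :: l₀)) z with hw
    have h1 : Depth A α (vec (s :: z :: l₀)) :=
      (hx₀.cons (by simp) (fun h => hs (hsub s h)) hzs).depth hA
    rw [vec_cons] at h1
    have h2 := hf' _ (h1.add z (k := w - A s z) (by omega) (by simp [hw]))
    rw [push_add_single, push_add_single, push_vec, hfs] at h2
    have h3 := hA'.le_add_wt h2 (f z)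
    have h4 := h2.reflect (f z)
    simp only [wt_add_single, hwz, hA'.diag] at h3 h4
    have h5 : 1 + (w - A s z) + (w - 1 * A' τ (f z) - (w - A s z) * 2) = 0 := by
      simp only [Pi.add_apply, hzQ, Pi.single_eq_same, Pi.single_eq_of_ne hzτ] at h3
      omega
    obtain ⟨u, hu, v, hv, hdu, hdv, huv⟩ := hA'.exists_boundary (X := {y | y ∈ l.map f})
      (List.mem_map_of_mem hl.conn.mem) h4 (t₀ := τ) hτ (by
        have := vec_nonneg ((z :: l₀).map f) τ
        simp [Ne.symm hzτ] at this ⊢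
        omega)
    have hvz : v ≠ f z := fun e => hv (e ▸ hfx')
    have hvτ : v = τ := by
      by_contra hne
      simp [hvz, hne] at hdv
      have := vec_pos.1 hdv
      rw [← List.map_cons] at this
      obtain ⟨y, hy, rfl⟩ := List.mem_map.1 this
      exact hv (List.mem_map_of_mem (hsub y hy))
    subst hvτ
    obtain rfl := huniq u hu huv
    simp only [Pi.add_apply, hzQ, Pi.single_eq_same, Pi.single_eq_of_ne hzτ] at hdu
    omega

/-- Extension of a local isomorphism. -/
lemma IsLocalIso.cons (hA : IsFiniteCartan A) (hA' : IsFiniteCartan A') {l : List I}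
    (hl : IsLocalIso A A' f α l) {x s : I} (hx : x ∈ l) (hs : s ∉ l) (hfs : f s ∉ l.map f)
    (h : A x s ≠ 0) (hun : ∀ z ∈ l, z ≠ x → A z s = 0) (h1 : A' (f x) (f s) = A x s)
    (h2 : A' (f s) (f x) = A s x) : IsLocalIso A A' f α (s :: l) := by
  have hmapconn := hl.map_conn hl.conn fun _ h => h
  have hz : ∀ z ∈ l, A' (f z) (f s) = A z s ∧ A' (f s) (f z) = A s z := by
    intro z hz
    by_cases hzx : z = x
    · subst hzx; exact ⟨h1, h2⟩
    · have h3 := hun z hz hzx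
      have h4 : A' (f z) (f s) = 0 := by
        by_contra h5
        exact hzx (hl.inj z hz x hx (hmapconn.eq_of_adj hA' hfs (List.mem_map_of_mem hz)
          (List.mem_map_of_mem hx) h5 (h1 ▸ h)))
      exact ⟨h4.trans h3.symm, (hA'.zero _ _ h4).trans (hA.zero _ _ h3).symm⟩
  refine ⟨hl.conn.cons hx hs h, ?_, ?_⟩
  · intro y hy w hw e
    rcases List.mem_cons.1 hy with rfl | hy' <;> rcases List.mem_cons.1 hw with rfl | hw'
    · rfl
    · exact absurd (e ▸ List.mem_map_of_mem hw') hfs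
    · exact absurd (e ▸ List.mem_map_of_mem hy') hfs
    · exact hl.inj y hy' w hw' e
  · intro y hy w hw
    rcases List.mem_cons.1 hy with rfl | hy' <;> rcases List.mem_cons.1 hw with rfl | hw'
    · rw [hA.diag, hA'.diag]
    · exact (hz w hw').2
    · exact (hz y hy').1
    · exact hl.mat y hy' w hw'

/-- A local isomorphism onto the whole diagram is an isomorphism. -/
lemma IsLocalIso.isIso (hA : IsFiniteCartan A) (hA' : IsFiniteCartan A')
    (hf : ∀ d, Depth A α d → Depth A' (f α) (push f d)) {l : List I}
    (hl : IsLocalIso A A' f α l) (hsurj : ∀ j, j ∈ l.map f) :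
    Function.Bijective f ∧ ∀ σ τ, A' (f σ) (f τ) = A σ τ := by
  have hmem : ∀ i, i ∈ l := by
    refine hA.conn (· ∈ l) ⟨α, hl.conn.mem⟩ fun x t hx h => ?_
    by_contra ht
    exact hl.notMem_of_adj hA hA' hf hx ht h (hsurj _)
  refine ⟨⟨fun x y e => hl.inj x (hmem x) y (hmem y) e, fun j => ?_⟩,
    fun σ τ => hl.mat σ (hmem σ) τ (hmem τ)⟩
  obtain ⟨x, -, rfl⟩ := List.mem_map.1 (hsurj j)
  exact ⟨x, rfl⟩

lemma IsLocalIso.base (hA : IsFiniteCartan A) (hA' : IsFiniteCartan A') :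
    IsLocalIso A A' f α [α] :=
  ⟨.base, by simp, by simp [hA.diag, hA'.diag]⟩

/-- If the target is simply laced, then `f` is an isomorphism. -/
lemma isIso_of_simplyLaced (hA : IsFiniteCartan A) (hA' : IsFiniteCartan A')
    (hf : ∀ d', Depth A' (f α) d' ↔ ∃ d, Depth A α d ∧ push f d = d')
    (hsl : ∀ i j, -1 ≤ A' i j) :
    Function.Bijective f ∧ ∀ σ τ, A' (f σ) (f τ) = A σ τ := by
  have hf' : ∀ d, Depth A α d → Depth A' (f α) (push f d) := fun d hd => (hf _).2 ⟨d, hd, rfl⟩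
  -- Without entries below `-1` the inequalities of `exists_lift` are equalities, so the local
  -- isomorphism keeps growing. It has distinct letters, hence cannot outgrow the index set.
  have key : ∀ n ≤ Fintype.card I, (Function.Bijective f ∧ ∀ σ τ, A' (f σ) (f τ) = A σ τ) ∨
      ∃ l, l.length = n + 1 ∧ IsLocalIso A A' f α l := by
    intro n
    induction n with
    | zero => exact fun _ => .inr ⟨[α], rfl, .base hA hA'⟩
    | succ n ih =>
      intro hn
      rcases ih (by omega) with h | ⟨l, hln, hl⟩
      · exact .inl h
      by_cases hsurj : ∀ j, j ∈ l.map f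
      · exact .inl (hl.isIso hA hA' hf' hsurj)
      right
      obtain ⟨y, hy, τ, hτ, hyτ⟩ : ∃ y ∈ l.map f, ∃ τ, τ ∉ l.map f ∧ A' y τ ≠ 0 := by
        by_contra! hc
        refine hsurj (hA'.conn (· ∈ l.map f) ⟨f α, List.mem_map_of_mem hl.conn.mem⟩ ?_)
        intro i j hi hij
        by_contra hj
        exact hij (hc i hi j hj)
      obtain ⟨x, hx, rfl⟩ := List.mem_map.1 hy
      obtain ⟨s, hs, rfl, hxs, hun, h1, h2⟩ := hl.exists_lift hA hA' hf hx hτ hyτ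
      have h3 : f x ≠ f s := fun e => hτ (e ▸ hy)
      have h4 : x ≠ s := fun e => hs (e ▸ hx)
      have h5 := hA'.le_neg_one h3 hyτ
      have h6 := hA'.le_neg_one h3.symm (hA'.ne_zero_symm hyτ)
      have h7 := hA.le_neg_one h4 hxs
      have h8 := hA.le_neg_one h4.symm (hA.ne_zero_symm hxs)
      have := hsl (f x) (f s)
      have := hsl (f s) (f x)
      exact ⟨s :: l, by simp [hln], hl.cons hA hA' hx hs hτ hxs hun (by omega) (by omega)⟩
  rcases key _ le_rfl with h | ⟨l, hln, hl⟩
  · exact h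
  · have := List.Nodup.length_le_card hl.conn.nodup
    omega

end Growth

/-! ### Paths, affine obstructions, and the finite diagrams with a multiple edge. -/

section Path

variable {I : Type*} [Fintype I] [DecidableEq I] {A : Matrix I I ℤ} {α : I}

/-- The word `b (n - 1), …, b 1, b 0`. -/
def pathWord (b : ℕ → I) : ℕ → List I
  | 0 => []
  | n + 1 => b n :: pathWord b n

@[simp] lemma pathWord_zero (b : ℕ → I) : pathWord b 0 = [] := rfl

@[simp] lemma pathWord_succ (b : ℕ → I) (n : ℕ) : pathWord b (n + 1) = b n :: pathWord b n := rfl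

lemma mem_pathWord {b : ℕ → I} {n : ℕ} {x : I} : x ∈ pathWord b n ↔ ∃ i < n, b i = x := by
  induction n with
  | zero => simp
  | succ n ih =>
    simp only [pathWord_succ, List.mem_cons, ih]
    constructor
    · rintro (rfl | ⟨i, hi, rfl⟩)
      · exact ⟨n, by omega, rfl⟩
      · exact ⟨i, by omega, rfl⟩
    · rintro ⟨i, hi, rfl⟩
      by_cases h : i = n
      · exact .inl (h ▸ rfl)
      · exact .inr ⟨i, by omega, rfl⟩

lemma sum_map_pathWord (b : ℕ → I) (g : I → ℤ) (n : ℕ) :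
    ((pathWord b n).map g).sum = ∑ i ∈ Finset.range n, g (b i) := by
  induction n with
  | zero => simp
  | succ n ih => rw [Finset.sum_range_succ, pathWord_succ, List.map_cons, List.sum_cons, ih]; ring

lemma map_pathWord {J : Type*} (f : I → J) (b : ℕ → I) (n : ℕ) :
    (pathWord b n).map f = pathWord (f ∘ b) n := by
  induction n with
  | zero => rfl
  | succ n ih => simp [ih]

lemma pathWord_congr {b c : ℕ → I} {n : ℕ} (h : ∀ i < n, b i = c i) :
    pathWord b n = pathWord c n := by
  induction n with
  | zero => rfl
  | succ n ih => simp [ih fun i hi => h i (by omega), h n (by omega)]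

/-- `b 0, …, b (n - 1)` is an induced path in the Dynkin diagram. -/
structure IsPath (A : Matrix I I ℤ) (b : ℕ → I) (n : ℕ) : Prop where
  inj : ∀ i < n, ∀ j < n, b i = b j → i = j
  far : ∀ i j, i + 1 < j → j < n → A (b i) (b j) = 0
  adj : ∀ i, i + 1 < n → A (b i) (b (i + 1)) ≠ 0

lemma IsPath.mono {b : ℕ → I} {n k : ℕ} (h : IsPath A b n) (hk : k ≤ n) : IsPath A b k :=
  ⟨fun i hi j hj => h.inj i (by omega) j (by omega), fun i j hij hj => h.far i j hij (by omega),
    fun i hi => h.adj i (by omega)⟩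

lemma IsPath.congr {b c : ℕ → I} {n : ℕ} (h : IsPath A b n) (hc : ∀ i < n, c i = b i) :
    IsPath A c n := by
  refine ⟨fun i hi j hj => ?_, fun i j hij hj => ?_, fun i hi => ?_⟩
  · rw [hc i hi, hc j hj]; exact h.inj i hi j hj
  · rw [hc i (by omega), hc j hj]; exact h.far i j hij hj
  · rw [hc i (by omega), hc _ hi]; exact h.adj i hi

lemma IsPath.adj' (hA : IsFiniteCartan A) {b : ℕ → I} {n : ℕ} (h : IsPath A b n) {i : ℕ}
    (hi : i + 1 < n) : A (b (i + 1)) (b i) ≠ 0 := hA.ne_zero_symm (h.adj i hi)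

lemma IsPath.far' (hA : IsFiniteCartan A) {b : ℕ → I} {n : ℕ} (h : IsPath A b n) {i j : ℕ}
    (hij : i + 1 < j) (hj : j < n) : A (b j) (b i) = 0 := hA.zero _ _ (h.far i j hij hj)

lemma IsPath.ne {b : ℕ → I} {n : ℕ} (h : IsPath A b n) {i j : ℕ} (hi : i < n) (hj : j < n)
    (hij : i ≠ j) : b i ≠ b j := fun e => hij (h.inj i hi j hj e)

lemma IsPath.conn {b : ℕ → I} {n : ℕ} (h : IsPath A b (n + 1)) :
    Conn A (b 0) (pathWord b (n + 1)) := by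
  induction n with
  | zero => exact .base
  | succ n ih =>
    refine (ih (h.mono (by omega))).cons (z := b n) (by simp) ?_ (h.adj n (by omega))
    rw [mem_pathWord]
    rintro ⟨i, hi, e⟩
    have := h.inj i (by omega) (n + 1) (by omega) e
    omega

lemma IsPath.snoc (hA : IsFiniteCartan A) {b : ℕ → I} {n : ℕ} (h : IsPath A b (n + 1)) {s : I}
    (hs : s ∉ pathWord b (n + 1)) (hns : A (b n) s ≠ 0) :
    IsPath A (Function.update b (n + 1) s) (n + 2) := by
  have hb : ∀ i, i < n + 1 → Function.update b (n + 1) s i = b i := fun i hi =>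
    Function.update_of_ne (by omega) _ _
  have hbs : Function.update b (n + 1) s (n + 1) = s := Function.update_self _ _ _
  have hne : ∀ i < n + 1, b i ≠ s := fun i hi e => hs (mem_pathWord.2 ⟨i, hi, e⟩)
  refine ⟨fun i hi j hj e => ?_, fun i j hij hj => ?_, fun i hi => ?_⟩
  · rcases Nat.lt_succ_iff_lt_or_eq.1 hi with hi' | rfl <;>
      rcases Nat.lt_succ_iff_lt_or_eq.1 hj with hj' | rfl
    · rw [hb i hi', hb j hj'] at e
      exact h.inj i hi' j hj' e
    · rw [hb i hi', hbs] at e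
      exact absurd e (hne i hi')
    · rw [hb j hj', hbs] at e
      exact absurd e.symm (hne j hj')
    · rfl
  · rcases Nat.lt_succ_iff_lt_or_eq.1 hj with hj' | rfl
    · rw [hb i (by omega), hb j hj']
      exact h.far i j hij hj'
    · rw [hb i (by omega), hbs]
      by_contra hne
      have := h.conn.eq_of_adj hA hs (mem_pathWord.2 ⟨i, by omega, rfl⟩)
        (mem_pathWord.2 ⟨n, by omega, rfl⟩) hne hns
      have := h.inj i (by omega) n (by omega) this
      omega
  · rcases Nat.lt_succ_iff_lt_or_eq.1 hi with hi' | hi'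
    · rw [hb i (by omega), hb _ hi']
      exact h.adj i hi'
    · obtain rfl : i = n := by omega
      rwa [hb i (by omega), hbs]

lemma IsFiniteCartan.exists_path (hA : IsFiniteCartan A) (α x : I) :
    ∃ b n, b 0 = α ∧ IsPath A b (n + 1) ∧ b n = x := by
  refine hA.conn (fun x => ∃ b n, b 0 = α ∧ IsPath A b (n + 1) ∧ b n = x)
    ⟨α, fun _ => α, 0, rfl, ⟨fun i hi j hj _ => by omega, fun i j _ _ => by omega,
      fun i hi => by omega⟩, rfl⟩ ?_ x
  rintro x y ⟨b, n, h0, hb, rfl⟩ hxy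
  by_cases hy : y ∈ pathWord b (n + 1)
  · obtain ⟨i, hi, rfl⟩ := mem_pathWord.1 hy
    exact ⟨b, i, h0, hb.mono (by omega), rfl⟩
  · exact ⟨Function.update b (n + 1) y, n + 1, by simpa using h0, hb.snoc hA hy hxy, by simp⟩

lemma IsPath.length_le {b : ℕ → I} {n : ℕ} (h : IsPath A b n) : n ≤ Fintype.card I := by
  have : Function.Injective fun i : Fin n => b i := fun i j e =>
    Fin.ext (h.inj i i.2 j j.2 e)
  simpa using Fintype.card_le_of_injective _ this

lemma sum_vec_mul (l : List I) (t : I) : ∑ k, vec l k * A k t = (l.map (A · t)).sum := by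
  have := wt_vec (A := A) (α := t) l t
  simp only [wt] at this
  linarith

/-- A nonempty word cannot have nonpositive pairings with all of its entries. -/
lemma IsFiniteCartan.false_of_word (hA : IsFiniteCartan A) {l : List I} (hl : l ≠ [])
    (h : ∀ x ∈ l, (l.map (A · x)).sum ≤ 0) : False := by
  obtain ⟨i, hi, hi'⟩ := hA.pos (vec l) (vec_nonneg l) (fun e => by
    obtain ⟨x, hx⟩ := List.exists_mem_of_ne_nil l hl
    have := vec_pos.2 hx
    simp [e] at this)
  rw [sum_vec_mul] at hi'
  exact absurd (h i (vec_pos.1 hi)) (not_le.2 hi')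

/-- A configuration `w` that can terminate a chain of `2`s ending at `c`. -/
structure IsCap (A : Matrix I I ℤ) (w : I → ℤ) (c : I) : Prop where
  nonneg : ∀ l, 0 ≤ w l
  inner : ∀ l, 0 < w l → ∑ k, w k * A k l + 2 * A c l ≤ 0
  outer : ∑ k, w k * A k c ≤ -2

lemma IsFiniteCartan.sum_mul_nonpos (hA : IsFiniteCartan A) {w : I → ℤ} (hw : ∀ l, 0 ≤ w l)
    {i : I} (hi : w i = 0) : ∑ k, w k * A k i ≤ 0 := by
  refine Finset.sum_nonpos fun k _ => ?_
  by_cases hk : k = i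
  · simp [hk, hi]
  · exact mul_nonpos_of_nonneg_of_nonpos (hw k) (hA.off k i hk)

/-- This is the forked end of an affine diagram of type D: coefficient one on both prongs. -/
lemma IsFiniteCartan.exists_cap_fork (hA : IsFiniteCartan A) {c l₁ l₂ : I} (h₁ : l₁ ≠ c)
    (h₂ : l₂ ≠ c) (h₁₂ : l₁ ≠ l₂) (ha₁ : A c l₁ ≠ 0) (ha₂ : A c l₂ ≠ 0) :
    ∃ w, IsCap A w c ∧ ∀ k, k ≠ l₁ → k ≠ l₂ → w k = 0 := by
  have e1 := hA.le_neg_one h₁.symm ha₁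
  have e2 := hA.le_neg_one h₂.symm ha₂
  have e3 := hA.le_neg_one h₁ (hA.ne_zero_symm ha₁)
  have e4 := hA.le_neg_one h₂ (hA.ne_zero_symm ha₂)
  have e5 := hA.off _ _ h₁₂
  have e6 := hA.off _ _ h₁₂.symm
  refine ⟨vec [l₁, l₂], ⟨vec_nonneg _, fun l hl => ?_, ?_⟩, fun k hk₁ hk₂ => ?_⟩
  · rw [sum_vec_mul]
    have := vec_pos.1 hl
    simp only [List.mem_cons, List.not_mem_nil, or_false] at this
    rcases this with rfl | rfl <;> simp [hA.diag] <;> omega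
  · rw [sum_vec_mul]
    simp
    omega
  · rw [vec_eq_zero]; simp [hk₁, hk₂]

/-- This is the end of an affine diagram of type B or C: the coefficient of `l` is two or one,
according to the direction of the multiple edge. -/
lemma IsFiniteCartan.exists_cap_bond (hA : IsFiniteCartan A) {c l : I} (h : l ≠ c)
    (ha : A c l ≤ -2 ∨ A l c ≤ -2) : ∃ w, IsCap A w c ∧ ∀ k, k ≠ l → w k = 0 := by
  rcases ha with ha | ha
  · have e := hA.le_neg_one h (hA.ne_zero_symm (by omega : A c l ≠ 0))
    refine ⟨vec [l, l], ⟨vec_nonneg _, fun k hk => ?_, ?_⟩, fun k hk => ?_⟩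
    · rw [sum_vec_mul]
      have := vec_pos.1 hk
      simp only [List.mem_cons, List.not_mem_nil, or_false, or_self] at this
      subst this
      simp [hA.diag]; omega
    · rw [sum_vec_mul]; simp; omega
    · rw [vec_eq_zero]; simp [hk]
  · have e := hA.le_neg_one h.symm (hA.ne_zero_symm (by omega : A l c ≠ 0))
    refine ⟨vec [l], ⟨vec_nonneg _, fun k hk => ?_, ?_⟩, fun k hk => ?_⟩
    · rw [sum_vec_mul]
      have := vec_pos.1 hk
      simp only [List.mem_cons, List.not_mem_nil, or_false] at this
      subst this
      simp [hA.diag]; omega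
    · rw [sum_vec_mul]; simp; omega
    · rw [vec_eq_zero]; simp [hk]

lemma IsPath.sum_le (hA : IsFiniteCartan A) {b : ℕ → I} {n : ℕ} (h : IsPath A b n) {i : ℕ}
    (hi : i < n) : ∑ k ∈ Finset.range n, A (b k) (b i) ≤
      2 - (if 0 < i then 1 else 0) - (if i + 1 < n then 1 else 0) := by
  have hle : ∀ k ∈ Finset.range n, A (b k) (b i) ≤ (if k = i then 2 else 0) -
      (if k = i - 1 then (if 0 < i then 1 else 0) else 0) - (if k = i + 1 then 1 else 0) := by
    intro k hk
    rw [Finset.mem_range] at hk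
    by_cases h1 : k = i
    · subst h1
      have : ¬ (k = k - 1 ∧ 0 < k) := by omega
      rw [hA.diag]
      split_ifs <;> omega
    by_cases h2 : k + 1 = i
    · subst h2
      have := hA.le_neg_one (h.ne hk hi (by omega)) (h.adj k hi)
      split_ifs <;> omega
    by_cases h3 : k = i + 1
    · subst h3
      have := hA.le_neg_one (h.ne hk hi (by omega)) (h.adj' hA hk)
      split_ifs <;> omega
    · have := hA.off _ _ (h.ne hk hi h1)
      split_ifs <;> omega
  refine (Finset.sum_le_sum hle).trans ?_
  simp only [Finset.sum_sub_distrib, Finset.sum_ite_eq', Finset.mem_range]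
  split_ifs <;> omega

/-- A path cannot be capped at both ends. -/
lemma IsPath.false_of_caps (hA : IsFiniteCartan A) {b : ℕ → I} {n : ℕ}
    (h : IsPath A b (n + 1)) {w w' : I → ℤ} (hw : IsCap A w (b 0)) (hw' : IsCap A w' (b n))
    (hb : ∀ i ≤ n, w (b i) = 0) (hb' : ∀ i ≤ n, w' (b i) = 0) (hd : ∀ l, w l = 0 ∨ w' l = 0) :
    False := by
  -- Twos along the path and a cap at each end: the null vector of an affine diagram. All its
  -- pairings on its support are nonpositive, against positivity.
  obtain ⟨l, hl, hl'⟩ := hA.pos (fun k => w k + w' k + 2 * vec (pathWord b (n + 1)) k)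
    (fun i => by
      have := hw.nonneg i
      have := hw'.nonneg i
      have := vec_nonneg (pathWord b (n + 1)) i
      omega)
    (fun e => by
      have h1 := congrFun e (b 0)
      have h2 : 0 < vec (pathWord b (n + 1)) (b 0) := vec_pos.2 (mem_pathWord.2 ⟨0, by omega, rfl⟩)
      have := hw.nonneg (b 0)
      have := hw'.nonneg (b 0)
      simp only [Pi.zero_apply] at h1
      omega)
  simp only [add_mul, Finset.sum_add_distrib, mul_assoc, ← Finset.mul_sum, sum_vec_mul] at hl hl'
  by_cases hlp : l ∈ pathWord b (n + 1)
  · obtain ⟨i, hi, rfl⟩ := mem_pathWord.1 hlp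
    have h1 := h.sum_le hA hi
    rw [← sum_map_pathWord b (A · (b i))] at h1
    have h2 := hA.sum_mul_nonpos hw.nonneg (hb i (by omega))
    have h3 := hA.sum_mul_nonpos hw'.nonneg (hb' i (by omega))
    have h4 := hw.outer
    have h5 := hw'.outer
    by_cases h0 : i = 0 <;> by_cases hn : i = n
    · subst h0; subst hn; simp only [lt_irrefl, if_false] at h1; omega
    · subst h0; rw [if_pos (by omega : 0 + 1 < n + 1)] at h1; omega
    · subst hn; rw [if_pos (by omega : 0 < i)] at h1; omega
    · rw [if_pos (by omega : 0 < i), if_pos (by omega : i + 1 < n + 1)] at h1; omega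
  · rw [vec_eq_zero.2 hlp] at hl
    have h2 := map_sum_le_of_mem hA.off (mem_pathWord.2 ⟨0, by omega, rfl⟩) hlp
    have h3 := map_sum_le_of_mem hA.off (mem_pathWord.2 ⟨n, by omega, rfl⟩) hlp
    have h6 := hw.nonneg l
    rcases hd l with h0 | h0
    · have h4 := hA.sum_mul_nonpos hw.nonneg h0
      have h5 := hw'.inner l (by omega)
      omega
    · have h4 := hA.sum_mul_nonpos hw'.nonneg h0
      have h5 := hw.inner l (by omega)
      omega

lemma IsPath.false_of_caps' (hA : IsFiniteCartan A) {b : ℕ → I} {n s e : ℕ}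
    (h : IsPath A b n) (hse : s ≤ e) (he : e < n) {w w' : I → ℤ} (hw : IsCap A w (b s))
    (hw' : IsCap A w' (b e)) (hb : ∀ i, s ≤ i → i ≤ e → w (b i) = 0)
    (hb' : ∀ i, s ≤ i → i ≤ e → w' (b i) = 0) (hd : ∀ l, w l = 0 ∨ w' l = 0) : False := by
  have hp : IsPath A (fun i => b (s + i)) (e - s + 1) := by
    refine ⟨fun i hi j hj e => ?_, fun i j hij hj => h.far _ _ (by omega) (by omega),
      fun i hi => h.adj (s + i) (by omega)⟩
    have := h.inj _ (by omega) _ (by omega) e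
    omega
  refine hp.false_of_caps hA (w := w) (w' := w') hw ?_ (fun i hi => hb _ (by omega) (by omega))
    (fun i hi => hb' _ (by omega) (by omega)) hd
  simpa [Nat.add_sub_cancel' hse] using hw'

/-- The edge between `b j` and `b (j + 1)` is not simple. -/
def IsMultiple (A : Matrix I I ℤ) (b : ℕ → I) (j : ℕ) : Prop :=
  A (b j) (b (j + 1)) ≤ -2 ∨ A (b (j + 1)) (b j) ≤ -2

/-- The far ends of the two multiple edges would cap the segment between them. -/
lemma IsPath.multiple_unique (hA : IsFiniteCartan A) {b : ℕ → I} {n i j : ℕ} (h : IsPath A b n)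
    (hi : IsMultiple A b i) (hij : i < j) (hj : IsMultiple A b j) (hjn : j + 1 < n) : False := by
  obtain ⟨w, hw, hw0⟩ := hA.exists_cap_bond (h.ne (by omega) (by omega) (by omega) :
    b i ≠ b (i + 1)) hi.symm
  obtain ⟨w', hw', hw0'⟩ := hA.exists_cap_bond (h.ne (by omega) (by omega) (by omega) :
    b (j + 1) ≠ b j) hj
  refine h.false_of_caps' hA (s := i + 1) (e := j) (by omega) (by omega) hw hw'
    (fun k _ _ => hw0 _ (h.ne (by omega) (by omega) (by omega)))
    (fun k _ _ => hw0' _ (h.ne (by omega) (by omega) (by omega))) fun l => ?_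
  by_cases hl : l = b i
  · exact .inr (hw0' l (hl ▸ h.ne (by omega) (by omega) (by omega)))
  · exact .inl (hw0 l hl)

/-- The segment between the fork and the multiple edge would be capped by the two prongs pointing
away and by the far end of the multiple edge. -/
lemma IsPath.false_of_fork (hA : IsFiniteCartan A) {b : ℕ → I} {n i j : ℕ} (h : IsPath A b n)
    (hj : IsMultiple A b j) (hjn : j + 1 < n) (hi : 0 < i) (hin : i + 1 < n) {t : I}
    (ht : t ∉ pathWord b n) (hit : A (b i) t ≠ 0) : False := by
  have hbt : ∀ k < n, b k ≠ t := fun k hk e => ht (mem_pathWord.2 ⟨k, hk, e⟩)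
  rcases le_or_gt i j with hij | hij
  · obtain ⟨i, rfl⟩ := Nat.exists_eq_add_of_lt hi
    simp only [zero_add] at *
    obtain ⟨w, hw, hw0⟩ := hA.exists_cap_fork (c := b (i + 1)) (l₁ := b i) (l₂ := t)
      (h.ne (by omega) (by omega) (by omega)) (hbt _ (by omega)).symm (hbt _ (by omega))
      (h.adj' hA (by omega)) hit
    obtain ⟨w', hw', hw0'⟩ := hA.exists_cap_bond (h.ne (by omega) (by omega) (by omega) :
      b (j + 1) ≠ b j) hj
    refine h.false_of_caps' hA hij (by omega) hw hw'
      (fun k _ _ => hw0 _ (h.ne (by omega) (by omega) (by omega)) (hbt _ (by omega)))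
      (fun k _ _ => hw0' _ (h.ne (by omega) (by omega) (by omega))) fun l => ?_
    by_cases hl : l = b (j + 1)
    · exact .inl (hw0 l (hl ▸ h.ne (by omega) (by omega) (by omega)) (hl ▸ hbt _ (by omega)))
    · exact .inr (hw0' l hl)
  · obtain ⟨w, hw, hw0⟩ := hA.exists_cap_fork (c := b i) (l₁ := b (i + 1)) (l₂ := t)
      (h.ne (by omega) (by omega) (by omega)) (hbt _ (by omega)).symm (hbt _ (by omega))
      (h.adj _ (by omega)) hit
    obtain ⟨w', hw', hw0'⟩ := hA.exists_cap_bond (h.ne (by omega) (by omega) (by omega) :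
      b j ≠ b (j + 1)) hj.symm
    refine h.false_of_caps' hA (s := j + 1) (e := i) (by omega) (by omega) hw' hw
      (fun k _ _ => hw0' _ (h.ne (by omega) (by omega) (by omega)))
      (fun k _ _ => hw0 _ (h.ne (by omega) (by omega) (by omega)) (hbt _ (by omega))) fun l => ?_
    by_cases hl : l = b j
    · exact .inr (hw0 l (hl ▸ h.ne (by omega) (by omega) (by omega)) (hl ▸ hbt _ (by omega)))
    · exact .inl (hw0' l hl)

/-- The coefficients `1, 2, 3, 4, 2` and `1, 2, 3, 2, 1` are the null vectors of the two affine
diagrams that extend F₄, one for each direction of the double edge. Smaller entries only lower the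
pairings. -/
lemma IsFiniteCartan.false_of_f4 (hA : IsFiniteCartan A) {x₁ x₂ x₃ x₄ x₅ : I}
    (hnd : [x₁, x₂, x₃, x₄, x₅].Nodup) (h12 : A x₁ x₂ ≠ 0) (h23 : A x₂ x₃ ≠ 0)
    (h34 : A x₃ x₄ ≤ -2 ∨ A x₄ x₃ ≤ -2) (h45 : A x₄ x₅ ≠ 0) : False := by
  simp only [List.nodup_cons, List.mem_cons, List.not_mem_nil, or_false, not_or, not_false_eq_true,
    List.nodup_nil, and_true] at hnd
  obtain ⟨⟨n12, n13, n14, n15⟩, ⟨n23, n24, n25⟩, ⟨n34, n35⟩, n45⟩ := hnd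
  have h34' : A x₃ x₄ ≠ 0 := by
    rcases h34 with h | h
    · omega
    · exact hA.ne_zero_symm (by omega)
  have a12 := hA.le_neg_one n12 h12
  have a21 := hA.le_neg_one (Ne.symm n12) (hA.ne_zero_symm h12)
  have a23 := hA.le_neg_one n23 h23
  have a32 := hA.le_neg_one (Ne.symm n23) (hA.ne_zero_symm h23)
  have a34 := hA.le_neg_one n34 h34'
  have a43 := hA.le_neg_one (Ne.symm n34) (hA.ne_zero_symm h34')
  have a45 := hA.le_neg_one n45 h45
  have a54 := hA.le_neg_one (Ne.symm n45) (hA.ne_zero_symm h45)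
  have b13 := hA.off _ _ n13
  have b14 := hA.off _ _ n14
  have b15 := hA.off _ _ n15
  have b24 := hA.off _ _ n24
  have b25 := hA.off _ _ n25
  have b35 := hA.off _ _ n35
  have c13 := hA.off _ _ (Ne.symm n13)
  have c14 := hA.off _ _ (Ne.symm n14)
  have c15 := hA.off _ _ (Ne.symm n15)
  have c24 := hA.off _ _ (Ne.symm n24)
  have c25 := hA.off _ _ (Ne.symm n25)
  have c35 := hA.off _ _ (Ne.symm n35)
  rcases h34 with h34 | h34
  · refine hA.false_of_word (l := [x₁, x₂, x₂, x₃, x₃, x₃, x₄, x₄, x₄, x₄, x₅, x₅]) (by simp) ?_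
    simp [hA.diag]
    omega
  · refine hA.false_of_word (l := [x₁, x₂, x₂, x₃, x₃, x₃, x₄, x₄, x₅]) (by simp) ?_
    simp [hA.diag]
    omega

/-- The coefficients `1, 2, 3` and `1, 2, 1` are the null vectors of the two affine diagrams that
extend G₂. -/
lemma IsFiniteCartan.false_of_triple (hA : IsFiniteCartan A) {x₁ x₂ x₃ : I}
    (hnd : [x₁, x₂, x₃].Nodup) (h12 : A x₁ x₂ ≠ 0) (h23 : A x₂ x₃ ≤ -3 ∨ A x₃ x₂ ≤ -3) : False := by
  simp only [List.nodup_cons, List.mem_cons, List.not_mem_nil, or_false, not_or, not_false_eq_true,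
    List.nodup_nil, and_true] at hnd
  obtain ⟨⟨n12, n13⟩, n23⟩ := hnd
  have h23' : A x₂ x₃ ≠ 0 := by
    rcases h23 with h | h
    · omega
    · exact hA.ne_zero_symm (by omega)
  have a12 := hA.le_neg_one n12 h12
  have a21 := hA.le_neg_one (Ne.symm n12) (hA.ne_zero_symm h12)
  have a23 := hA.le_neg_one n23 h23'
  have a32 := hA.le_neg_one (Ne.symm n23) (hA.ne_zero_symm h23')
  have b13 := hA.off _ _ n13
  have c13 := hA.off _ _ (Ne.symm n13)
  rcases h23 with h23 | h23
  · refine hA.false_of_word (l := [x₁, x₂, x₂, x₃, x₃, x₃]) (by simp) ?_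
    simp [hA.diag]
    omega
  · refine hA.false_of_word (l := [x₁, x₂, x₂, x₃]) (by simp) ?_
    simp [hA.diag]
    omega

/-- Only the entries `-1, -2, -3` occur, and one of each opposite pair is `-1`. -/
lemma IsFiniteCartan.entries (hA : IsFiniteCartan A) {x y : I} (hxy : x ≠ y) :
    -3 ≤ A x y ∧ (-1 ≤ A x y ∨ -1 ≤ A y x) := by
  constructor
  · by_contra! h
    have h' := hA.le_neg_one hxy.symm (hA.ne_zero_symm (by omega : A x y ≠ 0))
    refine hA.false_of_word (l := [x, y, y]) (by simp) ?_
    simp [hA.diag]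
    omega
  · by_contra! h
    refine hA.false_of_word (l := [x, y]) (by simp) ?_
    simp [hA.diag]
    omega

/-- The classification of the diagrams with a multiple edge, as seen from an extremal node. -/
lemma IsFiniteCartan.exists_path_of_multiple (hA : IsFiniteCartan A)
    (hα : ∀ s t, s ≠ α → t ≠ α → A α s ≠ 0 → A α t ≠ 0 → s = t) {u v : I} (huv : u ≠ v)
    (hm : A u v ≤ -2) :
    ∃ b m j, b 0 = α ∧ IsPath A b m ∧ (∀ x, ∃ i < m, b i = x) ∧ j + 1 < m ∧
      (∀ i, i + 1 < m → i ≠ j → A (b i) (b (i + 1)) = -1 ∧ A (b (i + 1)) (b i) = -1) ∧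
      ((j = 0 ∧ m = 2 ∧ (A (b 0) (b 1) = -3 ∧ A (b 1) (b 0) = -1 ∨
          A (b 0) (b 1) = -1 ∧ A (b 1) (b 0) = -3)) ∨
        (j = 0 ∨ j + 2 = m ∨ j = 1 ∧ m = 4) ∧ (A (b j) (b (j + 1)) = -2 ∧ A (b (j + 1)) (b j) = -1 ∨
          A (b j) (b (j + 1)) = -1 ∧ A (b (j + 1)) (b j) = -2)) := by
  obtain ⟨b₀, n₀, j₀, h0₀, hb₀, hj₀, hjn₀⟩ : ∃ b n j, b 0 = α ∧ IsPath A b n ∧ IsMultiple A b j ∧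
      j + 1 < n := by
    obtain ⟨b, n, h0, hb, rfl⟩ := hA.exists_path α u
    by_cases hv : v ∈ pathWord b (n + 1)
    · obtain ⟨i, hi, rfl⟩ := mem_pathWord.1 hv
      have hin : i ≠ n := fun e => huv (e ▸ rfl)
      have : i + 1 = n := by
        by_contra hne
        have := hb.far' hA (i := i) (j := n) (by omega) (by omega)
        omega
      subst this
      exact ⟨b, i + 1 + 1, i, h0, hb, .inr hm, by omega⟩
    · refine ⟨Function.update b (n + 1) v, n + 2, n, by simpa using h0, hb.snoc hA hv (by omega),
        .inl ?_, by omega⟩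
      simpa using hm
  -- A longest path from `α` with a multiple edge covers the diagram: a further node cannot be
  -- attached to `α`, which has at most one neighbour, nor inside (`false_of_fork`), nor at the far
  -- end.
  obtain ⟨m, ⟨b, j, h0, hb, hj, hjm⟩, hmax⟩ : ∃ m, (∃ b j, b 0 = α ∧ IsPath A b m ∧
      IsMultiple A b j ∧ j + 1 < m) ∧ ∀ b j, b 0 = α → IsPath A b (m + 1) → IsMultiple A b j →
      j + 1 < m + 1 → False := by
    classical
    let p : ℕ → Prop := fun m => ∃ b j, b 0 = α ∧ IsPath A b m ∧ IsMultiple A b j ∧ j + 1 < m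
    have h1 : p (Nat.findGreatest p (Fintype.card I)) :=
      Nat.findGreatest_spec hb₀.length_le ⟨b₀, j₀, h0₀, hb₀, hj₀, hjn₀⟩
    refine ⟨_, h1, fun b j h0 hb hj hjm => ?_⟩
    have := Nat.le_findGreatest (P := p) hb.length_le ⟨b, j, h0, hb, hj, hjm⟩
    exact Nat.not_succ_le_self _ this
  have hcov : ∀ x, x ∈ pathWord b m := by
    refine hA.conn (· ∈ pathWord b m) ⟨b 0, mem_pathWord.2 ⟨0, by omega, rfl⟩⟩ fun x t hx h => ?_
    by_contra ht
    obtain ⟨i, hi, rfl⟩ := mem_pathWord.1 hx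
    have hbt : ∀ k < m, b k ≠ t := fun k hk e => ht (mem_pathWord.2 ⟨k, hk, e⟩)
    by_cases hi0 : i = 0
    · subst hi0
      rw [h0] at h
      refine hbt 1 (by omega) (hα _ _ (h0 ▸ hb.ne (by omega) (by omega) (by omega))
        (h0 ▸ (hbt 0 (by omega)).symm) (h0 ▸ hb.adj 0 (by omega)) h)
    by_cases him : i + 1 = m
    · subst him
      refine hmax (Function.update b (i + 1) t) j (by simpa using h0) (hb.snoc hA ht h) ?_
        (by omega)
      simp only [IsMultiple]
      rwa [Function.update_of_ne (by omega), Function.update_of_ne (by omega)]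
    · exact hb.false_of_fork hA hj hjm (by omega) (by omega) ht h
  have hnd : ∀ i k, i < m → k < m → i ≠ k → b i ≠ b k := fun i k hi hk => hb.ne hi hk
  have hsimple : ∀ i, i + 1 < m → i ≠ j →
      A (b i) (b (i + 1)) = -1 ∧ A (b (i + 1)) (b i) = -1 := by
    intro i hi hij
    have h1 := hA.le_neg_one (hb.ne (by omega) hi (by omega)) (hb.adj i hi)
    have h2 := hA.le_neg_one (hb.ne hi (by omega) (by omega)) (hb.adj' hA hi)
    have h3 : ¬ IsMultiple A b i := fun h => by
      rcases lt_or_gt_of_ne hij with hlt | hlt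
      · exact hb.multiple_unique hA h hlt hj hjm
      · exact hb.multiple_unique hA hj hlt h hi
    simp only [IsMultiple] at h3
    omega
  refine ⟨b, m, j, h0, hb, fun x => mem_pathWord.1 (hcov x), hjm, hsimple, ?_⟩
  have hne := hb.ne (i := j) (j := j + 1) (by omega) hjm (by omega)
  have e1 := hA.entries hne
  have e2 := hA.entries hne.symm
  have e3 := hA.le_neg_one hne (hb.adj j hjm)
  have e4 := hA.le_neg_one hne.symm (hb.adj' hA hjm)
  by_cases htr : A (b j) (b (j + 1)) ≤ -3 ∨ A (b (j + 1)) (b j) ≤ -3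
  · have hj0 : j = 0 := by
      by_contra hj0
      obtain ⟨k, rfl⟩ := Nat.exists_eq_succ_of_ne_zero hj0
      refine hA.false_of_triple (x₁ := b k) (x₂ := b (k + 1)) (x₃ := b (k + 1 + 1)) ?_
        (hb.adj k (by omega)) htr
      simp [hnd k (k + 1) (by omega) (by omega) (by omega),
        hnd k (k + 1 + 1) (by omega) (by omega) (by omega),
        hnd (k + 1) (k + 1 + 1) (by omega) (by omega) (by omega)]
    subst hj0
    have hm2 : m = 2 := by
      by_contra hm2
      refine hA.false_of_triple (x₁ := b 2) (x₂ := b 1) (x₃ := b 0) ?_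
        (hb.adj' hA (i := 1) (by omega)) htr.symm
      simp [hnd 2 1 (by omega) (by omega) (by omega), hnd 2 0 (by omega) (by omega) (by omega),
        hnd 1 0 (by omega) (by omega) (by omega)]
    left
    refine ⟨rfl, hm2, ?_⟩
    simp only [zero_add] at e1 e2 e3 e4 htr
    omega
  · right
    refine ⟨?_, ?_⟩
    · by_contra hc
      have hj1 : 1 ≤ j := by omega
      obtain ⟨k, rfl⟩ : ∃ k, j = k + 1 := ⟨j - 1, by omega⟩
      by_cases hk : k = 0
      · subst hk
        refine hA.false_of_f4 (x₁ := b 4) (x₂ := b 3) (x₃ := b 2) (x₄ := b 1) (x₅ := b 0) ?_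
          (hb.adj' hA (i := 3) (by omega)) (hb.adj' hA (i := 2) (by omega)) hj.symm
          (hb.adj' hA (i := 0) (by omega))
        simp [hnd 4 3 (by omega) (by omega) (by omega), hnd 4 2 (by omega) (by omega) (by omega),
          hnd 4 1 (by omega) (by omega) (by omega), hnd 4 0 (by omega) (by omega) (by omega),
          hnd 3 2 (by omega) (by omega) (by omega), hnd 3 1 (by omega) (by omega) (by omega),
          hnd 3 0 (by omega) (by omega) (by omega), hnd 2 1 (by omega) (by omega) (by omega),
          hnd 2 0 (by omega) (by omega) (by omega), hnd 1 0 (by omega) (by omega) (by omega)]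
      · obtain ⟨k, rfl⟩ : ∃ i, k = i + 1 := ⟨k - 1, by omega⟩
        refine hA.false_of_f4 (x₁ := b k) (x₂ := b (k + 1)) (x₃ := b (k + 2)) (x₄ := b (k + 3))
          (x₅ := b (k + 4)) ?_ (hb.adj _ (by omega)) (hb.adj _ (by omega)) hj
          (hb.adj _ (by omega))
        simp [hnd k (k + 1) (by omega) (by omega) (by omega),
          hnd k (k + 2) (by omega) (by omega) (by omega),
          hnd k (k + 3) (by omega) (by omega) (by omega),
          hnd k (k + 4) (by omega) (by omega) (by omega),
          hnd (k + 1) (k + 2) (by omega) (by omega) (by omega),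
          hnd (k + 1) (k + 3) (by omega) (by omega) (by omega),
          hnd (k + 1) (k + 4) (by omega) (by omega) (by omega),
          hnd (k + 2) (k + 3) (by omega) (by omega) (by omega),
          hnd (k + 2) (k + 4) (by omega) (by omega) (by omega),
          hnd (k + 3) (k + 4) (by omega) (by omega) (by omega)]
    · simp only [IsMultiple] at hj
      omega

/-- An irreducible finite diagram has an extremal node. -/
lemma IsFiniteCartan.exists_extremal (hA : IsFiniteCartan A) (hcard : 2 ≤ Fintype.card I) :
    ∃ α, ∃! τ, τ ≠ α ∧ A α τ ≠ 0 := by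
  by_contra! hc
  -- The node with positive column sum cannot have two neighbours, and by connectedness it has one.
  obtain ⟨i, -, hi⟩ := hA.pos (fun _ => 1) (fun _ => zero_le_one) (fun h => by
    have : Nonempty I := Fintype.card_pos_iff.1 (by omega)
    simpa using congrFun h (Classical.arbitrary I))
  obtain ⟨x, hxi⟩ : ∃ x, x ≠ i ∧ A i x ≠ 0 := by
    by_contra! h
    obtain ⟨y, hy⟩ := Fintype.exists_ne_of_one_lt_card (by omega) i
    refine hy (hA.conn (· = i) ⟨i, rfl⟩ (fun j k hj hk => ?_) y)
    subst hj
    by_contra hne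
    exact hk (h k hne)
  obtain ⟨y, hy, hyx⟩ : ∃ y, (y ≠ i ∧ A i y ≠ 0) ∧ y ≠ x := by
    by_contra! h
    exact hc i ⟨x, hxi, fun y hy => h y hy⟩
  have h1 := hA.le_neg_one hxi.1 (hA.ne_zero_symm hxi.2)
  have h2 := hA.le_neg_one hy.1 (hA.ne_zero_symm hy.2)
  have h3 : ∀ k, 1 * A k i ≤ (if k = i then 2 else 0) - (if k = x then 1 else 0) -
      (if k = y then 1 else 0) := by
    intro k
    by_cases hki : k = i
    · subst hki; simp [hA.diag, hxi.1.symm, hy.1.symm]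
    by_cases hkx : k = x
    · subst hkx; simp [hki, hyx.symm, h1]
    by_cases hky : k = y
    · subst hky; simp [hki, hkx, h2]
    · simp [hki, hkx, hky, hA.off k i hki]
  have := Finset.sum_le_sum fun k (_ : k ∈ Finset.univ) => h3 k
  simp only [Finset.sum_sub_distrib, Finset.sum_ite_eq', Finset.mem_univ, if_true] at this
  omega

end Path

/-! ### Labelings of Cartan matrices, and the edge at which an isomorphism fails. -/

section Fold

variable {I I' : Type*} [Fintype I] [DecidableEq I] [Fintype I'] [DecidableEq I']
  {A : Matrix I I ℤ} {A' : Matrix I' I' ℤ} {α : I} {β : I'} {d : I → ℤ} {f : I → I'}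

/-- `α` is connected to exactly one other index. -/
def IsLeaf (A : Matrix I I ℤ) (α : I) : Prop := ∃! τ, τ ≠ α ∧ A α τ ≠ 0

lemma IsLeaf.eq (h : IsLeaf A α) {s t : I} (hs : s ≠ α) (ht : t ≠ α) (hs' : A α s ≠ 0)
    (ht' : A α t ≠ 0) : s = t := h.unique ⟨hs, hs'⟩ ⟨ht, ht'⟩

lemma exists_ne_of_not_isLeaf {x y : I} (h : ¬ IsLeaf A x) (hy : y ≠ x) (hxy : A x y ≠ 0) :
    ∃ z, z ≠ x ∧ z ≠ y ∧ A x z ≠ 0 := by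
  by_contra! hc
  refine h ⟨y, ⟨hy, hxy⟩, fun z hz => ?_⟩
  by_contra hzy
  exact hz.2 (hc z hz.1 hzy)

/-- The combinatorial form of the hypotheses on a labeling `f`. -/
structure IsLabeling (A : Matrix I I ℤ) (A' : Matrix I' I' ℤ) (f : I → I') : Prop where
  left : IsFiniteCartan A
  right : IsFiniteCartan A'
  leaf : ∀ α, IsLeaf A α → IsLeaf A' (f α)
  depth_iff : ∀ α, IsLeaf A α → ∀ d', Depth A' (f α) d' ↔ ∃ d, Depth A α d ∧ push f d = d'

lemma IsLabeling.depth_push (h : IsLabeling A A' f) (hα : IsLeaf A α) (hd : Depth A α d) :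
    Depth A' (f α) (push f d) := (h.depth_iff α hα _).2 ⟨d, hd, rfl⟩

lemma IsLabeling.depth_map (h : IsLabeling A A' f) (hα : IsLeaf A α) {l : List I}
    (hl : Depth A α (vec l)) : Depth A' (f α) (vec (l.map f)) := push_vec (f := f) l ▸ h.depth_push hα hl

/-- `f` is an isomorphism of diagrams. -/
def IsIso (A : Matrix I I ℤ) (A' : Matrix I' I' ℤ) (f : I → I') : Prop :=
  Function.Bijective f ∧ ∀ σ τ, A' (f σ) (f τ) = A σ τ

/-- Up to enumeration of the index sets, `f` is the map `g` between `B` and `B'`. -/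
def Form (A : Matrix I I ℤ) (A' : Matrix I' I' ℤ) (f : I → I') {n m : ℕ}
    (B : Matrix (Fin n) (Fin n) ℤ) (B' : Matrix (Fin m) (Fin m) ℤ) (g : Fin n → ℕ) : Prop :=
  ∃ (e : Fin n ≃ I) (e' : Fin m ≃ I'), (∀ i j, A (e i) (e j) = B i j) ∧
    (∀ i j, A' (e' i) (e' j) = B' i j) ∧ ∀ i, ((e'.symm (f (e i)) : Fin m) : ℕ) = g i

/-- `b 0, …, b (m - 1)` lists the whole diagram, a path in which all edges are simple except
possibly the one between `b j` and `b (j + 1)`. -/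
structure IsBondPath (A : Matrix I I ℤ) (b : ℕ → I) (m j : ℕ) : Prop extends IsPath A b m where
  cover : ∀ x, ∃ i < m, b i = x
  lt : j + 1 < m
  simple : ∀ i, i + 1 < m → i ≠ j → A (b i) (b (i + 1)) = -1 ∧ A (b (i + 1)) (b i) = -1

lemma IsBondPath.reverse (hA : IsFiniteCartan A) {b : ℕ → I} {m j : ℕ} (h : IsBondPath A b m j) :
    IsBondPath A (fun i => b (m - 1 - i)) m (m - 2 - j) := by
  have hlt := h.lt
  refine ⟨⟨fun i hi k hk e => ?_, fun i k hik hk => ?_, fun i hi => ?_⟩, fun x => ?_, by omega,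
    fun i hi hij => ?_⟩
  · have := h.inj _ (by omega) _ (by omega) e
    omega
  · exact h.toIsPath.far' hA (by omega) (by omega)
  · have := h.toIsPath.adj' hA (i := m - 1 - (i + 1)) (by omega)
    rwa [show m - 1 - (i + 1) + 1 = m - 1 - i by omega] at this
  · obtain ⟨i, hi, rfl⟩ := h.cover x
    exact ⟨m - 1 - i, by omega, by simp only [show m - 1 - (m - 1 - i) = i by omega]⟩
  · have := h.simple (m - 1 - (i + 1)) (by omega) (by omega)
    rw [show m - 1 - (i + 1) + 1 = m - 1 - i by omega] at this
    exact this.symm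

/-- The enumeration of the diagram that a path provides. -/
noncomputable def IsPath.equiv {b : ℕ → I} {n : ℕ} (h : IsPath A b n) (hc : ∀ x, ∃ i < n, b i = x) :
    Fin n ≃ I :=
  Equiv.ofBijective (fun i => b i) ⟨fun i j e => Fin.ext (h.inj i i.2 j j.2 e), fun x => by
    obtain ⟨i, hi, rfl⟩ := hc x
    exact ⟨⟨i, hi⟩, rfl⟩⟩

@[simp] lemma IsPath.equiv_apply {b : ℕ → I} {n : ℕ} (h : IsPath A b n)
    (hc : ∀ x, ∃ i < n, b i = x) (i : Fin n) : h.equiv hc i = b i := rfl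

/-- A path with simple edges. -/
structure IsSimplePath (A : Matrix I I ℤ) (b : ℕ → I) (n : ℕ) : Prop extends IsPath A b n where
  simple : ∀ i, i + 1 < n → A (b i) (b (i + 1)) = -1 ∧ A (b (i + 1)) (b i) = -1

lemma IsSimplePath.snoc (hA : IsFiniteCartan A) {b : ℕ → I} {n : ℕ} (h : IsSimplePath A b (n + 1))
    {s : I} (hs : s ∉ pathWord b (n + 1)) (h1 : A (b n) s = -1) (h2 : A s (b n) = -1) :
    IsSimplePath A (Function.update b (n + 1) s) (n + 2) := by
  refine ⟨h.toIsPath.snoc hA hs (by omega), fun i hi => ?_⟩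
  by_cases hin : i = n
  · subst hin
    rw [Function.update_of_ne (by omega), Function.update_self]
    exact ⟨h1, h2⟩
  · rw [Function.update_of_ne (by omega), Function.update_of_ne (by omega)]
    exact h.simple i (by omega)

lemma pathWord_update (b : ℕ → I) (n : ℕ) (s : I) :
    pathWord (Function.update b n s) n = pathWord b n :=
  pathWord_congr fun i hi => Function.update_of_ne (by omega) _ _

/-- Unless `f` is an isomorphism, it restricts to a map from a path of `L` onto the initial part of
the path of `J`, and preserves all edges but the last one. -/
lemma IsLabeling.exists_fold (h : IsLabeling A A' f) (hα : IsLeaf A α) {b : ℕ → I'} {m j : ℕ}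
    (hb : IsBondPath A' b m j) (h0 : b 0 = f α) : IsIso A A' f ∨ ∃ p : ℕ → I, p 0 = α ∧
      IsPath A p (j + 2) ∧ (∀ i < j + 2, f (p i) = b i) ∧
      (∀ i < j, A (p i) (p (i + 1)) = -1 ∧ A (p (i + 1)) (p i) = -1) ∧
      A' (b j) (b (j + 1)) ≤ A (p j) (p (j + 1)) ∧ A' (b (j + 1)) (b j) ≤ A (p (j + 1)) (p j) ∧
      (A' (b j) (b (j + 1)) ≠ A (p j) (p (j + 1)) ∨
        A' (b (j + 1)) (b j) ≠ A (p (j + 1)) (p j)) := by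
  by_contra! hc
  have hlt := hb.lt
  -- Without a fold the local isomorphism grows along `b` up to its end: simple edges lift to simple
  -- edges since the entries can only increase, and at the edge `j` equality is what the negated
  -- conclusion supplies.
  have key : ∀ k < m, ∃ p : ℕ → I, p 0 = α ∧ IsLocalIso A A' f α (pathWord p (k + 1)) ∧
      ∀ i < k + 1, f (p i) = b i := by
    intro k
    induction k with
    | zero => exact fun _ => ⟨fun _ => α, rfl, .base h.left h.right, fun i hi => by
        rw [show i = 0 by omega, h0]⟩
    | succ k ih =>
      intro hk
      obtain ⟨p, hp0, hl, hlab⟩ := ih (by omega)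
      have hmem : p k ∈ pathWord p (k + 1) := by simp
      have hτ : b (k + 1) ∉ (pathWord p (k + 1)).map f := by
        rw [map_pathWord, mem_pathWord]
        rintro ⟨i, hi, e⟩
        have := hb.inj i (by omega) (k + 1) hk (by rw [← e, Function.comp, hlab i hi])
        omega
      obtain ⟨s, hs, hfs, hks, hun, h1, h2⟩ := hl.exists_lift h.left h.right
        (h.depth_iff α hα) hmem hτ (by rw [hlab k (by omega)]; exact hb.adj k hk)
      rw [hlab k (by omega)] at h1 h2
      have hmat : ∀ i < k + 1, ∀ l < k + 1, A (p i) (p l) = A' (b i) (b l) := fun i hi l hl' => by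
        rw [← hl.mat _ (mem_pathWord.2 ⟨i, hi, rfl⟩) _ (mem_pathWord.2 ⟨l, hl', rfl⟩), hlab i hi,
          hlab l hl']
      have hpath : IsPath A p (k + 1) := by
        refine ⟨fun i hi l hl' e => hb.inj i (by omega) l (by omega) ?_, fun i l hil hl' => ?_,
          fun i hi => ?_⟩
        · rw [← hlab i hi, ← hlab l hl', e]
        · rw [hmat _ (by omega) _ hl', hb.far i l hil (by omega)]
        · rw [hmat _ (by omega) _ hi]; exact hb.adj i (by omega)
      have hup : ∀ i < k + 1, Function.update p (k + 1) s i = p i := fun i hi =>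
        Function.update_of_ne (by omega) _ _
      have hlab' : ∀ i < k + 1 + 1, f (Function.update p (k + 1) s i) = b i := by
        intro i hi
        rcases Nat.lt_succ_iff_lt_or_eq.1 hi with hi' | rfl
        · rw [hup i hi', hlab i hi']
        · rw [Function.update_self, hfs]
      refine ⟨Function.update p (k + 1) s, by rw [hup 0 (by omega), hp0], ?_, hlab'⟩
      have hent : A' (b k) (b (k + 1)) = A (p k) s ∧ A' (b (k + 1)) (b k) = A s (p k) := by
        by_cases hkj : k = j
        · subst hkj
          have := hc.2 (Function.update p (k + 1) s) (by rw [hup 0 (by omega), hp0])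
            (hpath.snoc h.left hs hks) hlab' (fun i hi => by
              rw [hup i (by omega), hup (i + 1) (by omega), hmat i (by omega) _ (by omega),
                hmat _ (by omega) i (by omega)]
              exact hb.simple i (by omega) (by omega))
          rw [hup k (by omega), Function.update_self] at this
          exact this h1 h2
        · have h3 := hb.simple k hk hkj
          have hne : p k ≠ s := fun e => hs (e ▸ hmem)
          have := h.left.le_neg_one hne hks
          have := h.left.le_neg_one hne.symm (h.left.ne_zero_symm hks)
          omega
      rw [pathWord_succ, pathWord_update, Function.update_self]
      exact hl.cons h.left h.right hmem hs (hfs.symm ▸ hτ) hks hun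
        (by rw [hfs, hlab k (by omega)]; exact hent.1)
        (by rw [hfs, hlab k (by omega)]; exact hent.2)
  obtain ⟨p, -, hl, hlab⟩ := key (m - 1) (by omega)
  refine hc.1 (hl.isIso h.left h.right (fun d hd => h.depth_push hα hd) fun x => ?_)
  obtain ⟨i, hi, rfl⟩ := hb.cover x
  exact List.mem_map.2 ⟨p i, mem_pathWord.2 ⟨i, by omega, rfl⟩, hlab i (by omega)⟩

lemma sum_vec (l : List I) : ∑ i, vec l i = l.length := by
  induction l with
  | nil => simp
  | cons x l ih => simp [vec_cons, Finset.sum_add_distrib, ih]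

/-- A criterion for the vectors `vec (pathWord c k)`, for `k ≤ N`, to contain all depth vectors. -/
lemma Depth.exists_eq_pathWord {c : ℕ → I} {N : ℕ}
    (h : ∀ k ≤ N, ∀ i, wt A α (vec (pathWord c k)) i = 0 ∨
      (wt A α (vec (pathWord c k)) i = 1 ∧ k + 1 ≤ N ∧ c k = i) ∨
      (wt A α (vec (pathWord c k)) i = 2 ∧ k + 2 ≤ N ∧ c k = i ∧ c (k + 1) = i) ∨
      (wt A α (vec (pathWord c k)) i = -1 ∧ 1 ≤ k ∧ c (k - 1) = i) ∨
      (wt A α (vec (pathWord c k)) i = -2 ∧ 2 ≤ k ∧ c (k - 1) = i ∧ c (k - 2) = i))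
    (hd : Depth A α d) : ∃ k ≤ N, d = vec (pathWord c k) := by
  have hs : ∀ k, vec (pathWord c (k + 1)) = vec (pathWord c k) + Pi.single (c k) 1 := fun k => by
    rw [pathWord_succ, vec_cons]
  induction hd with
  | zero => exact ⟨0, by omega, by simp⟩
  | @step d i x _ hx ih =>
    obtain ⟨k, hk, rfl⟩ := ih
    rcases h k hk i with e | ⟨e, h1, rfl⟩ | ⟨e, h1, h2, h3⟩ | ⟨e, h1, h2⟩ | ⟨e, h1, h2, h3⟩ <;>
      rw [e, Set.mem_uIcc] at hx
    · obtain rfl : x = 0 := by omega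
      exact ⟨k, hk, by simp⟩
    · obtain rfl | rfl : x = 0 ∨ x = 1 := by omega
      · exact ⟨k, hk, by simp⟩
      · exact ⟨k + 1, h1, (hs k).symm⟩
    · obtain rfl | rfl | rfl : x = 0 ∨ x = 1 ∨ x = 2 := by omega
      · exact ⟨k, hk, by simp⟩
      · exact ⟨k + 1, by omega, by rw [hs, h2]⟩
      · refine ⟨k + 2, by omega, ?_⟩
        rw [hs, hs, h2, h3, add_assoc, ← Pi.single_add]
        rfl
    · obtain ⟨k, rfl⟩ := Nat.exists_eq_add_of_le' h1
      rw [Nat.add_sub_cancel] at h2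
      obtain rfl | rfl : x = 0 ∨ x = -1 := by omega
      · exact ⟨k + 1, hk, by simp⟩
      · exact ⟨k, by omega, by rw [hs, h2, add_assoc, ← Pi.single_add]; simp⟩
    · obtain ⟨k, rfl⟩ := Nat.exists_eq_add_of_le' h1
      rw [show k + 2 - 1 = k + 1 by omega] at h2
      rw [Nat.add_sub_cancel] at h3
      have h4 := hs (k + 1)
      rw [show k + 1 + 1 = k + 2 by omega] at h4
      obtain rfl | rfl | rfl : x = 0 ∨ x = -1 ∨ x = -2 := by omega
      · exact ⟨k + 2, hk, by simp⟩
      · exact ⟨k + 1, by omega, by rw [h4, h2, add_assoc, ← Pi.single_add]; simp⟩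
      · refine ⟨k, by omega, ?_⟩
        rw [h4, hs, h2, h3, add_assoc, add_assoc, ← Pi.single_add, ← Pi.single_add]
        simp

end Fold

/-! ### Targets whose weights form a chain; types A and C. -/

section Chain

variable {I I' : Type*} [Fintype I] [DecidableEq I] [Fintype I'] [DecidableEq I']
  {A : Matrix I I ℤ} {A' : Matrix I' I' ℤ} {α : I} {β : I'} {d : I → ℤ} {f : I → I'}

/-- The depth vectors are the `vec (pathWord c k)` for `k ≤ N`. -/
structure IsChain (A : Matrix I I ℤ) (α : I) (c : ℕ → I) (N : ℕ) : Prop where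
  sub : ∀ d, Depth A α d → ∃ k ≤ N, d = vec (pathWord c k)
  top : Depth A α (vec (pathWord c N))

@[simp] lemma length_pathWord (b : ℕ → I) (n : ℕ) : (pathWord b n).length = n := by
  induction n with
  | zero => rfl
  | succ n ih => simp [ih]

lemma wt_pathWord_succ (c : ℕ → I) (k : ℕ) (i : I) :
    wt A α (vec (pathWord c (k + 1))) i = wt A α (vec (pathWord c k)) i - A (c k) i := by
  rw [pathWord_succ, vec_cons, wt_add_single, one_mul]

lemma IsChain.eq_vec {c : ℕ → I} {N : ℕ} (h : IsChain A α c N) {l : List I}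
    (hl : Depth A α (vec l)) : l.length ≤ N ∧ vec l = vec (pathWord c l.length) := by
  obtain ⟨k, hk, e⟩ := h.sub _ hl
  have h1 := sum_vec l
  rw [e, sum_vec, length_pathWord] at h1
  have h2 : k = l.length := by exact_mod_cast h1
  exact ⟨h2 ▸ hk, h2 ▸ e⟩

variable {c : ℕ → I'} {N : ℕ}

/-- The labels of the steps are determined by the depth. -/
lemma IsChain.label (h : IsLabeling A A' f) (hα : IsLeaf A α) (hc : IsChain A' (f α) c N)
    {l : List I} {x : I} (hl : Depth A α (vec l)) (hx : Depth A α (vec (x :: l))) :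
    l.length + 1 ≤ N ∧ f x = c l.length := by
  have h1 := hc.eq_vec (h.depth_map hα hl)
  have h2 := hc.eq_vec (h.depth_map hα hx)
  simp only [List.map_cons, List.length_cons, List.length_map] at h1 h2
  refine ⟨h2.1, ?_⟩
  have h3 := h2.2
  rw [pathWord_succ, vec_cons, vec_cons, h1.2, add_right_inj] at h3
  by_contra hne
  have := congrFun h3 (f x)
  simp [hne] at this

lemma IsPath.depth (hA : IsFiniteCartan A) {p : ℕ → I} {k : ℕ} (hp : IsPath A p k)
    (h0 : p 0 = α) : Depth A α (vec (pathWord p k)) := by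
  cases k with
  | zero => simpa using Depth.zero
  | succ k => exact h0 ▸ hp.conn.depth hA

lemma IsPath.label (h : IsLabeling A A' f) (hα : IsLeaf A α) (hc : IsChain A' (f α) c N)
    {p : ℕ → I} {k : ℕ} (hp : IsPath A p k) (h0 : p 0 = α) {i : ℕ} (hi : i < k) :
    i + 1 ≤ N ∧ f (p i) = c i := by
  have := hc.label h hα ((hp.mono hi.le).depth h.left h0)
    (pathWord_succ p i ▸ (hp.mono hi).depth h.left h0)
  rwa [length_pathWord] at this

/-- The node `t` can be subtracted directly after `p i`, or after `p (i + 1)`. So it carries the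
labels of two consecutive depths. -/
lemma IsPath.label_fork (h : IsLabeling A A' f) (hα : IsLeaf A α) (hc : IsChain A' (f α) c N)
    {p : ℕ → I} {k : ℕ} (hp : IsPath A p k) (h0 : p 0 = α) {i : ℕ} (hi : i + 1 < k) {t : I}
    (ht : t ∉ pathWord p k) (hit : A (p i) t ≠ 0) :
    i + 3 ≤ N ∧ f t = c (i + 1) ∧ c (i + 2) = c (i + 1) := by
  have hmem : p i ∈ pathWord p (i + 1) := by simp
  have ht' : t ∉ pathWord p (i + 2) := fun hm => by
    obtain ⟨s, hs, e⟩ := mem_pathWord.1 hm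
    exact ht (mem_pathWord.2 ⟨s, by omega, e⟩)
  have ht'' : t ∉ pathWord p (i + 1) := fun hm => ht' (by
    rw [pathWord_succ]; exact List.mem_cons_of_mem _ hm)
  have hc1 := (hp.mono (k := i + 1) (by omega)).conn
  have hc2 := (hp.mono (k := i + 1 + 1) (by omega)).conn
  rw [h0] at hc1 hc2
  have h1 := hc.label h hα (hc1.depth h.left) ((hc1.cons hmem ht'' hit).depth h.left)
  have h2 := hc.label h hα (hc2.depth h.left)
    ((hc2.cons (List.mem_cons_of_mem _ hmem) ht' hit).depth h.left)
  rw [length_pathWord] at h1 h2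
  exact ⟨h2.1, h1.2, h2.2.symm.trans h1.2⟩

/-- Here `p (k + 1)` can be subtracted twice in a row. -/
lemma IsPath.label_bond (h : IsLabeling A A' f) (hα : IsLeaf A α) (hc : IsChain A' (f α) c N)
    {p : ℕ → I} {k : ℕ} (hp : IsPath A p (k + 2)) (h0 : p 0 = α)
    (hk : A (p k) (p (k + 1)) ≤ -2) : k + 3 ≤ N ∧ c (k + 2) = c (k + 1) := by
  have h1 := hp.depth h.left h0
  have h2 := (hp.mono (k := k + 1) (by omega)).depth h.left h0
  have hn : p (k + 1) ∉ pathWord p (k + 1) := fun hm => by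
    obtain ⟨s, hs, e⟩ := mem_pathWord.1 hm
    have := hp.inj s (by omega) (k + 1) (by omega) e
    omega
  have hne : p (k + 1) ≠ α := h0 ▸ hp.ne (by omega) (by omega) (by omega)
  have h3 := map_sum_le_of_mem h.left.off (z := p k) (by simp) hn
  have h4 := h2.replicate (p (k + 1)) 2 (by
    rw [if_neg hne]
    push_cast
    omega)
  have h5 := hc.label h hα h1 h4
  rw [length_pathWord] at h5
  exact ⟨h5.1, by rw [← h5.2, (hp.label h hα hc h0 (i := k + 1) (by omega)).2]⟩

lemma IsPath.one_le_wt (hA : IsFiniteCartan A) {p : ℕ → I} {k : ℕ} (hp : IsPath A p (k + 1))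
    (h0 : p 0 = α) : -1 ≤ (if p k = α then 1 else 0) -
      ((pathWord p (k + 1)).map (A · (p k))).sum := by
  have h1 := hp.sum_le hA (i := k) (by omega)
  rw [← sum_map_pathWord p (A · (p k)), if_neg (by omega : ¬ k + 1 < k + 1)] at h1
  by_cases hk : k = 0
  · subst hk
    rw [if_pos h0]
    rw [if_neg (by omega)] at h1
    omega
  · rw [if_pos (by omega)] at h1
    split_ifs <;> omega

/-- Here `p k` can be subtracted again directly after `p (k + 1)`. -/
lemma IsPath.label_bond' (h : IsLabeling A A' f) (hα : IsLeaf A α) (hc : IsChain A' (f α) c N)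
    {p : ℕ → I} {k : ℕ} (hp : IsPath A p (k + 2)) (h0 : p 0 = α)
    (hk : A (p (k + 1)) (p k) ≤ -2) : k + 3 ≤ N ∧ c (k + 2) = c k := by
  have h1 := hp.depth h.left h0
  have h2 := (hp.mono (k := k + 1) (by omega)).one_le_wt h.left h0
  have h5 := hc.label h hα h1 (h1.cons (p k) (by
    rw [pathWord_succ, List.map_cons, List.sum_cons]
    omega))
  rw [length_pathWord] at h5
  exact ⟨h5.1, by rw [← h5.2, (hp.label h hα hc h0 (i := k) (by omega)).2]⟩

lemma IsSimplePath.entry (hA : IsFiniteCartan A) {p : ℕ → I} {n : ℕ} (hp : IsSimplePath A p n)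
    {i k : ℕ} (hi : i < n) (hk : k < n) :
    A (p i) (p k) = if i = k then 2 else if i + 1 = k ∨ k + 1 = i then -1 else 0 := by
  split_ifs with h1 h2
  · rw [h1, hA.diag]
  · rcases h2 with rfl | rfl
    · exact (hp.simple i hk).1
    · exact (hp.simple k hi).2
  · rcases lt_or_gt_of_ne h1 with h3 | h3
    · exact hp.far i k (by omega) hk
    · exact hp.toIsPath.far' hA (by omega) hi

lemma IsBondPath.entry (hA : IsFiniteCartan A) {b : ℕ → I} {m j : ℕ} (hb : IsBondPath A b m j)
    {x y : ℤ} (hx : A (b j) (b (j + 1)) = x) (hy : A (b (j + 1)) (b j) = y)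
    {i k : ℕ} (hi : i < m) (hk : k < m) :
    A (b i) (b k) = if i = k then 2 else if i + 1 = k then (if i = j then x else -1) else
      if k + 1 = i then (if k = j then y else -1) else 0 := by
  split_ifs with h1 h2 h3 h4 h5
  · rw [h1, hA.diag]
  · subst h3; subst h2; exact hx
  · subst h2; exact (hb.simple i hk h3).1
  · subst h5; subst h4; exact hy
  · subst h4; exact (hb.simple k hi h5).2
  · rcases lt_or_gt_of_ne h1 with h3 | h3
    · exact hb.far i k (by omega) hk
    · exact hb.toIsPath.far' hA (by omega) hi

/-- The standard representation of type A: after `k` steps the pairing is `1` with the next node,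
`-1` with the previous one, and `0` otherwise. -/
lemma IsSimplePath.isChain (hA : IsFiniteCartan A) {p : ℕ → I} {n : ℕ} (hp : IsSimplePath A p n)
    (hcov : ∀ x, ∃ i < n, p i = x) (h0 : p 0 = α) : IsChain A α p n := by
  refine ⟨fun d => Depth.exists_eq_pathWord ?_, hp.toIsPath.depth hA h0⟩
  intro k hk i
  obtain ⟨t, ht, rfl⟩ := hcov i
  have key : ∀ k ≤ n, wt A α (vec (pathWord p k)) (p t) =
      (if t = k then 1 else 0) - (if t + 1 = k then 1 else 0) := by
    intro k
    induction k with
    | zero =>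
      intro _
      have : p t = α ↔ t = 0 := by
        rw [← h0]
        exact ⟨hp.inj t ht 0 (by omega), fun e => by rw [e]⟩
      simp [this]
    | succ k ih =>
      intro hk
      rw [wt_pathWord_succ, ih (by omega), hp.entry hA hk ht]
      split_ifs <;> omega
  rw [key k hk]
  by_cases h1 : t = k
  · subst h1; simp; omega
  by_cases h2 : t + 1 = k
  · subst h2; simp
  · simp [h1, h2]

/-- A path of length at least `n₀` that grows without forks and multiple edges exhausts the
diagram. -/
lemma IsSimplePath.exists_cover (hA : IsFiniteCartan A) {p : ℕ → I} {n₀ : ℕ}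
    (hp : IsSimplePath A p n₀) (hn₀ : 1 ≤ n₀) (h0 : p 0 = α)
    (hfork : ∀ k p i t, n₀ ≤ k → IsSimplePath A p k → p 0 = α → i + 1 < k → t ∉ pathWord p k →
      A (p i) t = 0)
    (hbond : ∀ k p, n₀ ≤ k + 1 → IsPath A p (k + 2) → p 0 = α →
      -1 ≤ A (p k) (p (k + 1)) ∧ -1 ≤ A (p (k + 1)) (p k)) :
    ∃ p n, n₀ ≤ n ∧ IsSimplePath A p n ∧ p 0 = α ∧ ∀ x, ∃ i < n, p i = x := by
  by_contra! hc
  have key : ∀ k, ∃ p, IsSimplePath A p (n₀ + k) ∧ p 0 = α := by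
    intro k
    induction k with
    | zero => exact ⟨p, hp, h0⟩
    | succ k ih =>
      obtain ⟨p, hp, h0⟩ := ih
      obtain ⟨n, hn⟩ : ∃ n, n₀ + k = n + 1 := ⟨n₀ + k - 1, by omega⟩
      obtain ⟨y, hy⟩ := hc p (n₀ + k) (by omega) hp h0
      obtain ⟨x, hx, t, ht, hxt⟩ : ∃ x ∈ pathWord p (n₀ + k), ∃ t, t ∉ pathWord p (n₀ + k) ∧
          A x t ≠ 0 := by
        by_contra! h1
        have := hA.conn (· ∈ pathWord p (n₀ + k)) ⟨p 0, mem_pathWord.2 ⟨0, by omega, rfl⟩⟩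
          (fun i j hi hij => by
            by_contra hj
            exact hij (h1 i hi j hj)) y
        obtain ⟨i, hi, e⟩ := mem_pathWord.1 this
        exact hy i hi e
      obtain ⟨i, hi, rfl⟩ := mem_pathWord.1 hx
      have hin : i = n := by
        by_contra hne
        exact hxt (hfork (n₀ + k) p i t (by omega) hp h0 (by omega) ht)
      subst hin
      rw [hn] at hp ht
      have hp' := hp.toIsPath.snoc hA ht hxt
      have h3 := hbond i _ (by omega) hp' (by simpa using h0)
      have h4 := hp'.adj i (by omega)
      have h5 := hp'.adj' hA (i := i) (by omega)
      have h6 := hp'.ne (i := i) (j := i + 1) (by omega) (by omega) (by omega)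
      have h7 := hA.le_neg_one h6 h4
      have h8 := hA.le_neg_one h6.symm h5
      have h9 : Function.update p (i + 1) t i = p i := Function.update_of_ne (by omega) _ _
      rw [h9, Function.update_self] at h3 h7 h8
      refine ⟨Function.update p (i + 1) t, ?_, by simpa using h0⟩
      rw [show n₀ + (k + 1) = i + 2 by omega]
      exact hp.snoc hA ht (by omega) (by omega)
  obtain ⟨p, hp, -⟩ := key (Fintype.card I + 1)
  have := hp.length_le
  omega

/-- If the smaller diagram is a simple path, then it has as many nodes as the chain has steps. -/
lemma IsSimplePath.length_eq (h : IsLabeling A A' f) (hα : IsLeaf A α) (hc : IsChain A' (f α) c N)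
    {p : ℕ → I} {n : ℕ} (hp : IsSimplePath A p n) (h0 : p 0 = α)
    (hcov : ∀ x, ∃ i < n, p i = x) : n = N := by
  refine le_antisymm ?_ ?_
  · cases n with
    | zero => omega
    | succ n => exact (hp.toIsPath.label h hα hc h0 (i := n) (by omega)).1
  · obtain ⟨d, hd, e⟩ := (h.depth_iff α hα _).1 hc.top
    obtain ⟨k, hk, rfl⟩ := (hp.isChain h.left hcov h0).sub d hd
    rw [push_vec] at e
    have h1 := sum_vec ((pathWord p k).map f)
    rw [e, sum_vec, length_pathWord, List.length_map, length_pathWord] at h1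
    omega

lemma IsSimplePath.form (h : IsLabeling A A' f) (hα : IsLeaf A α) (hc : IsChain A' (f α) c N)
    {p : ℕ → I} {n : ℕ} (hp : IsSimplePath A p n) (h0 : p 0 = α)
    (hcov : ∀ x, ∃ i < n, p i = x) {m : ℕ} {B' : Matrix (Fin m) (Fin m) ℤ} (e' : Fin m ≃ I')
    (he' : ∀ i j, A' (e' i) (e' j) = B' i j) {g : ℕ → ℕ}
    (hg : ∀ i < N, ((e'.symm (c i) : Fin m) : ℕ) = g i) :
    Form A A' f (CartanMatrix.A N) B' (fun i => g i) := by
  obtain rfl := hp.length_eq h hα hc h0 hcov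
  refine ⟨hp.toIsPath.equiv hcov, e', fun i j => ?_, he', fun i => ?_⟩
  · simp only [IsPath.equiv_apply, hp.entry h.left i.2 j.2, CartanMatrix.A, Matrix.of_apply,
      Fin.ext_iff]
  · rw [IsPath.equiv_apply, (hp.toIsPath.label h hα hc h0 i.2).2, hg i i.2]

/-- Type `A_{2m-1} → C_m`. -/
lemma IsLabeling.form_typeC (h : IsLabeling A A' f) (hα : IsLeaf A α) {b : ℕ → I'} {m : ℕ}
    (hb : IsBondPath A' b (m + 2) m) (h0 : b 0 = f α) (h1 : A' (b m) (b (m + 1)) = -1)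
    (h2 : A' (b (m + 1)) (b m) = -2) : IsIso A A' f ∨
      Form A A' f (CartanMatrix.A (2 * (m + 2) - 1)) (CartanMatrix.C (m + 2))
        (fun i => min (i : ℕ) (2 * (m + 2) - 2 - i)) := by
  have hA' := h.right
  obtain ⟨g, hg⟩ : ∃ g : ℕ → ℕ, ∀ i, g i = min i (2 * m + 2 - i) := ⟨_, fun _ => rfl⟩
  -- The vector representation of C: the labels run to the long node, which occurs once, and back.
  have hc : IsChain A' (f α) (fun k => b (g k)) (2 * m + 3) := by
    have hsub : ∀ k ≤ 2 * m + 3, ∀ t < m + 2, wt A' (f α) (vec (pathWord (fun k => b (g k)) k)) (b t)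
        = (if k < 2 * m + 3 ∧ g k = t then 1 else 0) -
          (if 1 ≤ k ∧ g (k - 1) = t then 1 else 0) := by
      intro k hk t ht
      induction k with
      | zero =>
        have : b t = f α ↔ t = 0 := by
          rw [← h0]
          exact ⟨hb.inj t ht 0 (by omega), fun e => by rw [e]⟩
        simp [this, hg, eq_comm]
      | succ k ih =>
        rw [wt_pathWord_succ, ih (by omega), hb.entry hA' h1 h2 (by rw [hg]; omega) ht]
        simp only [hg, Nat.add_sub_cancel]
        rcases lt_or_ge k (m + 1) with hk' | hk'
        · rw [show min k (2 * m + 2 - k) = k by omega,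
            show min (k - 1) (2 * m + 2 - (k - 1)) = k - 1 by omega]
          split_ifs <;> omega
        · rw [show min k (2 * m + 2 - k) = 2 * m + 2 - k by omega,
            show min (k + 1) (2 * m + 2 - (k + 1)) = 2 * m + 2 - (k + 1) by omega]
          split_ifs <;> omega
    refine ⟨fun d => Depth.exists_eq_pathWord ?_, ?_⟩
    · intro k hk i
      obtain ⟨t, ht, rfl⟩ := hb.cover i
      rw [hsub k hk t ht]
      by_cases h3 : k < 2 * m + 3 ∧ g k = t
      · by_cases h4 : 1 ≤ k ∧ g (k - 1) = t
        · rw [if_pos h3, if_pos h4]; simp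
        · rw [if_pos h3, if_neg h4]
          exact .inr (.inl ⟨by simp, h3.1, by rw [h3.2]⟩)
      · by_cases h4 : 1 ≤ k ∧ g (k - 1) = t
        · rw [if_neg h3, if_pos h4]
          exact .inr (.inr (.inr (.inl ⟨by simp, h4.1, by rw [h4.2]⟩)))
        · rw [if_neg h3, if_neg h4]; simp
    · have : ∀ k ≤ 2 * m + 3, Depth A' (f α) (vec (pathWord (fun k => b (g k)) k)) := by
        intro k
        induction k with
        | zero => exact fun _ => by simpa using Depth.zero
        | succ k ih =>
          intro hk
          refine (ih (by omega)).cons _ ?_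
          rw [← wt_vec, hsub k (by omega) _ (by rw [hg]; omega), if_pos ⟨by omega, rfl⟩,
            if_neg (by rw [hg, hg]; omega)]
          simp
      exact this _ le_rfl
  rcases h.exists_fold hα hb h0 with hiso | ⟨p, hp0, hp, -, hs, h3, h4, h5⟩
  · exact .inl hiso
  right
  have hne := hp.ne (i := m) (j := m + 1) (by omega) (by omega) (by omega)
  have h6 := h.left.le_neg_one hne (hp.adj m (by omega))
  have h7 := h.left.le_neg_one hne.symm (hp.adj' h.left (by omega))
  have hinj : ∀ i k, i < m + 2 → k < m + 2 → b i = b k → i = k := fun i k hi hk =>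
    hb.inj i hi k hk
  have hps : IsSimplePath A p (m + 2) := ⟨hp, fun i hi => by
    rcases Nat.lt_succ_iff_lt_or_eq.1 (show i < m + 1 by omega) with hi' | rfl
    · exact hs i hi'
    · omega⟩
  -- Consecutive labels always differ, and labels two steps apart agree only around the long node,
  -- for `k = m`. Since the path already has `m + 2` nodes, only `k ≥ m + 1` matters.
  obtain ⟨p, n, -, hp, hp0, hcov⟩ := hps.exists_cover h.left (by omega) hp0
    (fun k p i t _ hp hp0 hi ht => by
      by_contra hne
      have := hp.toIsPath.label_fork h hα hc hp0 hi ht hne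
      have := hinj _ _ (by rw [hg]; omega) (by rw [hg]; omega) this.2.2
      rw [hg, hg] at this
      omega)
    (fun k p hk hp hp0 => by
      constructor
      · by_contra! hlt
        have := hp.label_bond h hα hc hp0 (by omega)
        have := hinj _ _ (by rw [hg]; omega) (by rw [hg]; omega) this.2
        rw [hg, hg] at this
        omega
      · by_contra! hlt
        have := hp.label_bond' h hα hc hp0 (by omega)
        have := hinj _ _ (by rw [hg]; omega) (by rw [hg]; omega) this.2
        rw [hg, hg] at this
        omega)
  refine (?_ : _ → _) (hp.form h hα hc hp0 hcov (hb.equiv hb.cover)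
    (B' := CartanMatrix.C (m + 2)) (g := g) (fun i j => ?_) (fun i hi => ?_))
  · intro hF
    obtain rfl : g = fun i => min i (2 * m + 2 - i) := funext hg
    exact hF
  · rw [IsPath.equiv_apply, IsPath.equiv_apply, hb.entry hA' h1 h2 i.2 j.2]
    simp only [CartanMatrix.C, Matrix.of_apply, Fin.ext_iff]
    split_ifs <;> omega
  · have : b (g i) = hb.equiv hb.cover ⟨g i, by rw [hg]; omega⟩ := rfl
    rw [this, Equiv.symm_apply_apply]

end Chain

/-! ### Target B over the long end: sources of type A and D. -/

section TypeB

variable {I I' : Type*} [Fintype I] [DecidableEq I] [Fintype I'] [DecidableEq I']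
  {A : Matrix I I ℤ} {A' : Matrix I' I' ℤ} {α : I} {β : I'} {d : I → ℤ} {f : I → I'}

lemma Form.of_bijective {n m : ℕ} {B : Matrix (Fin n) (Fin n) ℤ} {B' : Matrix (Fin m) (Fin m) ℤ}
    {g : Fin n → ℕ} (q : Fin n → I) (hq : Function.Bijective q) (e' : Fin m ≃ I')
    (hB : ∀ i j, A (q i) (q j) = B i j) (hB' : ∀ i j, A' (e' i) (e' j) = B' i j)
    (hg : ∀ i, g i < m) (hf : ∀ i, f (q i) = e' ⟨g i, hg i⟩) : Form A A' f B B' g :=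
  ⟨Equiv.ofBijective q hq, e', hB, hB', fun i => by
    change ((e'.symm (f (q i)) : Fin m) : ℕ) = g i
    rw [hf, Equiv.symm_apply_apply]⟩

/-- The vector representation of B. The short node is subtracted twice in a row, through the zero
weight at depth `m + 2`; this is where the pairings `2` and `-2` come from. -/
lemma IsBondPath.isChain_typeB (hA' : IsFiniteCartan A') {b : ℕ → I'} {m : ℕ}
    (hb : IsBondPath A' b (m + 2) m) (h0 : b 0 = β) (h1 : A' (b m) (b (m + 1)) = -2)
    (h2 : A' (b (m + 1)) (b m) = -1) :
    IsChain A' β (fun k => b (min k (2 * m + 3 - k))) (2 * m + 4) := by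
  obtain ⟨g, hg⟩ : ∃ g : ℕ → ℕ, ∀ i, g i = min i (2 * m + 3 - i) := ⟨_, fun _ => rfl⟩
  simp only [← hg]
  have hstep : ∀ k t, g k < m + 2 → t < m + 2 → wt A' β (vec (pathWord (fun k => b (g k)) (k + 1)))
      (b t) = wt A' β (vec (pathWord (fun k => b (g k)) k)) (b t) -
        if g k = t then 2 else if g k + 1 = t then (if g k = m then -2 else -1) else
          if t + 1 = g k then -1 else 0 := fun k t hk ht => by
    rw [wt_pathWord_succ, hb.entry hA' h1 h2 hk ht]
    simp
  have hW1 : ∀ k ≤ m + 1, ∀ t < m + 2, wt A' β (vec (pathWord (fun k => b (g k)) k)) (b t) =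
      (if t = k then (if t = m + 1 then 2 else 1) else 0) - if t + 1 = k then 1 else 0 := by
    intro k hk t ht
    induction k with
    | zero =>
      have : b t = β ↔ t = 0 := by
        rw [← h0]
        exact ⟨hb.inj t ht 0 (by omega), fun e => by rw [e]⟩
      by_cases ht0 : t = 0 <;> simp [this, ht0, h0]
    | succ k ih =>
      have hgk : g k = k := by rw [hg]; omega
      rw [hstep k t (by omega) ht, ih (by omega), hgk]
      split_ifs <;> omega
  have hW2 : ∀ t < m + 2, wt A' β (vec (pathWord (fun k => b (g k)) (m + 2))) (b t) = 0 := by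
    intro t ht
    have hgk : g (m + 1) = m + 1 := by rw [hg]; omega
    rw [hstep (m + 1) t (by omega) ht, hW1 _ le_rfl t ht, hgk]
    split_ifs <;> omega
  have hW3 : ∀ k ≤ m + 1, ∀ t < m + 2,
      wt A' β (vec (pathWord (fun k => b (g k)) (m + 3 + k))) (b t) =
      (if t + k = m then 1 else 0) - if t + k = m + 1 then (if t = m + 1 then 2 else 1) else 0 := by
    intro k hk t ht
    induction k with
    | zero =>
      have hgk : g (m + 2) = m + 1 := by rw [hg]; omega
      rw [Nat.add_zero, hstep (m + 2) t (by omega) ht, hW2 t ht, hgk]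
      split_ifs <;> omega
    | succ k ih =>
      have hgk : g (m + 3 + k) = m - k := by rw [hg]; omega
      rw [← add_assoc, hstep (m + 3 + k) t (by omega) ht, ih (by omega), hgk]
      split_ifs <;> omega
  refine ⟨fun d => Depth.exists_eq_pathWord ?_, ?_⟩
  · intro k hk i
    obtain ⟨t, ht, rfl⟩ := hb.cover i
    rcases lt_trichotomy k (m + 2) with h3 | rfl | h3
    · rw [hW1 k (by omega) t ht]
      by_cases h4 : t = k
      · subst h4
        have e : g t = t := by rw [hg]; omega
        have e' : t = m + 1 → g (t + 1) = t := fun _ => by rw [hg]; omega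
        rw [e]
        by_cases h5 : t = m + 1
        · rw [e' h5]; simp [h5]; omega
        · simp [h5]; omega
      · by_cases h5 : t + 1 = k
        · subst h5
          have e : g t = t := by rw [hg]; omega
          simp [e]
        · simp [h4, h5]
    · exact .inl (hW2 t ht)
    · obtain ⟨k, rfl⟩ : ∃ k', k = m + 3 + k' := ⟨k - (m + 3), by omega⟩
      rw [hW3 k (by omega) t ht]
      by_cases h4 : t + k = m
      · have e : g (m + 3 + k) = t := by rw [hg]; omega
        rw [e, if_pos h4, if_neg (by omega)]
        exact .inr (.inl ⟨by simp, by omega, rfl⟩)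
      · rw [if_neg h4]
        by_cases h5 : t + k = m + 1
        · have e : g (m + 3 + k - 1) = t := by rw [hg]; omega
          rw [if_pos h5, e]
          by_cases h6 : t = m + 1
          · have e' : g (m + 3 + k - 2) = t := by rw [hg]; omega
            rw [if_pos h6, e']
            exact .inr (.inr (.inr (.inr ⟨by simp, by omega, rfl, rfl⟩)))
          · rw [if_neg h6]
            exact .inr (.inr (.inr (.inl ⟨by simp, by omega, rfl⟩)))
        · simp [h5]
  · have h3 : ∀ k ≤ m + 1, Depth A' β (vec (pathWord (fun k => b (g k)) k)) := by
      intro k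
      induction k with
      | zero => exact fun _ => by simpa using Depth.zero
      | succ k ih =>
        intro hk
        refine (ih (by omega)).cons _ ?_
        have e : g k = k := by rw [hg]; omega
        beta_reduce
        rw [← wt_vec, e, hW1 k (by omega) k (by omega), if_pos rfl, if_neg (by omega),
          if_neg (by omega)]
        simp
    have h4 : ∀ k ≤ m + 1, Depth A' β (vec (pathWord (fun k => b (g k)) (m + 3 + k))) := by
      intro k
      induction k with
      | zero =>
        intro _
        have e : g (m + 1) = m + 1 := by rw [hg]; omega
        have e' : g (m + 2) = m + 1 := by rw [hg]; omega
        have := (h3 (m + 1) le_rfl).replicate (b (m + 1)) 2 (by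
          rw [← wt_vec, hW1 _ le_rfl _ (by omega), if_pos rfl, if_pos rfl, if_neg (by omega)]
          simp)
        rw [Nat.add_zero, pathWord_succ, pathWord_succ, e, e']
        exact this
      | succ k ih =>
        intro hk
        refine (ih (by omega)).cons _ ?_
        have e : g (m + 3 + k) = m - k := by rw [hg]; omega
        change 1 ≤ (if b (g (m + 3 + k)) = β then 1 else 0) - (List.map (A' · (b (g (m + 3 + k))))
          (pathWord (fun k => b (g k)) (m + 3 + k))).sum
        rw [← wt_vec, e, hW3 k (by omega) _ (by omega), if_pos (by omega), if_neg (by omega)]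
        simp
    have := h4 (m + 1) le_rfl
    rwa [show m + 3 + (m + 1) = 2 * m + 4 by omega] at this

/-- Type `D_{m+3} → B_{m+2}`. -/
lemma IsSimplePath.form_typeD (h : IsLabeling A A' f) (hα : IsLeaf A α) {b : ℕ → I'} {m : ℕ}
    (hb : IsBondPath A' b (m + 2) m) (h0 : b 0 = f α) (h1 : A' (b m) (b (m + 1)) = -2)
    (h2 : A' (b (m + 1)) (b m) = -1) {p : ℕ → I} {t : I} (hp : IsSimplePath A p (m + 2))
    (hp0 : p 0 = α) (ht : t ∉ pathWord p (m + 2)) (hmt : A (p m) t ≠ 0) :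
    3 ≤ m + 3 ∧ Form A A' f (CartanMatrix.D (m + 3)) (CartanMatrix.B (m + 2))
      (fun i => min (i : ℕ) (m + 1)) := by
  have hA := h.left
  have hc := hb.isChain_typeB h.right h0 h1 h2
  have hinj : ∀ i k, i < m + 2 → k < m + 2 → b i = b k → i = k := fun i k hi hk =>
    hb.inj i hi k hk
  have hpt : ∀ i < m + 2, p i ≠ t := fun i hi e => ht (mem_pathWord.2 ⟨i, hi, e⟩)
  -- For `m = 0` both `p 1` and `t` would be neighbours of the leaf `α`.
  have hm : 1 ≤ m := by
    by_contra hm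
    obtain rfl : m = 0 := by omega
    refine hpt 1 (by omega) (hα.eq ?_ ?_ ?_ ?_)
    · exact hp0 ▸ hp.ne (by omega) (by omega) (by omega)
    · exact hp0 ▸ (hpt 0 (by omega)).symm
    · exact hp0 ▸ hp.adj 0 (by omega)
    · exact hp0 ▸ hmt
  have hft : f t = b (m + 1) := by
    rw [(hp.toIsPath.label_fork h hα hc hp0 (i := m) (by omega) ht hmt).2.1]
    congr 1
    omega
  have hfp : ∀ i < m + 2, f (p i) = b i := fun i hi => by
    rw [(hp.toIsPath.label h hα hc hp0 hi).2]
    congr 1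
    omega
  have htm := hA.ne_zero_symm hmt
  have e1 := hA.le_neg_one (hpt m (by omega)) hmt
  have e2 := hA.le_neg_one (hpt m (by omega)).symm htm
  have hd1 := (hp.toIsPath.mono (k := m + 1) (by omega)).depth hA hp0
  have ht1 : t ∉ pathWord p (m + 1) := fun hm => ht (by
    rw [pathWord_succ]; exact List.mem_cons_of_mem _ hm)
  have hd2 : Depth A α (vec (t :: pathWord p (m + 2))) :=
    hA.depth_cons (hp.toIsPath.depth hA hp0) (mem_pathWord.2 ⟨0, by omega, hp0⟩)
      (mem_pathWord.2 ⟨m, by omega, rfl⟩) ht hmt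
  have hpm1 : p (m + 1) ∉ pathWord p (m + 1) := fun hm => by
    obtain ⟨s, hs, e⟩ := mem_pathWord.1 hm
    have := hp.inj s (by omega) (m + 1) (by omega) e
    omega
  -- Otherwise `t` could be subtracted twice after `p m`, and then `p (m + 1)` at depth `m + 3`,
  -- where the chain prescribes the label `b m`.
  have e3 : A (p m) t = -1 := by
    by_contra hne
    have h3 := hd1.replicate t 2 (by
      have := map_sum_le_of_mem hA.off (z := p m) (by simp) ht1
      rw [if_neg (hp0 ▸ (hpt 0 (by omega)).symm)]
      push_cast
      omega)
    have h4 := hc.label h hα h3 (hA.depth_cons (z := p m) (s := p (m + 1)) h3 ?_ ?_ ?_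
      (hp.adj m (by omega)))
    · rw [hfp (m + 1) (by omega)] at h4
      have := hinj _ _ (by omega) (by simp; omega) h4.2
      simp at this
      omega
    · exact List.mem_append_right _ (mem_pathWord.2 ⟨0, by omega, hp0⟩)
    · simp
    · simp only [List.mem_append, not_or]
      exact ⟨by simp [hpt (m + 1) (by omega)], hpm1⟩
  have e4 : A t (p m) = -1 := by
    by_contra hne
    have h3 := ((hp.toIsPath.mono (k := m + 1) (by omega)).snoc hA ht1 hmt).label_bond' h hα hc
      (by simpa using hp0) (k := m) (by
        rw [Function.update_self, Function.update_of_ne (by omega)]; omega)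
    have := hinj _ _ (by omega) (by omega) h3.2
    omega
  have e5 := (hp.simple m (by omega)).2
  have hwt := (hp.toIsPath.mono (k := m + 1) (by omega)).one_le_wt hA hp0
  -- A further node `x` could be subtracted after `t`, and then `p m` at depth `m + 4`, where the
  -- chain prescribes `b (m - 1)`.
  have hcov : ∀ x, x ∈ t :: pathWord p (m + 2) := by
    refine hA.conn (· ∈ t :: pathWord p (m + 2)) ⟨t, by simp⟩ fun z x hz hzx => ?_
    by_contra hx
    have h3 : Depth A α (vec (x :: t :: pathWord p (m + 2))) := hA.depth_cons hd2
      (List.mem_cons_of_mem _ (mem_pathWord.2 ⟨0, by omega, hp0⟩)) hz hx hzx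
    have hxm : x ≠ p m := fun e => hx (List.mem_cons_of_mem _ (mem_pathWord.2 ⟨m, by omega, e.symm⟩))
    have h4 := hc.label h hα h3 (h3.cons (p m) (by
      have := hA.off _ _ hxm
      rw [List.map_cons, List.map_cons, pathWord_succ p (m + 1), List.map_cons, List.sum_cons,
        List.sum_cons, List.sum_cons]
      omega))
    rw [hfp m (by omega)] at h4
    have := hinj _ _ (by omega) (by simp; omega) h4.2
    simp at this
    omega
  have hq : ∀ i < m + 2, Function.update p (m + 2) t i = p i := fun i hi =>
    Function.update_of_ne (by omega) _ _
  have hqt : Function.update p (m + 2) t (m + 2) = t := Function.update_self _ _ _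
  have hent : ∀ i < m + 2, i ≠ m → A (p i) t = 0 := fun i hi him => by
    by_contra hne
    have := hp.toIsPath.conn.eq_of_adj hA ht (mem_pathWord.2 ⟨i, hi, rfl⟩)
      (mem_pathWord.2 ⟨m, by omega, rfl⟩) hne hmt
    exact him (hp.inj i hi m (by omega) this)
  refine ⟨by omega, .of_bijective (fun i : Fin (m + 3) => Function.update p (m + 2) t i)
    ⟨fun i k e => ?_, fun x => ?_⟩ (hb.equiv hb.cover) (fun i k => ?_) (fun i k => ?_)
    (fun i => by omega) (fun i => ?_)⟩
  · simp only at e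
    apply Fin.ext
    rcases Nat.lt_succ_iff_lt_or_eq.1 i.2 with hi | hi <;>
      rcases Nat.lt_succ_iff_lt_or_eq.1 k.2 with hk | hk
    · rw [hq _ hi, hq _ hk] at e
      exact hp.inj _ hi _ hk e
    · rw [hq _ hi, hk, hqt] at e
      exact absurd e (hpt _ hi)
    · rw [hq _ hk, hi, hqt] at e
      exact absurd e.symm (hpt _ hk)
    · omega
  · rcases List.mem_cons.1 (hcov x) with rfl | hx
    · exact ⟨Fin.last _, hqt⟩
    · obtain ⟨i, hi, rfl⟩ := mem_pathWord.1 hx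
      exact ⟨⟨i, by omega⟩, hq i hi⟩
  · simp only [CartanMatrix.D, Matrix.of_apply, Fin.ext_iff]
    rcases Nat.lt_succ_iff_lt_or_eq.1 i.2 with hi | hi <;>
      rcases Nat.lt_succ_iff_lt_or_eq.1 k.2 with hk | hk
    · rw [hq _ hi, hq _ hk, hp.entry hA hi hk]
      split_ifs <;> omega
    · rw [hq _ hi, hk, hqt]
      by_cases him : (i : ℕ) = m
      · rw [him, e3]; split_ifs <;> omega
      · rw [hent _ hi him]; split_ifs <;> omega
    · rw [hq _ hk, hi, hqt]
      by_cases hkm : (k : ℕ) = m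
      · rw [hkm, e4]; split_ifs <;> omega
      · rw [hA.zero _ _ (hent _ hk hkm)]; split_ifs <;> omega
    · rw [if_pos (by omega), hi, hk, hqt, hA.diag]
  · rw [IsPath.equiv_apply, IsPath.equiv_apply, hb.entry h.right h1 h2 i.2 k.2]
    simp only [CartanMatrix.B, Matrix.of_apply, Fin.ext_iff]
    split_ifs <;> omega
  · change f (Function.update p (m + 2) t i) = b (min i (m + 1))
    rcases Nat.lt_succ_iff_lt_or_eq.1 i.2 with hi | hi
    · rw [hq _ hi, hfp _ hi]; congr 1; omega
    · rw [hi, hqt, hft]; congr 1; omega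

/-- Types `A_{2m} → B_m` and `D_{m+1} → B_m`. -/
lemma IsLabeling.form_typeB (h : IsLabeling A A' f) (hα : IsLeaf A α) {b : ℕ → I'} {m : ℕ}
    (hb : IsBondPath A' b (m + 2) m) (h0 : b 0 = f α) (h1 : A' (b m) (b (m + 1)) = -2)
    (h2 : A' (b (m + 1)) (b m) = -1) : IsIso A A' f ∨
      Form A A' f (CartanMatrix.A (2 * (m + 2))) (CartanMatrix.B (m + 2))
        (fun i => min (i : ℕ) (2 * (m + 2) - 1 - i)) ∨
      3 ≤ m + 3 ∧ Form A A' f (CartanMatrix.D (m + 3)) (CartanMatrix.B (m + 2))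
        (fun i => min (i : ℕ) (m + 1)) := by
  have hc := hb.isChain_typeB h.right h0 h1 h2
  rcases h.exists_fold hα hb h0 with hiso | ⟨p, hp0, hp, -, hs, h3, h4, h5⟩
  · exact .inl hiso
  right
  -- The only equal consecutive labels are those at depths `m + 1` and `m + 2`, so the only possible
  -- fork is at `p m`, which leads to type D. Later multiple edges would need other coincidences.
  by_cases hfork : ∃ p t, IsSimplePath A p (m + 2) ∧ p 0 = α ∧ t ∉ pathWord p (m + 2) ∧
      A (p m) t ≠ 0
  · obtain ⟨p, t, hp, hp0, ht, hmt⟩ := hfork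
    exact .inr (hp.form_typeD h hα hb h0 h1 h2 hp0 ht hmt)
  left
  have hne := hp.ne (i := m) (j := m + 1) (by omega) (by omega) (by omega)
  have h6 := h.left.le_neg_one hne (hp.adj m (by omega))
  have h7 := h.left.le_neg_one hne.symm (hp.adj' h.left (by omega))
  have hinj : ∀ i k, i < m + 2 → k < m + 2 → b i = b k → i = k := fun i k hi hk =>
    hb.inj i hi k hk
  have hps : IsSimplePath A p (m + 2) := ⟨hp, fun i hi => by
    rcases Nat.lt_succ_iff_lt_or_eq.1 (show i < m + 1 by omega) with hi' | rfl
    · exact hs i hi'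
    · omega⟩
  obtain ⟨p, n, -, hp, hp0, hcov⟩ := hps.exists_cover h.left (by omega) hp0
    (fun k p i t hk hp hp0 hi ht => by
      by_contra hne
      have := hp.toIsPath.label_fork h hα hc hp0 hi ht hne
      have := hinj _ _ (by omega) (by omega) this.2.2
      have him : i = m := by omega
      rw [him] at hne
      exact hfork ⟨p, t, ⟨hp.toIsPath.mono hk, fun i _ => hp.simple i (by omega)⟩, hp0, fun hm => by
        obtain ⟨s, hs, e⟩ := mem_pathWord.1 hm
        exact ht (mem_pathWord.2 ⟨s, by omega, e⟩), hne⟩)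
    (fun k p hk hp hp0 => by
      constructor
      · by_contra! hlt
        have := hp.label_bond h hα hc hp0 (by omega)
        have := hinj _ _ (by omega) (by omega) this.2
        omega
      · by_contra! hlt
        have := hp.label_bond' h hα hc hp0 (by omega)
        have := hinj _ _ (by omega) (by omega) this.2
        omega)
  refine hp.form h hα hc hp0 hcov (hb.equiv hb.cover) (fun i j => ?_)
    (g := fun i => min i (2 * m + 3 - i)) (fun i hi => ?_)
  · rw [IsPath.equiv_apply, IsPath.equiv_apply, hb.entry h.right h1 h2 i.2 j.2]
    simp only [CartanMatrix.B, Matrix.of_apply, Fin.ext_iff]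
    split_ifs <;> omega
  · have : b (min i (2 * m + 3 - i)) = hb.equiv hb.cover ⟨min i (2 * m + 3 - i), by omega⟩ := rfl
    rw [this, Equiv.symm_apply_apply]

end TypeB

/-! ### Words that can be checked by computation. -/

section Word

variable {I I' K : Type*} [Fintype I] [DecidableEq I] [Fintype I'] [DecidableEq I']
  [Fintype K] [DecidableEq K]
  {A : Matrix I I ℤ} {A' : Matrix I' I' ℤ} {α : I} {β : I'} {d : I → ℤ} {f : I → I'}

/-- The words that describe a descent from `ϖ_a` by simple roots, each step being possible since
the pairing with the simple coroot is positive. -/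
def IsWord (M : Matrix K K ℤ) (a : K) : List K → Prop
  | [] => True
  | x :: l => IsWord M a l ∧ 1 ≤ (if x = a then 1 else 0) - (l.map (M · x)).sum

instance (M : Matrix K K ℤ) (a : K) : DecidablePred (IsWord M a) := fun l => by
  induction l with
  | nil => exact inferInstanceAs (Decidable True)
  | cons x l ih =>
    exact inferInstanceAs
      (Decidable (IsWord M a l ∧ 1 ≤ (if x = a then 1 else 0) - (l.map (M · x)).sum))

lemma IsWord.depth {M : Matrix K K ℤ} {a : K} {q : K → I} (hq : Function.Injective q)
    (hM : ∀ i j, A (q i) (q j) = M i j) {l : List K} (hl : IsWord M a l) :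
    Depth A (q a) (vec (l.map q)) := by
  induction l with
  | nil => simpa using Depth.zero
  | cons x l ih =>
    refine (ih hl.1).cons (q x) ?_
    simpa only [hq.eq_iff, List.map_map, Function.comp_def, hM] using hl.2

/-- The value of `normGap` on a word. -/
def wordGap (M : Matrix K K ℤ) (δ : K → ℤ) (a : K) : List K → ℤ
  | [] => 0
  | x :: l => wordGap M δ a l + 2 * δ x * ((if x = a then 1 else 0) - (l.map (M · x)).sum - 1)

/-- A word of negative gap would end in a weight longer than the highest one. For a concrete Cartan
matrix, `decide` can thus refute the existence of a word. -/
lemma wordGap_nonneg {M : Matrix K K ℤ} {δ : K → ℤ} {a : K} (e : K ≃ I')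
    (hM : ∀ i j, A' (e i) (e j) = M i j) (hdiag : ∀ i, M i i = 2) (hpos : ∀ i, 0 < δ i)
    (hδ : ∀ i j, M i j * δ j = M j i * δ i) {l : List K} (hl : Depth A' (e a) (vec (l.map e))) :
    0 ≤ wordGap M δ a l := by
  have hM' : ∀ i j, A' i j = M (e.symm i) (e.symm j) := fun i j => by
    rw [← hM, e.apply_symm_apply, e.apply_symm_apply]
  have h1 : ∀ l : List K, normGap A' (δ ∘ e.symm) (e a) (vec (l.map e)) = wordGap M δ a l := by
    intro l
    induction l with
    | nil => simp [normGap, wordGap]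
    | cons x l ih =>
      rw [List.map_cons, vec_cons, normGap_add_single (fun i => by rw [hM', hdiag])
        (fun i j => by simpa only [hM', Function.comp_apply] using hδ _ _), ih, wt_vec, wordGap]
      simp only [e.injective.eq_iff, List.map_map, Function.comp_def, hM, e.symm_apply_apply,
        mul_one]
  rw [← h1]
  exact normGap_nonneg (fun i => by rw [hM', hdiag]) (fun i => hpos _)
    (fun i j => by simpa only [hM', Function.comp_apply] using hδ _ _) hl

/-- A part of the diagram that admits a word with maximal image is the whole diagram. -/
lemma IsLabeling.form_of_word (h : IsLabeling A A' f) (hα : IsLeaf A α) {n m : ℕ}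
    {B : Matrix (Fin n) (Fin n) ℤ} {B' : Matrix (Fin m) (Fin m) ℤ}
    {g : Fin n → ℕ} {q : Fin n → I} (hq : Function.Injective q) (hB : ∀ i j, A (q i) (q j) = B i j)
    {a : Fin n} (ha : q a = α) {l : List (Fin n)} (hl : Depth A (q a) (vec (l.map q))) (hal : a ∈ l)
    (hmax : ∀ y, ¬ Depth A' (f α) (vec (y :: (l.map q).map f))) (e' : Fin m ≃ I')
    (hB' : ∀ i j, A' (e' i) (e' j) = B' i j)
    (hg : ∀ i, g i < m) (hf : ∀ i, f (q i) = e' ⟨g i, hg i⟩) : Form A A' f B B' g := by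
  refine .of_bijective q ⟨hq, fun x => ?_⟩ e' hB hB' hg hf
  rw [ha] at hl
  have h2 := h.left.mem_of_maximal (fun d => h.depth_push hα) hl (ha ▸ List.mem_map_of_mem hal) hmax x
  obtain ⟨i, -, hi⟩ := List.mem_map.1 h2
  exact ⟨i, hi⟩

lemma IsChain.maximal {c : ℕ → I'} {N : ℕ} (hc : IsChain A' β c N) {l : List I'}
    (hl : l.length = N) (y : I') : ¬ Depth A' β (vec (y :: l)) := fun h => by
  have := (hc.eq_vec h).1
  rw [List.length_cons] at this
  omega

/-- Pushing forward preserves the number of letters, and the bottom of the chain over `f α` has to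
be reached. -/
lemma IsChain.length_le (h : IsLabeling A A' f) (hα : IsLeaf A α) {c : ℕ → I'} {N : ℕ}
    (hc : IsChain A' (f α) c N) {c' : ℕ → I} {n : ℕ} (hc' : IsChain A α c' n) : N ≤ n := by
  obtain ⟨d, hd, e⟩ := (h.depth_iff α hα _).1 hc.top
  obtain ⟨k, hk, rfl⟩ := hc'.sub d hd
  rw [push_vec] at e
  have h1 := sum_vec ((pathWord c' k).map f)
  rw [e, sum_vec, length_pathWord, List.length_map, length_pathWord] at h1
  omega

end Word

/-! ### Target G₂ over the short node: sources B₃ from the short end and D₄. -/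

section TypeG

variable {I I' : Type*} [Fintype I] [DecidableEq I] [Fintype I'] [DecidableEq I']
  {A : Matrix I I ℤ} {A' : Matrix I' I' ℤ} {α : I} {β : I'} {d : I → ℤ} {f : I → I'}

/-- The seven-dimensional representation of G₂, with labels `s, l, s, s, l, s`. -/
lemma isChain_typeG (hA' : IsFiniteCartan A') {s l : I'} (hsl : s ≠ l) (hcov : ∀ x, x = s ∨ x = l)
    (h1 : A' s l = -1) (h2 : A' l s = -3) :
    IsChain A' s (fun k => if k % 3 = 1 then l else s) 6 := by
  have d1 := hA'.diag s
  have d2 := hA'.diag l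
  refine ⟨fun d => Depth.exists_eq_pathWord ?_, ?_⟩
  · intro k hk i
    rcases hcov i with rfl | rfl <;> interval_cases k <;>
      simp [wt_vec, pathWord, h1, h2, d1, d2, hsl, hsl.symm]
  · simp only [pathWord]
    have h0 : Depth A' s (vec []) := by simpa using Depth.zero
    have h3 : Depth A' s (vec [l, s]) := (h0.cons s (by simp)).cons l (by simp [h1, hsl.symm])
    have h4 := h3.replicate s 2 (by simp [h2, d1])
    exact (h4.cons l (by simp [h1, d2, hsl.symm, List.replicate])).cons s
      (by simp [h2, d1, List.replicate])

/-- The spin representation of B₂. Its three steps are too few for the six of G₂, so a source that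
begins like this needs a third node. -/
lemma isChain_typeB₂ {p q : I} (hA : IsFiniteCartan A) (hpq : p ≠ q) (hcov : ∀ x, x = p ∨ x = q)
    (h1 : A p q = -1) (h2 : A q p = -2) :
    IsChain A p (fun k => if k % 2 = 1 then q else p) 3 := by
  have d1 := hA.diag p
  have d2 := hA.diag q
  refine ⟨fun d => Depth.exists_eq_pathWord ?_, ?_⟩
  · intro k hk i
    rcases hcov i with rfl | rfl <;> interval_cases k <;>
      simp [wt_vec, pathWord, h1, h2, d1, d2, hpq, hpq.symm]
  · simp only [pathWord]
    have h0 : Depth A p (vec []) := by simpa using Depth.zero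
    exact ((h0.cons p (by simp)).cons q (by simp [h1, hpq.symm])).cons p (by simp [h2, d1])

/-- The two nodes of a diagram of type `G₂`, the short one and the long one. -/
structure IsG₂ (A : Matrix I I ℤ) (s l : I) : Prop where
  ne : s ≠ l
  cover : ∀ x, x = s ∨ x = l
  short : A s l = -1
  long : A l s = -3

/-- The enumeration of a diagram of type `G₂`. -/
noncomputable def IsG₂.equiv {s l : I} (h : IsG₂ A s l) : Fin 2 ≃ I :=
  Equiv.ofBijective ![l, s] ⟨fun i j => by
    have := h.ne
    fin_cases i <;> fin_cases j <;> simp [this, this.symm], fun x => by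
    rcases h.cover x with rfl | rfl
    · exact ⟨1, rfl⟩
    · exact ⟨0, rfl⟩⟩

lemma IsG₂.equiv_apply {s l : I} (h : IsG₂ A s l) (i : Fin 2) : h.equiv i = ![l, s] i := rfl

lemma IsG₂.equiv_entry (hA : IsFiniteCartan A) {s l : I} (h : IsG₂ A s l) (i j : Fin 2) :
    A (h.equiv i) (h.equiv j) = CartanMatrix.G₂ i j := by
  change A (![l, s] i) (![l, s] j) = _
  fin_cases i <;> fin_cases j <;> simp [CartanMatrix.G₂, hA.diag, h.short, h.long]

/-- Types `B_3 → G_2`, the first node of `L` being short. -/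
lemma IsLabeling.form_typeG_bond (h : IsLabeling A A' f) (hα : IsLeaf A α) {s l : I'}
    (hG : IsG₂ A' s l) (hs : f α = s) {q : I} (hq : q ≠ α) (h1 : A α q = -1) (h2 : A q α = -2) :
    Form A A' f (CartanMatrix.B 3) CartanMatrix.G₂ ![1, 0, 1] := by
  have hA := h.left
  have hc := isChain_typeG h.right hG.ne hG.cover hG.short hG.long
  rw [← hs] at hc
  have hsl := hG.ne
  have w1 : Depth A α (vec [α]) := depth_singleton
  have w2 : Depth A α (vec [q, α]) := w1.cons q (by simp [h1, hq])
  have w3 : Depth A α (vec [α, q, α]) := w2.cons α (by simp [h2, hA.diag])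
  have lq := (hc.label h hα w1 w2).2
  simp only [List.length_cons, List.length_nil] at lq
  norm_num at lq
  obtain ⟨t, htα, htq⟩ : ∃ t, t ≠ α ∧ t ≠ q := by
    by_contra! hno
    have := hc.length_le h hα (isChain_typeB₂ hA hq.symm (fun x => or_iff_not_imp_left.2 (hno x))
      h1 h2)
    omega
  obtain ⟨x, hx, t, ht, hxt⟩ : ∃ x, (x = α ∨ x = q) ∧ ∃ t, ¬ (t = α ∨ t = q) ∧ A x t ≠ 0 := by
    by_contra! hno
    have := hA.conn (fun x => x = α ∨ x = q) ⟨α, .inl rfl⟩ (fun i j hi hij => by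
      by_contra hj
      exact hij (hno i hi j (not_or.1 hj))) t
    tauto
  clear htα htq
  rw [not_or] at ht
  obtain rfl : x = q := by
    refine hx.resolve_left ?_
    rintro rfl
    exact ht.2 (hα.eq ht.1 hq hxt (by omega))
  clear hx
  have hαt : A α t = 0 := by
    by_contra hne
    exact ht.2 (hα.eq ht.1 hq hne (by omega))
  have w4 : Depth A α (vec [t, x, α]) :=
    hA.depth_cons w2 (z := x) (by simp) (by simp) (by simp [ht]) hxt
  have lt := (hc.label h hα w2 w4).2
  simp only [List.length_cons, List.length_nil] at lt
  norm_num at lt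
  have hn1 := hA.le_neg_one (Ne.symm ht.2) hxt
  have hn2 := hA.le_neg_one ht.2 (hA.ne_zero_symm hxt)
  -- Otherwise `t` could be subtracted twice after three steps, the second time at depth 4, where
  -- the label is long.
  have e1 : A x t = -1 := by
    by_contra hne
    have w5 : Depth A α (vec [t, α, x, α]) :=
      hA.depth_cons w3 (z := x) (by simp) (by simp) (by simp [ht]) hxt
    have w6 := w3.replicate t 2 (by simp [ht, hαt]; omega)
    have := (hc.label h hα w5 w6).2
    simp only [List.length_cons, List.length_nil] at this
    norm_num at this
    exact hsl (hs.symm.trans (lt.symm.trans this))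
  -- Otherwise the middle node could be repeated at depth 3, where the label is short.
  have e2 : A t x = -1 := by
    by_contra hne
    have := (hc.label h hα w4 (w4.cons x (by simp [hq, h1, hA.diag]; omega))).2
    simp only [List.length_cons, List.length_nil] at this
    norm_num at this
    exact hsl (hs.symm.trans (this.symm.trans lq))
  have hq : Function.Injective ![t, x, α] := fun i j => by
    have := ht.1; have := ht.2
    fin_cases i <;> fin_cases j <;> simp_all [eq_comm]
  have hB : ∀ i j, A (![t, x, α] i) (![t, x, α] j) = CartanMatrix.B 3 i j := fun i j => by
    have := hA.zero _ _ hαt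
    fin_cases i <;> fin_cases j <;> simp [CartanMatrix.B, hA.diag, e1, e2, h1, h2, hαt, this]
  -- A word for the lowest weight of the spin representation of B₃: six steps, as many as the chain
  -- has, so no further node fits.
  refine h.form_of_word hα hq hB (a := 2) rfl (l := [2, 1, 0, 2, 1, 2])
    (IsWord.depth hq hB (by decide)) (by decide) (hc.maximal (by simp)) hG.equiv
    (hG.equiv_entry h.right) (fun i => by fin_cases i <;> simp) (fun i => ?_)
  rw [hG.equiv_apply]
  fin_cases i <;> simp [lq, lt, hs]

/-- Type `D_4 → G_2`. -/
lemma IsLabeling.form_typeG_fork (h : IsLabeling A A' f) (hα : IsLeaf A α) {s l : I'}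
    (hG : IsG₂ A' s l) (hs : f α = s) {q t u : I} (hq : q ≠ α) (h1 : A α q = -1) (h2 : A q α = -1)
    (ht : t ≠ α) (htq : t ≠ q) (hqt : A q t ≠ 0) (hu : u ≠ α) (huq : u ≠ q) (hqu : A q u ≠ 0)
    (htu : t ≠ u) :
    Form A A' f (CartanMatrix.D 4) CartanMatrix.G₂ ![1, 0, 1, 1] := by
  have hA := h.left
  have hc := isChain_typeG h.right hG.ne hG.cover hG.short hG.long
  rw [← hs] at hc
  have hsl := hG.ne
  have w1 : Depth A α (vec [α]) := depth_singleton
  have w2 : Depth A α (vec [q, α]) := w1.cons q (by simp [h1, hq])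
  have lq := (hc.label h hα w1 w2).2
  simp only [List.length_cons, List.length_nil] at lq
  norm_num at lq
  have key : ∀ t u, t ≠ α → t ≠ q → A q t ≠ 0 → u ≠ α → u ≠ q → A q u ≠ 0 → t ≠ u →
      f t = s ∧ A α t = 0 ∧ A q t = -1 ∧ A t q = -1 := by
    intro t u ht htq hqt hu huq hqu htu
    have w3 : Depth A α (vec [t, q, α]) :=
      hA.depth_cons w2 (z := q) (by simp) (by simp) (by simp [ht, htq]) hqt
    have lt := (hc.label h hα w2 w3).2
    have w4 : Depth A α (vec [u, q, α]) :=
      hA.depth_cons w2 (z := q) (by simp) (by simp) (by simp [hu, huq]) hqu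
    have lu := (hc.label h hα w2 w4).2
    simp only [List.length_cons, List.length_nil] at lt lu
    norm_num at lt lu
    have hαt : A α t = 0 := by
      by_contra hne
      exact htq (hα.eq ht hq hne (by omega))
    have hn1 := hA.le_neg_one (Ne.symm htq) hqt
    have hn2 := hA.le_neg_one htq (hA.ne_zero_symm hqt)
    refine ⟨lt.trans hs, hαt, ?_, ?_⟩
    -- Subtracting `t` twice would move `u` to depth 4, where the label is long.
    · by_contra hne
      have w5 := w2.replicate t 2 (by simp [ht, hαt]; omega)
      have w6 : Depth A α (vec (u :: [t, t, q, α])) :=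
        hA.depth_cons w5 (z := q) (by simp) (by simp)
          (by simp [hu, huq, htu.symm, List.replicate]) hqu
      have := (hc.label h hα w5 w6).2
      simp only [List.length_append, List.length_replicate, List.length_cons, List.length_nil]
        at this
      norm_num at this
      exact hsl (hs.symm.trans (lu.symm.trans this))
    · by_contra hne
      have := (hc.label h hα w3 (w3.cons q (by simp [hq, h1, hA.diag]; omega))).2
      simp only [List.length_cons, List.length_nil] at this
      norm_num at this
      exact hsl (hs.symm.trans (this.symm.trans lq))
  obtain ⟨lt, t1, t2, t3⟩ := key t u ht htq hqt hu huq hqu htu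
  obtain ⟨lu, u1, u2, u3⟩ := key u t hu huq hqu ht htq hqt htu.symm
  have htu0 : A t u = 0 := by
    by_contra hne
    have hcn : Conn A α [t, q, α] := ((Conn.base (A := A) (α := α)).cons (z := α) (by simp)
      (by simp [hq]) (by omega)).cons (z := q) (by simp) (by simp [ht, htq]) hqt
    exact htq (hcn.eq_of_adj hA (s := u) (by simp [hu, huq, htu.symm]) (by simp) (by simp) hne hqu)
  have hq : Function.Injective ![α, q, t, u] := fun i j => by
    fin_cases i <;> fin_cases j <;> simp_all [eq_comm]
  have hB : ∀ i j, A (![α, q, t, u] i) (![α, q, t, u] j) = CartanMatrix.D 4 i j := fun i j => by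
    have := hA.zero _ _ t1
    have := hA.zero _ _ u1
    have := hA.zero _ _ htu0
    fin_cases i <;> fin_cases j <;> simp [CartanMatrix.D, hA.diag, *]
  -- A word for the lowest weight of the eight-dimensional representation of D₄.
  refine h.form_of_word hα hq hB (a := 0) rfl (l := [0, 1, 3, 2, 1, 0])
    (IsWord.depth hq hB (by decide)) (by decide) (hc.maximal (by simp)) hG.equiv
    (hG.equiv_entry h.right) (fun i => by fin_cases i <;> simp) (fun i => ?_)
  rw [hG.equiv_apply]
  fin_cases i <;> simp [lq, lt, lu, hs]

end TypeG

/-! ### Target G₂ over the short node: B₃ from the long end, and all sources together. -/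

section TypeG

variable {I I' : Type*} [Fintype I] [DecidableEq I] [Fintype I'] [DecidableEq I']
  {A : Matrix I I ℤ} {A' : Matrix I' I' ℤ} {α : I} {β : I'} {d : I → ℤ} {f : I → I'}

lemma sum_le_push (hd : ∀ i, 0 ≤ d i) {j : I'} (S : Finset I) (hS : ∀ i ∈ S, f i = j) :
    ∑ i ∈ S, d i ≤ push f d j := by
  have h1 : ∑ i ∈ S, d i = ∑ i ∈ S, if f i = j then d i else 0 :=
    Finset.sum_congr rfl fun i hi => by rw [if_pos (hS i hi)]
  rw [h1, push]
  exact Finset.sum_le_sum_of_subset_of_nonneg (Finset.subset_univ S)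
    (fun i _ _ => by split_ifs <;> simp [hd])

lemma push_eq_sum {j : I'} (S : Finset I) (hS : ∀ i ∈ S, f i = j)
    (h0 : ∀ i, i ∉ S → f i = j → d i = 0) : push f d j = ∑ i ∈ S, d i := by
  have h1 : ∑ i ∈ S, d i = ∑ i ∈ S, if f i = j then d i else 0 :=
    Finset.sum_congr rfl fun i hi => by rw [if_pos (hS i hi)]
  rw [h1, push]
  refine (Finset.sum_subset (Finset.subset_univ S) fun i _ hi => ?_).symm
  by_cases hij : f i = j
  · rw [if_pos hij, h0 i hi hij]
  · rw [if_neg hij]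

lemma wt_eq_sum (S : Finset I) (h0 : ∀ i, i ∉ S → d i = 0) (i : I) :
    wt A α d i = (if i = α then 1 else 0) - ∑ k ∈ S, d k * A k i := by
  rw [wt, Finset.sum_subset (Finset.subset_univ S) fun k _ hk => by rw [h0 k hk, zero_mul]]

lemma Depth.pos (hA : IsFiniteCartan A) (hd : Depth A α d) {t : I} (ht : 0 < d t) : 0 < d α := by
  by_cases htα : t = α
  · exact htα ▸ ht
  · obtain ⟨x, hx, -, -, h, -⟩ := hA.exists_boundary (X := {α}) rfl hd htα ht
    rwa [← Set.mem_singleton_iff.1 hx]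

/-- Type `B_3 → G_2`, the first node of `L` being long. -/
lemma IsLabeling.form_typeG_bond' (h : IsLabeling A A' f) (hα : IsLeaf A α) {s l : I'}
    (hG : IsG₂ A' s l) (hs : f α = s) {q t : I} (hq : q ≠ α) (h1 : A α q = -1) (h2 : A q α = -1)
    (ht : t ≠ α) (htq : t ≠ q) (hqt : A q t ≤ -2) :
    Form A A' f (CartanMatrix.B 3) CartanMatrix.G₂ ![1, 0, 1] := by
  have hA := h.left
  have hc := isChain_typeG h.right hG.ne hG.cover hG.short hG.long
  rw [← hs] at hc
  have hsl := hG.ne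
  have w1 : Depth A α (vec [α]) := depth_singleton
  have w2 : Depth A α (vec [q, α]) := w1.cons q (by simp [h1, hq])
  have lq := (hc.label h hα w1 w2).2
  have w3 : Depth A α (vec [t, q, α]) :=
    hA.depth_cons w2 (z := q) (by simp) (by simp) (by simp [ht, htq]) (by omega)
  have lt := (hc.label h hα w2 w3).2
  simp only [List.length_cons, List.length_nil] at lq lt
  norm_num at lq lt
  have hαt : A α t = 0 := by
    by_contra hne
    exact htq (hα.eq ht hq hne (by omega))
  have hn2 := hA.le_neg_one htq (hA.ne_zero_symm (by omega))
  have hen := (hA.entries (Ne.symm htq)).2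
  -- Otherwise `t` could be subtracted three times in a row, the last time at depth 4, where the
  -- label is long.
  have e1 : A q t = -2 := by
    by_contra hne
    have w5 := w2.replicate t 2 (by simp [ht, hαt]; omega)
    have w6 := w2.replicate t 3 (by simp [ht, hαt]; omega)
    have := (hc.label h hα w5 w6).2
    simp only [List.length_append, List.length_replicate, List.length_cons, List.length_nil] at this
    norm_num at this
    exact hsl (hs.symm.trans (lt.symm.trans this))
  have e2 : A t q = -1 := by omega
  have hq3 : Function.Injective ![α, q, t] := fun i j => by
    fin_cases i <;> fin_cases j <;> simp_all [eq_comm]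
  have w4 : Depth A α (vec [t, t, q, α]) := w2.replicate t 2 (by simp [ht, hαt, e1])
  have w5 := (w4.cons q (by simp [hq, h1, e2, hA.diag])).cons α
    (by simp [h2, hA.zero _ _ hαt, hA.diag])
  refine h.form_of_word hα hq3 (fun i j => ?_) (a := 0) rfl (l := [0, 1, 2, 2, 1, 0]) w5
    (by decide) (hc.maximal (by simp)) hG.equiv
    (hG.equiv_entry h.right) (fun i => by fin_cases i <;> simp) (fun i => ?_)
  · have := hA.zero _ _ hαt
    fin_cases i <;> fin_cases j <;> simp [CartanMatrix.B, hA.diag, *]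
  · rw [hG.equiv_apply]
    fin_cases i <;> simp [lq, lt, hs]

lemma IsG₂.isBondPath {s l : I} (h : IsG₂ A s l) :
    IsBondPath A (fun i => if i = 0 then s else l) 2 0 := by
  refine ⟨⟨fun i hi j hj e => ?_, fun i j _ _ => by omega, fun i hi => ?_⟩, fun x => ?_, by omega,
    fun i hi h0 => by omega⟩
  · have := h.ne
    interval_cases i <;> interval_cases j <;> simp_all
  · obtain rfl : i = 0 := by omega
    simp [h.short]
  · rcases h.cover x with rfl | rfl
    · exact ⟨0, by omega, rfl⟩
    · exact ⟨1, by omega, rfl⟩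

/-- Types `A_6`, `B_3`, `D_4` `→ G_2`. -/
lemma IsLabeling.form_typeG (h : IsLabeling A A' f) (hα : IsLeaf A α) {s l : I'}
    (hG : IsG₂ A' s l) (hs : f α = s) : IsIso A A' f ∨
      Form A A' f (CartanMatrix.A 6) CartanMatrix.G₂ ![1, 0, 1, 1, 0, 1] ∨
      Form A A' f (CartanMatrix.B 3) CartanMatrix.G₂ ![1, 0, 1] ∨
      Form A A' f (CartanMatrix.D 4) CartanMatrix.G₂ ![1, 0, 1, 1] := by
  subst hs
  have hA := h.left
  have hc := isChain_typeG h.right hG.ne hG.cover hG.short hG.long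
  have hsl := hG.ne
  rcases h.exists_fold hα hG.isBondPath rfl with hiso | ⟨p, hp0, hp, -, -, h3, h4, h5⟩
  · exact .inl hiso
  right
  simp only [if_true, zero_add, one_ne_zero, if_false, hG.short, hG.long] at h3 h4 h5
  have hne := hp.ne (i := 0) (j := 1) (by omega) (by omega) (by omega)
  have h6 := hA.le_neg_one hne (hp.adj 0 (by omega))
  have h7 := hA.le_neg_one hne.symm (hp.adj' hA (i := 0) (by omega))
  -- The fold weakens the triple edge, so this entry is `-2` or `-1`. In the second case the node
  -- after `α` may carry a fork (D₄), a double edge (B₃), or neither (A₆).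
  by_cases h8 : A (p 1) (p 0) = -2
  · exact .inr (.inl (h.form_typeG_bond hα hG rfl (hp0 ▸ hne.symm) (by rw [← hp0]; omega)
      (by rw [← hp0]; exact h8)))
  by_cases hfork : ∃ q t u, q ≠ α ∧ A α q = -1 ∧ A q α = -1 ∧ t ≠ α ∧ t ≠ q ∧ A q t ≠ 0 ∧ u ≠ α ∧
      u ≠ q ∧ A q u ≠ 0 ∧ t ≠ u
  · obtain ⟨q, t, u, hq, h1, h2, ht, htq, hqt, hu, huq, hqu, htu⟩ := hfork
    exact .inr (.inr (h.form_typeG_fork hα hG rfl hq h1 h2 ht htq hqt hu huq hqu htu))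
  by_cases hbond : ∃ q t, q ≠ α ∧ A α q = -1 ∧ A q α = -1 ∧ t ≠ α ∧ t ≠ q ∧ A q t ≤ -2
  · obtain ⟨q, t, hq, h1, h2, ht, htq, hqt⟩ := hbond
    exact .inr (.inl (h.form_typeG_bond' hα hG rfl hq h1 h2 ht htq hqt))
  left
  have hps : IsSimplePath A p 2 := ⟨hp, fun i hi => by
    obtain rfl : i = 0 := by omega
    simp only [zero_add]
    omega⟩
  have hstart : ∀ p : ℕ → I, IsPath A p 2 → p 0 = α → p 1 ≠ α ∧ A α (p 1) = -1 ∧ A (p 1) α = -1 := by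
    intro p' hp' h0'
    have : p' 1 = p 1 := by
      refine hα.eq (h0' ▸ hp'.ne (by omega) (by omega) (by omega)) (hp0 ▸ hne.symm)
        (h0' ▸ hp'.adj 0 (by omega)) (hp0 ▸ hp.adj 0 (by omega))
    rw [this, ← hp0]
    exact ⟨hne.symm, by omega, by omega⟩
  obtain ⟨p, n, -, hp, hp0, hcov⟩ := hps.exists_cover hA (by omega) hp0
    (fun k p i t hk hp hp0 hi ht => by
      by_contra hne
      have h9 := hp.toIsPath.label_fork h hα hc hp0 hi ht hne
      obtain ⟨h9, -, h10⟩ := h9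
      -- Only the labels at depths 2 and 3 are equal and consecutive.
      have hi1 : i = 1 := by
        have : i < 4 := by omega
        interval_cases i <;> simp [hsl, hsl.symm] at h10 ⊢
      subst hi1
      obtain ⟨h1, h2, h3⟩ := hstart p (hp.toIsPath.mono (by omega)) hp0
      have hpt : ∀ i < k, p i ≠ t := fun i hi e => ht (mem_pathWord.2 ⟨i, hi, e⟩)
      exact hfork ⟨p 1, p 2, t, h1, h2, h3, hp0 ▸ hp.ne (by omega) (by omega) (by omega),
        hp.ne (by omega) (by omega) (by omega), hp.adj 1 (by omega), hp0 ▸ (hpt 0 (by omega)).symm,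
        (hpt 1 (by omega)).symm, hne, hpt 2 (by omega)⟩)
    (fun k p hk hp hp0 => by
      obtain ⟨h1, h2, h3⟩ := hstart p (hp.mono (by omega)) hp0
      constructor
      · by_contra! hlt
        obtain ⟨h9, h10⟩ := hp.label_bond h hα hc hp0 (by omega)
        have hi1 : k = 1 := by
          have : k < 4 := by omega
          interval_cases k <;> simp [hsl, hsl.symm] at h10 ⊢
        subst hi1
        have h11 : A (p 1) (p 2) < -1 := hlt
        exact hbond ⟨p 1, p 2, h1, h2, h3, hp0 ▸ hp.ne (by omega) (by omega) (by omega),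
          hp.ne (by omega) (by omega) (by omega), by omega⟩
      · by_contra! hlt
        obtain ⟨h9, h10⟩ := hp.label_bond' h hα hc hp0 (by omega)
        -- Labels two steps apart agree for `k = 0`, which is excluded here, and for `k = 3`. Then
        -- `p 3` is repeated at depth 5 and `p 2` can follow at depth 6, beyond the end of the
        -- chain.
        have hi3 : k = 3 := by
          have : k < 4 := by omega
          interval_cases k <;> simp [hsl, hsl.symm] at h10 hk ⊢
        subst hi3
        have w1 := hp.depth hA hp0
        have hs3 := (hp.mono (k := 4) (by omega)).one_le_wt hA hp0
        have w2 := w1.cons (p 3) (by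
          rw [pathWord_succ, List.map_cons, List.sum_cons]
          omega)
        have hs2 := hp.sum_le hA (i := 2) (by omega)
        rw [← sum_map_pathWord p (A · (p 2)), if_pos (by omega), if_pos (by omega)] at hs2
        have h11 := hA.le_neg_one (hp.ne (i := 3) (j := 2) (by omega) (by omega) (by omega))
          (hp.adj' hA (i := 2) (by omega))
        have w3 := w2.cons (p 2) (by
          rw [List.map_cons, List.sum_cons, if_neg (hp0 ▸ hp.ne (by omega) (by omega) (by omega))]
          change 1 ≤ 0 - (A (p 3) (p 2) + ((pathWord p (3 + 2)).map (A · (p 2))).sum)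
          omega)
        have := (hc.label h hα w2 w3).1
        simp at this)
  have hF := hp.form h hα hc hp0 hcov hG.equiv (hG.equiv_entry h.right)
    (g := fun k => if k % 3 = 1 then 0 else 1) (fun i hi => ?_)
  · convert hF using 2 with i
    fin_cases i <;> rfl
  · by_cases hi1 : i % 3 = 1
    · rw [if_pos hi1, if_pos hi1, show hG.equiv.symm l = 0 from (Equiv.symm_apply_eq _).2 rfl]
      rfl
    · rw [if_neg hi1, if_neg hi1, show hG.equiv.symm (f α) = 1 from (Equiv.symm_apply_eq _).2 rfl]
      rfl

end TypeG

/-! ### Target G₂ over the long node. -/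

section TypeG

variable {I I' : Type*} [Fintype I] [DecidableEq I] [Fintype I'] [DecidableEq I']
  {A : Matrix I I ℤ} {A' : Matrix I' I' ℤ} {α : I} {β : I'} {d : I → ℤ} {f : I → I'}

lemma IsG₂.isBondPath' {s l : I} (h : IsG₂ A s l) (hA : IsFiniteCartan A) :
    IsBondPath A (fun i => if i = 0 then l else s) 2 0 := by
  have := (h.isBondPath).reverse hA
  refine ⟨this.toIsPath.congr fun i hi => ?_, fun x => ?_, by omega, fun i hi h0 => by omega⟩
  · interval_cases i <;> simp
  · rcases h.cover x with rfl | rfl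
    · exact ⟨1, by omega, rfl⟩
    · exact ⟨0, by omega, rfl⟩

/-- Exit from a set whose elements, other than `z`, have no neighbours outside. -/
lemma Depth.exists_adj (hA : IsFiniteCartan A) (hd : Depth A α d) (X : Set I) (hα : α ∈ X) {z : I}
    (hX : ∀ x ∈ X, x ≠ z → ∀ t, t ∉ X → A x t = 0) (hz : ∀ t, t ∉ X → A z t ≠ 0 → d t = 0) {t : I}
    (ht : t ∉ X) : d t = 0 := by
  by_contra hne
  obtain ⟨x, hx, y, hy, -, hdy, hxy⟩ := hA.exists_boundary hα hd ht
    ((hA.nonneg α d hd t).lt_of_ne (Ne.symm hne))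
  by_cases hxz : x = z
  · subst hxz
    have := hz y hy hxy
    omega
  · exact hxy (hX x hx hxz y hy)

/-- A labeling whose image contains the long node of `G_2` as the image of a leaf is an
isomorphism. -/
lemma IsLabeling.isIso_typeG (h : IsLabeling A A' f) (hα : IsLeaf A α) {s l : I'}
    (hG : IsG₂ A' s l) (hl : f α = l) : IsIso A A' f := by
  subst hl
  have hA := h.left
  have hA' := h.right
  have hsl := hG.ne
  -- The highest weight is now the highest root `θ`, and `![3, 1]` are the relative squared lengths
  -- of the long and the short simple root.
  have bad : ∀ lst w, Depth A α (vec lst) → lst.map f = w.map hG.equiv →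
      0 ≤ wordGap CartanMatrix.G₂ ![3, 1] 0 w := fun lst w hw e =>
    wordGap_nonneg hG.equiv (hG.equiv_entry hA') (by decide) (by decide) (by decide)
      (e ▸ h.depth_map hα hw)
  rcases h.exists_fold hα (hG.isBondPath' h.right) rfl with hiso | ⟨p, hp0, hp, hlab, -, h3, h4, h5⟩
  · exact hiso
  exfalso
  simp only [if_true, zero_add, one_ne_zero, if_false, hG.short, hG.long] at h3 h4 h5
  have hne := hp.ne (i := 0) (j := 1) (by omega) (by omega) (by omega)
  have h6 := hA.le_neg_one hne (hp.adj 0 (by omega))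
  have h7 := hA.le_neg_one hne.symm (hp.adj' hA (i := 0) (by omega))
  have lq : f (p 1) = s := hlab 1 (by omega)
  rw [hp0] at h3 h4 h5 h6 h7 hne
  obtain ⟨q, hq⟩ : ∃ q, p 1 = q := ⟨_, rfl⟩
  rw [hq] at h3 h4 h5 h6 h7 hne lq
  clear hp hp0 hlab hq p
  have hqα : A q α = -1 := by omega
  have hαX : ∀ t, t ≠ α → t ≠ q → A α t = 0 := fun t ht htq => by
    by_contra h0
    exact htq (hα.eq ht hne.symm h0 (by omega))
  have w1 : Depth A α (vec [α]) := depth_singleton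
  have w2 : Depth A α (vec [q, α]) :=
    hA.depth_cons w1 (z := α) (by simp) (by simp) (by simp [hne.symm]) (by omega)
  have hd2 := hA.diag
  have lab : ∀ t, t ≠ α → t ≠ q → A q t ≠ 0 → f t = s := by
    intro t ht htq hqt
    refine (hG.cover _).resolve_right fun ht' => ?_
    have := bad [t, q, α] [0, 1, 0]
      (hA.depth_cons w2 (z := q) (by simp) (by simp) (by simp [ht, htq]) hqt)
      (by simp [lq, ht', hG.equiv_apply])
    revert this; decide
  -- a lift of the weight of depth `(1, 3)`
  obtain ⟨d, hd, e⟩ := (h.depth_iff α hα (vec [s, s, s, f α])).1 (by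
    have : Depth A' (f α) (vec [f α]) := depth_singleton
    exact this.replicate s 3 (by simp [hsl, hG.long]))
  have hnn := hA.nonneg α d hd
  have es : push f d s = 3 := by rw [e]; simp [vec, hsl.symm]
  have el : push f d (f α) = 1 := by rw [e]; simp [vec, hsl]
  have hdα : d α = 1 := by
    obtain ⟨x, -, hx⟩ := exists_of_push_pos (f := f) (d := d) (j := s) (by omega)
    have := hd.pos hA hx
    have := le_push (f := f) hnn α
    omega
  have hdl : ∀ y, y ≠ α → f y = f α → d y = 0 := by
    intro y hy hfy
    have := sum_le_push (f := f) hnn {α, y} (j := f α) (by simp [hfy])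
    rw [Finset.sum_pair hy.symm] at this
    have := hnn y
    omega
  -- With the support in `α, q`, the coefficient of `q` is 3. The reflection in `q` would make it
  -- negative, because `A α q ≥ -2`.
  obtain ⟨t, ht, htq, hqt, hdt⟩ : ∃ t, t ≠ α ∧ t ≠ q ∧ A q t ≠ 0 ∧ d t ≠ 0 := by
    by_contra! hno
    have h0 : ∀ t, t ∉ ({α, q} : Finset I) → d t = 0 := fun t ht =>
      hd.exists_adj hA {α, q} (by simp) (z := q) (by simp_all)
        (fun t ht h => by
          simp only [Set.mem_insert_iff, Set.mem_singleton_iff, not_or] at ht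
          exact hno t ht.1 ht.2 h)
        (by simpa using ht)
    have h1 := push_eq_sum (f := f) (d := d) (j := s) {q} (by simp [lq]) (fun i hi hfi => by
      refine h0 i ?_
      simp only [Finset.mem_singleton] at hi
      have : i ≠ α := fun e => hsl (by rw [← hfi, e])
      simp [this, hi])
    have h2 := hA.le_add_wt hd q
    rw [wt_eq_sum {α, q} h0, Finset.sum_pair hne, if_neg hne.symm, hd2] at h2
    simp only [Finset.sum_singleton] at h1
    rw [es] at h1
    rw [← h1, hdα] at h2
    omega
  have lt := lab t ht htq hqt
  have hαt := hαX t ht htq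
  have hn1 := hA.le_neg_one (Ne.symm htq) hqt
  have hn2 := hA.le_neg_one htq (hA.ne_zero_symm hqt)
  have w3 : Depth A α (vec [t, q, α]) :=
    hA.depth_cons w2 (z := q) (by simp) (by simp) (by simp [ht, htq]) hqt
  -- This and the next two claims have the same reason: otherwise some word has one long and four
  -- short labels, but `θ - l - 4s` is longer than `θ`.
  have hαq : A α q = -1 := by
    by_contra h0
    have w4 := (w1.replicate q 2 (by simp [hne.symm]; omega)).replicate t 2
      (by simp [ht, hαt, List.replicate]; omega)
    have := bad ([t, t, q, q, α]) [1, 1, 1, 1, 0] w4 (by simp [lq, lt, hG.equiv_apply])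
    revert this; decide
  have hqt1 : A q t = -1 := by
    by_contra h0
    have w4 := (w2.replicate t 2 (by simp [ht, hαt]; omega)).cons q
      (by simp [hne.symm, hd2, hαq, List.replicate]; omega)
    have := bad ([q, t, t, q, α]) [1, 1, 1, 1, 0] w4 (by simp [lq, lt, hG.equiv_apply])
    revert this; decide
  have huniq : ∀ u, u ≠ α → u ≠ q → u ≠ t → A q u = 0 := by
    intro u hu huq hut
    by_contra hqu
    have hn3 := hA.le_neg_one huq (hA.ne_zero_symm hqu)
    have w4 : Depth A α (vec [u, t, q, α]) :=
      hA.depth_cons w3 (z := q) (by simp) (by simp) (by simp [hu, huq, hut]) hqu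
    have := bad [q, u, t, q, α] [1, 1, 1, 1, 0] (w4.cons q
      (by simp [hne.symm, hd2, hαq]; omega))
      (by simp [lq, lt, lab u hu huq hqu, hG.equiv_apply])
    revert this; decide
  have hX : ∀ d, Depth A α d → (∀ z, z ≠ α → z ≠ q → z ≠ t → A t z ≠ 0 → d z = 0) →
      ∀ z, z ∉ ({α, q, t} : Finset I) → d z = 0 := fun d hd h0 z hz =>
    hd.exists_adj hA {α, q, t} (by simp) (z := t)
      (fun x hx hxt y hy => by
        simp only [Set.mem_insert_iff, Set.mem_singleton_iff, not_or] at hx hy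
        rcases hx with rfl | rfl | rfl
        · exact hαX y hy.1 hy.2.1
        · exact huniq y hy.1 hy.2.1 hy.2.2
        · exact absurd rfl hxt)
      (fun t ht h => by
        simp only [Set.mem_insert_iff, Set.mem_singleton_iff, not_or] at ht
        exact h0 t ht.1 ht.2.1 ht.2.2 h)
      (by simpa using hz)
  have htα0 := hA.zero _ _ hαt
  have hsum : ∀ d, (∀ z, z ∉ ({α, q, t} : Finset I) → d z = 0) → ∀ i,
      wt A α d i = (if i = α then 1 else 0) - (d α * A α i + (d q * A q i + d t * A t i)) := by
    intro d h0 i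
    rw [wt_eq_sum _ h0, Finset.sum_insert (by simp [hne, ht.symm]), Finset.sum_pair htq.symm]
  -- either the edge between `q` and `t` is not simple or `t` has another short neighbour
  have hor : A t q ≤ -2 ∨ ∃ w, w ≠ α ∧ w ≠ q ∧ w ≠ t ∧ A t w ≠ 0 ∧ f w = s := by
    by_contra! hno
    have h0 := hX d hd fun z hz hzq hzt htz => hdl z hz
      ((hG.cover _).resolve_left (hno.2 z hz hzq hzt htz))
    have h1 := push_eq_sum (f := f) (d := d) (j := s) {q, t} (by simp [lq, lt]) (fun i hi hfi => by
      refine h0 i ?_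
      simp only [Finset.mem_insert, Finset.mem_singleton, not_or] at hi
      have : i ≠ α := fun e => hsl (by rw [← hfi, e])
      simp [this, hi])
    rw [es, Finset.sum_pair htq.symm] at h1
    have h2 := hA.le_add_wt hd q
    have h3 := hA.le_add_wt hd t
    have h4 := hd.reflect q
    rw [hsum d h0, if_neg hne.symm, hdα, hαq, hd2] at h2 h4
    rw [hsum d h0, if_neg ht, hdα, hαt, hqt1, hd2] at h3
    have h6 := hnn q
    have h7 : A t q = -1 := by
      have := hno.1
      omega
    rw [h7] at h2 h4
    -- If `d t = 1`, the reflection in `q` removes `q` and cuts `t` off from `α`. If `d t = 2`, the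
    -- reflection in `t` makes its coefficient negative.
    obtain h8 | h8 : d t = 1 ∨ d t = 2 := by omega
    · have h9 : d q = 2 := by omega
      rw [h8, h9] at h4
      obtain ⟨x, hx, y, hy, hdx, hdy, hxy⟩ := hA.exists_boundary (X := {α}) rfl h4 (t₀ := t)
        (by simpa using ht) (by simp [htq, h8])
      rw [Set.mem_singleton_iff] at hx hy
      subst hx
      by_cases hyq : y = q
      · subst hyq; simp [h9] at hdy
      · exact hxy (hαX y hy hyq)
    · omega
  -- a lift of the weight of depth `(2, 2)`
  obtain ⟨d', hd', e'⟩ := (h.depth_iff α hα (vec [f α, s, s, f α])).1 (by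
    have : Depth A' (f α) (vec [f α]) := depth_singleton
    exact (this.replicate s 2 (by simp [hsl, hG.long])).cons (f α)
      (by simp [hG.short, hA'.diag]))
  have hnn' := hA.nonneg α d' hd'
  have es' : push f d' s = 2 := by rw [e']; simp [vec, hsl.symm]
  have el' : push f d' (f α) = 2 := by rw [e']; simp [vec, hsl]
  -- Leaving `α, q, t` by a short node would use three short labels, one too many. Inside `α, q, t`
  -- the coefficient of `α` would be 2, and simple reflections lead to a negative coefficient or to
  -- a support without `α`.
  obtain ⟨z, hz, hzq, hzt, htz, hfz⟩ : ∃ z, z ≠ α ∧ z ≠ q ∧ z ≠ t ∧ A t z ≠ 0 ∧ f z = f α := by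
    by_contra! hno
    have hqpos : ∀ z, z ≠ α → 0 < d' z → 0 < d' q := by
      intro z hz hdz
      obtain ⟨x, hx, y, hy, hdx, hdy, hxy⟩ := hA.exists_boundary (X := {α}) rfl hd' (t₀ := z)
        (by simpa using hz) hdz
      rw [Set.mem_singleton_iff] at hx hy
      subst hx
      by_cases hyq : y = q
      · exact hyq ▸ hdy
      · exact absurd (hαX y hy hyq) hxy
    by_cases hout : ∃ z, z ∉ ({α, q, t} : Finset I) ∧ d' z ≠ 0
    · obtain ⟨z, hz, hdz⟩ := hout
      obtain ⟨x, hx, y, hy, hdx, hdy, hxy⟩ := hA.exists_boundary (X := {α, q, t}) (by simp) hd'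
        (t₀ := z) (by simpa using hz) ((hnn' z).lt_of_ne (Ne.symm hdz))
      simp only [Set.mem_insert_iff, Set.mem_singleton_iff, not_or] at hx hy
      rcases hx with rfl | rfl | rfl
      · exact hxy (hαX y hy.1 hy.2.1)
      · exact hxy (huniq y hy.1 hy.2.1 hy.2.2)
      · have hfy := (hG.cover _).resolve_right (hno y hy.1 hy.2.1 hy.2.2 hxy)
        have h1 := hqpos y hy.1 hdy
        have h2 := sum_le_push (f := f) hnn' {q, x, y} (j := s) (by simp [lq, lt, hfy])
        rw [Finset.sum_insert (by simp [htq.symm, Ne.symm hy.2.1]),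
          Finset.sum_pair (Ne.symm hy.2.2)] at h2
        omega
    · push Not at hout
      have h1 := push_eq_sum (f := f) (d := d') (j := s) {q, t} (by simp [lq, lt])
        (fun i hi hfi => by
          refine hout i ?_
          simp only [Finset.mem_insert, Finset.mem_singleton, not_or] at hi
          have : i ≠ α := fun e => hsl (by rw [← hfi, e])
          simp [this, hi])
      have h2 := push_eq_sum (f := f) (d := d') (j := f α) {α} (by simp) (fun i hi hfi => by
        refine hout i ?_
        have : i ≠ q := fun e => hsl (by rw [← hfi, e, lq])
        have : i ≠ t := fun e => hsl (by rw [← hfi, e, lt])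
        simp_all)
      rw [es', Finset.sum_pair htq.symm] at h1
      rw [el', Finset.sum_singleton] at h2
      have h3 := hA.le_add_wt hd' t
      rw [hsum d' hout, if_neg ht, hαt, hqt1, hd2] at h3
      have h4 := hnn' t
      obtain h5 | h5 : d' t = 0 ∨ d' t = 1 := by omega
      · have h6 := hA.le_add_wt (hd'.reflect q) α
        rw [wt_add_single, hsum d' hout, hsum d' hout, if_pos rfl, if_neg hne.symm, hd2, hd2, hαq,
          hqα, htα0, ← h2, h5] at h6
        simp [hne, ← h2] at h6
        omega
      · have h6 := (hd'.reflect α).pos hA (t := t) (by simp [ht, h5])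
        rw [hsum d' hout] at h6
        simp [hd2, hqα, htα0, ← h2] at h6
        omega
  have hnz := hA.le_neg_one hzt (hA.ne_zero_symm htz)
  have w4 : Depth A α (vec [z, t, q, α]) :=
    hA.depth_cons w3 (z := t) (by simp) (by simp) (by simp [hz, hzq, hzt]) htz
  -- Both cases produce a word with two long and five short labels, but `θ - 2l - 5s = -2s` is
  -- longer than `θ`.
  rcases hor with h0 | ⟨w, hw, hwq, hwt, htw, hfw⟩
  · have hzq0 := hA.off _ _ hzq
    have w5 := w4.cons q (by simp [hne.symm, hd2, hαq]; omega)
    have w6 := w5.cons t (by simp [ht, hd2, hqt1, hαt]; omega)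
    have w7 := w6.cons q (by simp [hne.symm, hd2, hαq]; omega)
    have := bad [q, t, q, z, t, q, α] [1, 1, 1, 0, 1, 1, 0] w7
      (by simp [lq, lt, hfz, hG.equiv_apply])
    revert this; decide
  · have hwz : w ≠ z := fun e => hsl (by rw [← hfw, ← hfz, e])
    have hnw := hA.le_neg_one hwt (hA.ne_zero_symm htw)
    have hzq0 := hA.off _ _ hzq
    have hwq0 := hA.off _ _ hwq
    have w5 : Depth A α (vec [w, z, t, q, α]) :=
      hA.depth_cons w4 (z := t) (by simp) (by simp) (by simp [hw, hwq, hwt, hwz]) htw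
    have w6 := w5.cons t (by simp [ht, hd2, hqt1, hαt]; omega)
    have w7 := w6.cons q (by simp [hne.symm, hd2, hαq]; omega)
    have := bad [q, t, w, z, t, q, α] [1, 1, 1, 0, 1, 1, 0] w7
      (by simp [lq, lt, hfz, hfw, hG.equiv_apply])
    revert this; decide

end TypeG

/-! ### Lifting of paths; C over its long end and B over its short end. -/

section LongEnds

variable {I I' : Type*} [Fintype I] [DecidableEq I] [Fintype I'] [DecidableEq I']
  {A : Matrix I I ℤ} {A' : Matrix I' I' ℤ} {α : I} {β : I'} {d : I → ℤ} {f : I → I'}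

/-- A path of `J` that starts in the image of a leaf lifts to `L`. -/
lemma IsLabeling.exists_path_lift (h : IsLabeling A A' f) (hα : IsLeaf A α) {b : ℕ → I'} {k : ℕ}
    (hb : IsPath A' b (k + 1)) (h0 : b 0 = f α) :
    ∃ x : ℕ → I, x 0 = α ∧ IsPath A x (k + 1) ∧ ∀ i < k + 1, f (x i) = b i := by
  have hA := h.left
  -- Lift the weight in which every node of the path is subtracted once. Each label then occurs
  -- exactly once in `d`, which makes the path inside its support unambiguous.
  obtain ⟨d, hd, e⟩ := (h.depth_iff α hα _).1 (h0 ▸ hb.conn.depth h.right)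
  have hnn := hA.nonneg α d hd
  have hcount : ∀ i < k + 1, push f d (b i) = 1 := fun i hi => by
    rw [e, vec, List.count_eq_one_of_mem hb.conn.nodup (mem_pathWord.2 ⟨i, hi, rfl⟩), Nat.cast_one]
  have key : ∀ n < k + 1, ∃ x : ℕ → I, x 0 = α ∧ IsPath A x (n + 1) ∧
      (∀ i < n + 1, f (x i) = b i) ∧ ∀ i < n + 1, 0 < d (x i) := by
    intro n
    induction n with
    | zero =>
      intro _
      refine ⟨fun _ => α, rfl, ⟨fun i hi j hj _ => by omega, fun i j _ _ => by omega,
        fun i hi => by omega⟩, fun i hi => by rw [show i = 0 by omega, h0], fun i hi => ?_⟩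
      obtain ⟨t, -, ht⟩ := exists_of_push_pos (f := f) (d := d) (j := b 0) (by
        rw [hcount 0 (by omega)]; exact one_pos)
      exact hd.pos hA ht
    | succ n ih =>
      intro hn
      obtain ⟨x, hx0, hx, hlab, hpos⟩ := ih (by omega)
      obtain ⟨t₀, ht₀, hdt₀⟩ := exists_of_push_pos (f := f) (d := d) (j := b (n + 1)) (by
        rw [hcount _ hn]; exact one_pos)
      obtain ⟨y, hy, t, ht, -, hdt, hyt⟩ := hA.exists_boundary (X := {y | y ∈ pathWord x (n + 1)})
        (mem_pathWord.2 ⟨0, by omega, hx0⟩) hd (t₀ := t₀) (fun hm => by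
          obtain ⟨i, hi, rfl⟩ := mem_pathWord.1 hm
          rw [hlab i hi] at ht₀
          have := hb.inj i (by omega) (n + 1) hn ht₀
          omega) hdt₀
      obtain ⟨i, hi, rfl⟩ := mem_pathWord.1 hy
      have hxt : ∀ s < n + 1, x s ≠ t := fun s hs hst => ht (mem_pathWord.2 ⟨s, hs, hst⟩)
      obtain ⟨s, hs, hst⟩ : ∃ s < k + 1, b s = f t := by
        have := le_push (f := f) hnn t
        rw [e] at this
        exact mem_pathWord.1 (vec_pos.1 (hdt.trans_le this))
      -- The labels `b 0, …, b n` are already used up by the nodes found so far.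
      have hsn : n < s := by
        by_contra hle
        have h1 := sum_le_push (f := f) hnn {x s, t} (j := b s) (by
          simp [hlab s (by omega), hst])
        rw [Finset.sum_pair (hxt s (by omega)), hcount s hs] at h1
        have := hpos s (by omega)
        omega
      have ht' : t ∉ pathWord x (i + 1) := fun hm => by
        obtain ⟨r, hr, hrt⟩ := mem_pathWord.1 hm
        exact hxt r (by omega) hrt
      have hw : Depth A α (vec (t :: pathWord x (i + 1))) :=
        hA.depth_cons ((hx.mono (by omega)).depth hA hx0) (mem_pathWord.2 ⟨0, by omega, hx0⟩)
          (z := x i) (by simp) ht' hyt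
      have hw' := h.depth_map hα hw
      have hmap : (pathWord x (i + 1)).map f = pathWord b (i + 1) := by
        rw [map_pathWord]
        exact pathWord_congr fun r hr => hlab r (by omega)
      rw [List.map_cons, ← hst, hmap] at hw'
      -- Subtracting `t` directly after `x i` gives a weight, so `b s` is linked to one of `b 0, …,
      -- b i`. As `b` is an induced path, `s ≤ i + 1 ≤ n + 1`, which forces `s = n + 1` and `i = n`.
      obtain ⟨u, hu, v, hv, -, hdv, huv⟩ := h.right.exists_boundary
        (X := {y | y ∈ pathWord b (i + 1)}) (mem_pathWord.2 ⟨0, by omega, h0⟩) hw' (t₀ := b s)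
        (fun hm => by
          obtain ⟨r, hr, e⟩ := mem_pathWord.1 hm
          have := hb.inj r (by omega) s hs e
          omega) (vec_pos.2 (by simp))
      obtain rfl : v = b s := (List.mem_cons.1 (vec_pos.1 hdv)).resolve_right hv
      obtain ⟨r, hr, rfl⟩ := mem_pathWord.1 hu
      have hsr : s ≤ r + 1 := by
        by_contra hlt
        exact huv (hb.far r s (by omega) hs)
      obtain rfl : s = n + 1 := by omega
      obtain rfl : i = n := by omega
      have hup : ∀ l < i + 1, Function.update x (i + 1) t l = x l := fun l hl =>
        Function.update_of_ne (by omega) _ _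
      refine ⟨Function.update x (i + 1) t, by rw [hup 0 (by omega), hx0], hx.snoc hA ht hyt,
        fun l hl => ?_, fun l hl => ?_⟩
      · rcases Nat.lt_succ_iff_lt_or_eq.1 hl with hl' | rfl
        · rw [hup l hl', hlab l hl']
        · rw [Function.update_self, hst]
      · rcases Nat.lt_succ_iff_lt_or_eq.1 hl with hl' | rfl
        · rw [hup l hl']; exact hpos l hl'
        · rwa [Function.update_self]
  obtain ⟨x, h1, h2, h3, -⟩ := key k (by omega)
  exact ⟨x, h1, h2, h3⟩

/-- No proper fold maps a leaf to the long node of `C_m`. -/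
lemma IsLabeling.isIso_typeC (h : IsLabeling A A' f) (hα : IsLeaf A α) {b : ℕ → I'} {m : ℕ}
    (hb : IsBondPath A' b m 0) (hm : 3 ≤ m) (h0 : b 0 = f α) (h1 : A' (b 0) (b 1) = -2)
    (h2 : A' (b 1) (b 0) = -1) : IsIso A A' f := by
  have hA := h.left
  have hA' := h.right
  rcases h.exists_fold hα hb h0 with hiso | ⟨p, hp0, hp, hlab, -, h3, h4, h5⟩
  · exact hiso
  exfalso
  simp only [zero_add, h1, h2] at h3 h4 h5
  have hne := hp.ne (i := 0) (j := 1) (by omega) (by omega) (by omega)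
  have h6 := hA.le_neg_one hne (hp.adj 0 (by omega))
  have h7 := hA.le_neg_one hne.symm (hp.adj' hA (i := 0) (by omega))
  have lq : f (p 1) = b 1 := hlab 1 (by omega)
  rw [hp0] at h3 h4 h5 h6 h7 hne
  obtain ⟨q, hq⟩ : ∃ q, p 1 = q := ⟨_, rfl⟩
  rw [hq] at h3 h4 h5 h6 h7 hne lq
  clear hp hp0 hlab hq p
  have b01 : b 0 ≠ b 1 := hb.ne (by omega) (by omega) (by omega)
  have b02 : b 0 ≠ b 2 := hb.ne (by omega) (by omega) (by omega)
  have b12 : b 1 ≠ b 2 := hb.ne (by omega) (by omega) (by omega)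
  have e21 := (hb.simple 1 (by omega) (by omega)).2
  have hαq : A α q = -1 := by omega
  obtain ⟨x, hx0, hx, hlab⟩ := h.exists_path_lift hα (k := 2) (hb.toIsPath.mono hm) h0
  have hx1 : x 1 = q := hα.eq (hx0 ▸ hx.ne (by omega) (by omega) (by omega)) hne.symm
    (hx0 ▸ hx.adj 0 (by omega)) (by omega)
  -- The double edge of `J` allows `b 1` twice. Since the edge from `α` to `q` is simple, the second
  -- one has to come from another neighbour `t` of `q`.
  obtain ⟨d, hd, e⟩ := (h.depth_iff α hα (vec [b 1, b 1, b 0])).1 (by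
    have : Depth A' (f α) (vec [b 0]) := h0 ▸ depth_singleton
    exact this.replicate (b 1) 2 (by simp [h1, ← h0, b01.symm]))
  have hnn := hA.nonneg α d hd
  have e0 : push f d (b 0) = 1 := by rw [e]; simp [vec, b01.symm]
  have e1 : push f d (b 1) = 2 := by rw [e]; simp [vec, b01]
  have hdα : 0 < d α := by
    obtain ⟨y, -, hy⟩ := exists_of_push_pos (f := f) (d := d) (j := b 0) (by omega)
    exact hd.pos hA hy
  have hdα' := le_push (f := f) hnn α
  rw [← h0, e0] at hdα'
  obtain ⟨t, ht, htq, hqt, hdt⟩ : ∃ t, t ≠ α ∧ t ≠ q ∧ A q t ≠ 0 ∧ d t ≠ 0 := by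
    by_contra! hno
    have h8 : ∀ t, t ∉ ({α, q} : Finset I) → d t = 0 := fun t ht =>
      hd.exists_adj hA {α, q} (by simp) (z := q) (fun y hy hyq t ht => by
          simp only [Set.mem_insert_iff, Set.mem_singleton_iff, not_or] at hy ht
          rcases hy with rfl | rfl
          · by_contra hyt
            exact ht.2 (hα.eq ht.1 hne.symm hyt (by omega))
          · exact absurd rfl hyq)
        (fun t ht h => by
          simp only [Set.mem_insert_iff, Set.mem_singleton_iff, not_or] at ht
          exact hno t ht.1 ht.2 h)
        (by simpa using ht)
    have h9 := push_eq_sum (f := f) (d := d) (j := b 1) {q} (by simp [lq]) (fun i hi hfi => by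
      refine h8 i ?_
      simp only [Finset.mem_singleton] at hi
      have : i ≠ α := fun e => b01 (by rw [← hfi, e, h0])
      simp [this, hi])
    have h10 := hA.le_add_wt hd q
    rw [wt_eq_sum {α, q} h8, Finset.sum_pair hne, if_neg hne.symm, hA.diag, hαq] at h10
    rw [e1, Finset.sum_singleton] at h9
    omega
  have ltt : f t = b 1 := by
    have h8 := le_push (f := f) hnn t
    have h9 := hnn t
    rw [e] at h8
    have h10 := vec_pos.1 (show 0 < vec [b 1, b 1, b 0] (f t) by omega)
    simp only [List.mem_cons, List.not_mem_nil, or_false, or_self_left] at h10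
    refine h10.resolve_right fun h11 => ?_
    have := sum_le_push (f := f) hnn {α, t} (j := b 0) (by rw [h0] at h11; simp [h0, h11])
    rw [Finset.sum_pair ht.symm] at this
    omega
  have lx : f (x 2) = b 2 := hlab 2 (by omega)
  have hqx : A q (x 2) ≠ 0 := hx1 ▸ hx.adj 1 (by omega)
  have hxα : x 2 ≠ α := fun h8 => b02 (by rw [h0, ← lx, h8])
  have hxq : x 2 ≠ q := fun h8 => b12 (by rw [← lx, h8, lq])
  have hxt : x 2 ≠ t := fun h8 => b12 (by rw [← lx, h8, ltt])
  have hn1 := hA.le_neg_one htq (hA.ne_zero_symm hqt)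
  have hn2 := hA.le_neg_one hxq (hA.ne_zero_symm hqx)
  have w1 : Depth A α (vec [α]) := depth_singleton
  have w2 : Depth A α (vec [q, α]) :=
    hA.depth_cons w1 (z := α) (by simp) (by simp) (by simp [hne.symm]) (by omega)
  have w3 : Depth A α (vec [t, q, α]) :=
    hA.depth_cons w2 (z := q) (by simp) (by simp) (by simp [ht, htq]) hqt
  have w4 : Depth A α (vec [x 2, t, q, α]) :=
    hA.depth_cons w3 (z := q) (by simp) (by simp) (by simp [hxα, hxq, hxt]) hqx
  have w5 := h.depth_map hα (w4.cons q (by simp [hne.symm, hA.diag, hαq]; omega))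
  simp only [List.map_cons, List.map_nil, lq, lx, ltt, ← h0] at w5
  -- The label `b 1` occurs three times and the pairing with it is `-3`. The reflection removes it,
  -- and `b 2` loses its connection to `b 0`.
  have w6 := w5.reflect (b 1)
  rw [wt_vec] at w6
  simp [b01.symm, hA'.diag, h1, e21] at w6
  obtain ⟨u, hu, v, hv, -, hdv, huv⟩ := hA'.exists_boundary (X := {b 0}) rfl w6 (t₀ := b 2)
    (by simpa using b02.symm) (by simp [vec, b12.symm])
  rw [Set.mem_singleton_iff] at hu hv
  subst hu
  by_cases hv1 : v = b 1
  · subst hv1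
    simp [vec, b12.symm, b01] at hdv
  · rw [Pi.add_apply, Pi.single_eq_of_ne hv1, add_zero] at hdv
    have := vec_pos.1 hdv
    simp only [List.mem_cons, List.not_mem_nil, or_false, hv, hv1, false_or] at this
    subst this
    exact huv (hb.far 0 2 (by omega) (by omega))

/-- If a leaf is mapped to the short end of `B_m`, then another one is mapped to the long end. -/
lemma IsLabeling.exists_leaf_typeB (h : IsLabeling A A' f) (hα : IsLeaf A α) {b : ℕ → I'} {m : ℕ}
    (hb : IsBondPath A' b m 0) (hm : 3 ≤ m) (h0 : b 0 = f α) (h1 : A' (b 0) (b 1) = -1)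
    (h2 : A' (b 1) (b 0) = -2) : IsIso A A' f ∨ ∃ α', IsLeaf A α' ∧ f α' = b (m - 1) := by
  have hA := h.left
  have hA' := h.right
  rcases h.exists_fold hα hb h0 with hiso | ⟨p, hp0, hp, hlab, -, h3, h4, h5⟩
  · exact .inl hiso
  right
  simp only [zero_add, h1, h2] at h3 h4 h5
  have hne := hp.ne (i := 0) (j := 1) (by omega) (by omega) (by omega)
  have h6 := hA.le_neg_one hne (hp.adj 0 (by omega))
  have h7 := hA.le_neg_one hne.symm (hp.adj' hA (i := 0) (by omega))
  have lq : f (p 1) = b 1 := hlab 1 (by omega)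
  rw [hp0] at h3 h4 h5 h6 h7 hne
  obtain ⟨q, hq⟩ : ∃ q, p 1 = q := ⟨_, rfl⟩
  rw [hq] at h3 h4 h5 h6 h7 hne lq
  clear hp hp0 hlab hq p
  have b01 : b 0 ≠ b 1 := hb.ne (by omega) (by omega) (by omega)
  have hαq : A α q = -1 := by omega
  have hqα : A q α = -1 := by omega
  obtain ⟨m, rfl⟩ : ∃ m', m = m' + 3 := ⟨m - 3, by omega⟩
  obtain ⟨x, hx0, hx, hlab⟩ := h.exists_path_lift hα (k := m + 2) hb.toIsPath h0
  have hx1 : x 1 = q := hα.eq (hx0 ▸ hx.ne (by omega) (by omega) (by omega)) hne.symm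
    (hx0 ▸ hx.adj 0 (by omega)) (by omega)
  refine ⟨x (m + 2), ?_, hlab _ (by omega)⟩
  -- A further neighbour `y` of the lifted end could be attached to the whole path. Whatever its
  -- label `b s` is, a reflection in that node contradicts connectedness or nonnegativity.
  by_contra hleaf
  obtain ⟨d, hd, e⟩ := (h.depth_iff α hα (vec [b 0, b 1, b 0])).1 (by
    have : Depth A' (f α) (vec [b 0]) := h0 ▸ depth_singleton
    exact (this.cons (b 1) (by simp [h1, ← h0, b01.symm])).cons (b 0)
      (by simp [h2, ← h0, hA'.diag]))
  have hnn := hA.nonneg α d hd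
  have e0 : push f d (b 0) = 2 := by rw [e]; simp [vec, b01.symm]
  have e1 : push f d (b 1) = 1 := by rw [e]; simp [vec, b01]
  have hαX : ∀ t, t ≠ α → t ≠ q → A α t = 0 := fun t ht htq => by
    by_contra hyt
    exact htq (hα.eq ht hne.symm hyt (by omega))
  have hdq : 0 < d q := by
    obtain ⟨y, hfy, hy⟩ := exists_of_push_pos (f := f) (d := d) (j := b 1) (by omega)
    obtain ⟨u, hu, v, hv, -, hdv, huv⟩ := hA.exists_boundary (X := {α}) rfl hd (t₀ := y)
      (fun hm => b01 (by rw [h0, ← hfy, Set.mem_singleton_iff.1 hm])) hy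
    rw [Set.mem_singleton_iff] at hu hv
    subst hu
    by_cases hvq : v = q
    · exact hvq ▸ hdv
    · exact absurd (hαX v hv hvq) huv
  -- Otherwise `α` alone would account for the label `b 0`, with coefficient 2, and the reflection
  -- in `α` would remove it from the support.
  obtain ⟨t, ht, htq, hqt, hdt⟩ : ∃ t, t ≠ α ∧ t ≠ q ∧ A q t ≠ 0 ∧ d t ≠ 0 := by
    by_contra! hno
    have h8 : ∀ t, t ∉ ({α, q} : Finset I) → d t = 0 := fun t ht =>
      hd.exists_adj hA {α, q} (by simp) (z := q) (fun y hy hyq t ht => by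
          simp only [Set.mem_insert_iff, Set.mem_singleton_iff, not_or] at hy ht
          rcases hy with rfl | rfl
          · exact hαX t ht.1 ht.2
          · exact absurd rfl hyq)
        (fun t ht h => by
          simp only [Set.mem_insert_iff, Set.mem_singleton_iff, not_or] at ht
          exact hno t ht.1 ht.2 h)
        (by simpa using ht)
    have h9 := push_eq_sum (f := f) (d := d) (j := b 0) {α} (by simp [h0]) (fun i hi hfi => by
      refine h8 i ?_
      simp only [Finset.mem_singleton] at hi
      have : i ≠ q := fun e => b01 (by rw [← hfi, e, lq])
      simp [this, hi])
    have h10 := le_push (f := f) hnn q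
    rw [lq, e1] at h10
    rw [e0, Finset.sum_singleton] at h9
    have h11 := (hd.reflect α).pos hA (t := q) (by simpa [hne.symm] using hdq)
    rw [wt_eq_sum {α, q} h8, Finset.sum_pair hne, if_pos rfl, hA.diag, hqα] at h11
    simp at h11
    omega
  have ltt : f t = b 0 := by
    have h8 := le_push (f := f) hnn t
    have h9 := hnn t
    rw [e] at h8
    have h10 := vec_pos.1 (show 0 < vec [b 0, b 1, b 0] (f t) by omega)
    simp only [List.mem_cons, List.not_mem_nil, or_false] at h10
    have h11 : f t ≠ b 1 := fun h11 => by
      have := sum_le_push (f := f) hnn {q, t} (j := b 1) (by simp [lq, ← h11])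
      rw [Finset.sum_pair htq.symm] at this
      omega
    tauto
  obtain ⟨y, hyx, hyx', hxy⟩ := exists_ne_of_not_isLeaf hleaf
    (hx.ne (i := m + 1) (j := m + 2) (by omega) (by omega) (by omega))
    (hx.adj' hA (i := m + 1) (by omega))
  have hyw : y ∉ pathWord x (m + 3) := fun hm => by
    obtain ⟨i, hi, e⟩ := mem_pathWord.1 hm
    have h8 : i ≠ m + 2 := fun h => hyx (by rw [← e, h])
    have h9 : i ≠ m + 1 := fun h => hyx' (by rw [← e, h])
    have h10 : A (x (m + 2)) (x i) = 0 := hx.far' hA (i := i) (j := m + 2) (by omega) (by omega)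
    exact hxy (e ▸ h10)
  have w1 := hA.depth_cons (hx.depth hA hx0) (mem_pathWord.2 ⟨0, by omega, hx0⟩) (z := x (m + 2))
    (by simp) hyw hxy
  have hmap : (pathWord x (m + 3)).map f = pathWord b (m + 3) := by
    rw [map_pathWord]
    exact pathWord_congr fun r hr => hlab r (by omega)
  obtain ⟨s, hs, hsy⟩ := hb.cover (f y)
  have hxt : ∀ i < m + 3, x i ≠ t := fun i hi hit => by
    have h8 := hlab i hi
    rw [hit, ltt] at h8
    have := hb.inj 0 (by omega) i hi h8
    subst this
    exact ht (hit ▸ hx0)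
  have hcol : ∀ s, 1 ≤ s → s < m + 3 → ((pathWord b (m + 3)).map (A' · (b s))).sum =
      1 - if s + 1 < m + 3 then 1 else 0 := by
    intro s hs1 hs
    rw [sum_map_pathWord b (A' · (b s))]
    have h8 : ∀ i ∈ Finset.range (m + 3), A' (b i) (b s) = (if i = s then 2 else 0) -
        (if i = s - 1 then 1 else 0) - if i = s + 1 then 1 else 0 := fun i hi => by
      rw [hb.entry hA' h1 h2 (Finset.mem_range.1 hi) hs]
      split_ifs <;> omega
    rw [Finset.sum_congr rfl h8]
    simp only [Finset.sum_sub_distrib, Finset.sum_ite_eq', Finset.mem_range]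
    split_ifs <;> omega
  have hsα : ∀ s, 1 ≤ s → s < m + 3 → b s ≠ f α := fun s hs1 hs =>
    h0 ▸ hb.ne hs (by omega) (by omega)
  have hcnt : ∀ s < m + 3, vec (pathWord b (m + 3)) (b s) = 1 := fun s hs => by
    rw [vec, List.count_eq_one_of_mem hb.conn.nodup (mem_pathWord.2 ⟨s, hs, rfl⟩), Nat.cast_one]
  -- For `s = 0`, adding `t` as well makes `b 0` occur three times with pairing `-3`; the reflection
  -- removes the starting node itself.
  by_cases hs0 : s = 0
  · subst hs0
    have hty : t ≠ y := by
      rintro rfl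
      have := hx.conn.eq_of_adj hA hyw (x := x 1) (z := x (m + 2))
        (mem_pathWord.2 ⟨1, by omega, rfl⟩) (by simp) (hx1 ▸ hqt) hxy
      have := hx.inj 1 (by omega) (m + 2) (by omega) this
      omega
    have w2 := h.depth_map hα (hA.depth_cons w1
      (List.mem_cons_of_mem _ (mem_pathWord.2 ⟨0, by omega, hx0⟩)) (z := q) (s := t)
      (List.mem_cons_of_mem _ (mem_pathWord.2 ⟨1, by omega, hx1⟩)) (fun hm => by
        rcases List.mem_cons.1 hm with h8 | h8
        · exact hty h8
        · obtain ⟨i, hi, h9⟩ := mem_pathWord.1 h8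
          exact hxt i hi h9) hqt)
    rw [List.map_cons, List.map_cons, ltt, ← hsy, hmap] at w2
    have hsum0 : ((pathWord b (m + 3)).map (A' · (b 0))).sum = 0 := by
      rw [sum_map_pathWord b (A' · (b 0))]
      have h8 : ∀ i ∈ Finset.range (m + 3), A' (b i) (b 0) = (if i = 0 then 2 else 0) -
          (if i = 1 then 2 else 0) := fun i hi => by
        rw [hb.entry hA' h1 h2 (Finset.mem_range.1 hi) (by omega)]
        rcases i with _ | _ | i <;> simp
      rw [Finset.sum_congr rfl h8]
      simp
    have h8 := (w2.reflect (b 0)).pos hA' (t := b 1) (by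
      rw [Pi.add_apply, Pi.single_eq_of_ne b01.symm, add_zero, vec_pos]
      exact List.mem_cons_of_mem _ (List.mem_cons_of_mem _ (mem_pathWord.2 ⟨1, by omega, rfl⟩)))
    rw [wt_vec, List.map_cons, List.map_cons, List.sum_cons, List.sum_cons, hsum0, if_pos h0,
      hA'.diag, ← h0, Pi.add_apply, Pi.single_eq_same, vec_cons, vec_cons, Pi.add_apply,
      Pi.add_apply, hcnt 0 (by omega), Pi.single_eq_same] at h8
    omega
  -- For `s > 0`, `b s` occurs twice. After the reflection its coefficient is `-1` at the far end,
  -- and otherwise `0`, which cuts off `b (s + 1)`.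
  · have w2 := h.depth_map hα w1
    rw [List.map_cons, ← hsy, hmap] at w2
    have h8 := hcol s (by omega) hs
    have hwt : vec (b s :: pathWord b (m + 3)) (b s) +
        wt A' (f α) (vec (b s :: pathWord b (m + 3))) (b s) =
        if s + 1 < m + 3 then 0 else -1 := by
      rw [wt_vec, List.map_cons, List.sum_cons, h8, if_neg (hsα s (by omega) hs), hA'.diag,
        vec_cons, Pi.add_apply, hcnt s hs, Pi.single_eq_same]
      split_ifs <;> omega
    have h9 := hA'.le_add_wt w2 (b s)
    rw [hwt] at h9
    have hs2 : s + 1 < m + 3 := by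
      by_contra hlt
      rw [if_neg hlt] at h9
      omega
    rw [if_pos hs2] at hwt
    obtain ⟨u, hu, v, hv, -, hdv, huv⟩ := hA'.exists_boundary (X := {y | y ∈ pathWord b s})
      (mem_pathWord.2 ⟨0, by omega, h0⟩) (w2.reflect (b s)) (t₀ := b (s + 1)) (fun hm => by
        obtain ⟨i, hi, e⟩ := mem_pathWord.1 hm
        have := hb.inj i (by omega) (s + 1) hs2 e
        omega) (by
        rw [Pi.add_apply, Pi.single_eq_of_ne (hb.ne hs2 hs (by omega)), add_zero, vec_pos]
        exact List.mem_cons_of_mem _ (mem_pathWord.2 ⟨s + 1, hs2, rfl⟩))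
    obtain ⟨i, hi, rfl⟩ := mem_pathWord.1 hu
    obtain ⟨r, hr, rfl⟩ := hb.cover v
    have hr1 : s ≤ r := by
      by_contra hlt
      exact hv (mem_pathWord.2 ⟨r, by omega, rfl⟩)
    by_cases hrs : r = s
    · subst hrs
      rw [Pi.add_apply, Pi.single_eq_same, hwt] at hdv
      omega
    · exact huv (hb.far i r (by omega) hr)

end LongEnds

/-! ### Target F₄. -/

section TypeF

variable {I I' : Type*} [Fintype I] [DecidableEq I] [Fintype I'] [DecidableEq I']
  {A : Matrix I I ℤ} {A' : Matrix I' I' ℤ} {α : I} {d : I → ℤ} {f : I → I'}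

/-- The weights `![2, 2, 1, 1]` are the relative squared lengths of the simple roots. Nearly all
exclusions over F₄ consist in naming a word and computing its negative gap. -/
lemma wordGap_typeF_nonneg {e : Fin 4 ≃ I'}
    (he : ∀ i j, A' (e i) (e j) = CartanMatrix.F₄ i j) {a : Fin 4} {w : List (Fin 4)}
    (hw : Depth A' (e a) (vec (w.map e))) : 0 ≤ wordGap CartanMatrix.F₄ ![2, 2, 1, 1] a w :=
  wordGap_nonneg e he (by decide) (by decide) (by decide) hw

lemma IsLabeling.wordGap_typeF_nonneg (h : IsLabeling A A' f) (hα : IsLeaf A α) {e : Fin 4 ≃ I'}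
    (he : ∀ i j, A' (e i) (e j) = CartanMatrix.F₄ i j) {a : Fin 4} (ha : f α = e a) {l : List I}
    (hl : Depth A α (vec l)) (w : List (Fin 4)) (hw : l.map f = w.map e) :
    0 ≤ wordGap CartanMatrix.F₄ ![2, 2, 1, 1] a w :=
  RootHasse.wordGap_typeF_nonneg he (ha ▸ hw ▸ h.depth_map hα hl)

lemma isBondPath_typeF {e : Fin 4 ≃ I'} (he : ∀ i j, A' (e i) (e j) = CartanMatrix.F₄ i j) :
    IsBondPath A' (fun i => e (Fin.ofNat 4 i)) 4 1 := by
  refine ⟨⟨fun i hi j hj hij => ?_, fun i j hij hj => ?_, fun i hi => ?_⟩, fun x => ?_, by omega,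
    fun i hi hi1 => ?_⟩
  · have := congrArg Fin.val (e.injective hij)
    simp only [Fin.ofNat] at this
    omega
  · rw [he]
    have : i < 2 := by omega
    interval_cases i <;> interval_cases j <;> first | omega | rfl
  · rw [he]
    have : i < 3 := by omega
    interval_cases i <;> decide
  · exact ⟨e.symm x, by omega, by simp⟩
  · rw [he, he]
    have : i < 3 := by omega
    interval_cases i <;> first | omega | decide

/-- Type `E_6 → F_4`. -/
lemma IsLabeling.form_typeF (h : IsLabeling A A' f) (hα : IsLeaf A α) {e : Fin 4 ≃ I'}
    (he : ∀ i j, A' (e i) (e j) = CartanMatrix.F₄ i j) (ha : f α = e 3) :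
    IsIso A A' f ∨ Form A A' f CartanMatrix.E₆ CartanMatrix.F₄ ![3, 0, 2, 1, 2, 3] := by
  have hA := h.left
  have hA' := h.right
  have hb := (isBondPath_typeF he).reverse hA'
  refine (h.exists_fold hα hb ha.symm).imp_right ?_
  rintro ⟨p, p0, hp, lp, hp1, h3, h4, h5⟩
  have test := fun {l} => h.wordGap_typeF_nonneg hα he ha (l := l)
  have fne : ∀ {x y : I} {i j : Fin 4}, f x = e i → f y = e j → i ≠ j → x ≠ y :=
    fun hx hy hij hxy => hij (e.injective (by rw [← hx, ← hy, hxy]))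
  obtain ⟨u, hu⟩ : ∃ u, u = p 1 := ⟨_, rfl⟩
  obtain ⟨v, hv⟩ : ∃ v, v = p 2 := ⟨_, rfl⟩
  have lu : f u = e 2 := by rw [hu, lp 1 (by omega)]; rfl
  have lv : f v = e 1 := by rw [hv, lp 2 (by omega)]; rfl
  have uα : u ≠ α := fne lu ha (by decide)
  have vα : v ≠ α := fne lv ha (by decide)
  have vu : v ≠ u := fne lv lu (by decide)
  obtain ⟨hαu, huα⟩ : A α u = -1 ∧ A u α = -1 := by simpa [p0, hu] using hp1 0 (by omega)
  have hαv : A α v = 0 := by rw [← p0, hv]; exact hp.far 0 2 (by omega) (by omega)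
  have hvα := hA.zero _ _ hαv
  have huv' : A u v ≠ 0 := by rw [hu, hv]; exact hp.adj 1 (by omega)
  have hn1 := hA.le_neg_one vu.symm huv'
  have hn2 := hA.le_neg_one vu (hA.ne_zero_symm huv')
  obtain ⟨huv, hvu⟩ : A u v = -1 ∧ A v u = -1 := by
    have e1 : A' (e 2) (e 1) = -1 := he _ _
    have e2 : A' (e 1) (e 2) = -2 := he _ _
    change A' (e 2) (e 1) ≤ A (p 1) (p 2) at h3
    change A' (e 1) (e 2) ≤ A (p 2) (p 1) at h4
    change A' (e 2) (e 1) ≠ A (p 1) (p 2) ∨ A' (e 1) (e 2) ≠ A (p 2) (p 1) at h5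
    rw [e1, ← hu, ← hv] at h3
    rw [e2, ← hu, ← hv] at h4
    rw [e1, e2, ← hu, ← hv] at h5
    omega
  clear h3 h4 h5 hp1 hp lp hu hv
  have leafα : ∀ x, x ≠ α → x ≠ u → A α x = 0 := fun x hx hxu => by
    by_contra hne
    exact hxu (hα.eq hx uα hne (by omega))
  have w1 : Depth A α (vec [α]) := depth_singleton
  have w2 : Depth A α (vec [u, α]) :=
    hA.depth_cons w1 (z := α) (by simp) (by simp) (by simp [uα]) (by omega)
  have w3 : Depth A α (vec [v, u, α]) :=
    hA.depth_cons w2 (z := u) (by simp) (by simp) (by simp [vα, vu]) huv'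
  -- The length bound leaves only the label of `v` for a third neighbour of `u`; subtracting both is
  -- then too long.
  have nbru : ∀ x, x ≠ α → x ≠ u → x ≠ v → A u x = 0 := fun x hx hxu hxv => by
    by_contra hne
    obtain ⟨k, hk⟩ := e.surjective (f x)
    have t1 := test (hA.depth_cons w2 (z := u) (s := x) (by simp) (by simp) (by simp [hx, hxu]) hne)
      [k, 2, 3] (by simp [hk, lu, ha])
    have hk1 : k = 1 := by clear hk; revert t1; revert k; decide
    subst hk1
    have t2 := test (hA.depth_cons w3 (z := u) (s := x) (by simp) (by simp)
      (by simp [hx, hxu, hxv]) hne) [1, 1, 2, 3] (by simp [hk, lu, lv, ha])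
    revert t2; decide
  -- Lift a weight with two labels `e 2`. If it lived on `α, u, v` only, reflecting in `u` and then
  -- in `v` would give a negative coefficient.
  obtain ⟨t, tα, tu, tv, hvt', lt⟩ : ∃ t, t ≠ α ∧ t ≠ u ∧ t ≠ v ∧ A v t ≠ 0 ∧ f t = e 2 := by
    obtain ⟨d, hd, hpush⟩ := (h.depth_iff α hα (vec ([2, 1, 2, 3].map e))).1
      (ha ▸ IsWord.depth e.injective he (by decide))
    have hnn := hA.nonneg α d hd
    have c1 : push f d (e 1) = 1 := by rw [hpush]; simp [vec]
    have c2 : push f d (e 2) = 2 := by rw [hpush]; simp [vec]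
    have c3 : push f d (e 3) = 1 := by rw [hpush]; simp [vec]
    have c0 : push f d (e 0) = 0 := by rw [hpush]; simp [vec]
    by_cases hX : ∃ t, t ∉ ({α, u, v} : Set I) ∧ 0 < d t
    · obtain ⟨t₀, ht₀, hdt₀⟩ := hX
      obtain ⟨x, hx, t, ht, hdx, hdt, hxt⟩ := hA.exists_boundary (by simp) hd ht₀ hdt₀
      simp only [Set.mem_insert_iff, Set.mem_singleton_iff, not_or] at hx ht
      rcases hx with rfl | rfl | rfl
      · exact absurd (leafα t ht.1 ht.2.1) hxt
      · exact absurd (nbru t ht.1 ht.2.1 ht.2.2) hxt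
      · refine ⟨t, ht.1, ht.2.1, ht.2.2, hxt, ?_⟩
        have hdα := hd.pos hA hdx
        obtain ⟨k, hk⟩ := e.surjective (f t)
        have t1 := le_push (f := f) hnn t
        have t2 := fun hk' => sum_le_push (f := f) hnn {α, t} (j := e 3) (by simpa [ha] using hk')
        have t3 := fun hk' => sum_le_push (f := f) hnn {x, t} (j := e 1) (by simpa [lv] using hk')
        rw [Finset.sum_pair (Ne.symm ht.1)] at t2
        rw [Finset.sum_pair (Ne.symm ht.2.2)] at t3
        rw [← hk] at t1 t2 t3 ⊢
        fin_cases k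
        · have : d t ≤ 0 := c0 ▸ t1
          omega
        · have := t3 rfl
          omega
        · rfl
        · have := t2 rfl
          omega
    · exfalso
      push Not at hX
      have h0 : ∀ x, x ∉ ({α, u, v} : Finset I) → d x = 0 := fun x hx =>
        le_antisymm (hX x (by simpa using hx)) (hnn x)
      have hS : ∀ {x : I} {k : Fin 4}, x ∈ ({α, u, v} : Finset I) → f x = e k →
          (∀ y ∈ ({α, u, v} : Finset I), f y = e k → y = x) → push f d (e k) = d x := by
        intro x k _ hk hy
        rw [push_eq_sum {x} (by simpa using hk) fun i hi hik => ?_, Finset.sum_singleton]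
        by_contra hne
        exact hi (by simpa using hy i (by_contra fun hm => hne (h0 i hm)) hik)
      have d3 := hS (x := α) (by simp) ha (by simp [lu, lv])
      have d2 := hS (x := u) (by simp) lu (by simp [ha, lv])
      have d1 := hS (x := v) (by simp) lv (by simp [ha, lu])
      have s1 : wt A α d u = -2 := by
        rw [wt_eq_sum {α, u, v} h0, Finset.sum_insert (by simp [uα.symm, vα.symm]),
          Finset.sum_pair vu.symm, if_neg uα, hA.diag, hαu, hvu]
        omega
      have s2 := hA.le_add_wt (hd.reflect u) v
      have s3 : wt A α (d + Pi.single u (wt A α d u)) v = -2 := by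
        rw [wt_add_single, wt_eq_sum {α, u, v} h0,
          Finset.sum_insert (by simp [uα.symm, vα.symm]), Finset.sum_pair vu.symm, if_neg vα,
          hA.diag, hαv, huv, s1]
        omega
      rw [s3, Pi.add_apply, Pi.single_eq_of_ne vu] at s2
      omega
  obtain ⟨x, x0, hx, lx⟩ := h.exists_path_lift hα (k := 3) hb.toIsPath ha.symm
  have hx1 : x 1 = u := hα.eq (x0 ▸ hx.ne (by omega) (by omega) (by omega)) uα
    (x0 ▸ hx.adj 0 (by omega)) (by omega)
  have lx2 : f (x 2) = e 1 := lx 2 (by omega)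
  have hx2 : x 2 = v := by
    by_contra hne
    exact hx.adj 1 (by omega) (hx1 ▸ nbru (x 2) (fne lx2 ha (by decide)) (fne lx2 lu (by decide))
      hne)
  obtain ⟨z, hvz', lz⟩ : ∃ z, A v z ≠ 0 ∧ f z = e 0 :=
    ⟨x 3, hx2 ▸ hx.adj 2 (by omega), lx 3 (by omega)⟩
  clear hx lx lx2 x0 hx1 hx2
  have zα : z ≠ α := fne lz ha (by decide)
  have zu : z ≠ u := fne lz lu (by decide)
  have zv : z ≠ v := fne lz lv (by decide)
  have zt : z ≠ t := fne lz lt (by decide)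
  have w4 : Depth A α (vec [t, v, u, α]) :=
    hA.depth_cons w3 (z := v) (by simp) (by simp) (by simp [tα, tu, tv]) hvt'
  have cn : Conn A α [t, v, u, α] := (((Conn.base (A := A) (α := α)).cons (z := α) (by simp)
    (by simp [uα]) (by omega)).cons (z := u) (by simp) (by simp [vα, vu]) huv').cons (z := v)
      (by simp) (by simp [tα, tu, tv]) hvt'
  -- Leaves have leaves as images, and `e 2` is an inner node.
  have hleaf : ¬ IsLeaf A t := fun hl => by
    have := (h.leaf t hl)
    rw [lt] at this
    have := this.eq (s := e 1) (t := e 3) (by simp) (by simp) (by rw [he]; decide)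
      (by rw [he]; decide)
    simp at this
  obtain ⟨w, wt', wv, htw'⟩ := exists_ne_of_not_isLeaf hleaf (Ne.symm tv) (hA.ne_zero_symm hvt')
  have wα : w ≠ α := fun e => hA.ne_zero_symm htw' (e ▸ leafα t tα tu)
  have wu : w ≠ u := fun e => hA.ne_zero_symm htw' (e ▸ nbru t tα tu tv)
  have htz : A t z = 0 := by
    by_contra hne
    exact tv (cn.eq_of_adj hA (s := z) (by simp [zα, zu, zv, zt]) (by simp) (by simp) hne hvz')
  have hvw : A v w = 0 := by
    by_contra hne
    exact tv (cn.eq_of_adj hA (s := w) (by simp [wα, wu, wv, wt']) (by simp) (by simp) htw' hne)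
  have wz : w ≠ z := fun e => htw' (e ▸ htz)
  have w5 : Depth A α (vec [w, t, v, u, α]) :=
    hA.depth_cons w4 (z := t) (by simp) (by simp) (by simp [wα, wu, wv, wt']) htw'
  have cn5 : Conn A α [w, t, v, u, α] :=
    cn.cons (z := t) (by simp) (by simp [wα, wu, wv, wt']) htw'
  have hwz : A w z = 0 := by
    by_contra hne
    exact wv (cn5.eq_of_adj hA (s := z) (by simp [zα, zu, zv, zt, wz.symm]) (by simp) (by simp)
      hne hvz')
  have lw : f w = e 3 := by
    obtain ⟨k, hk⟩ := e.surjective (f w)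
    have t1 := test w5 [k, 2, 1, 2, 3] (by simp [hk, lt, lv, lu, ha])
    have t2 := test (hA.depth_cons w5 (z := v) (s := z) (by simp) (by simp)
      (by simp [zα, zu, zv, zt, wz.symm]) hvz') [0, k, 2, 1, 2, 3] (by simp [hk, lt, lv, lu, ha, lz])
    rw [← hk]
    congr 1
    clear hk
    revert t1 t2; revert k; decide
  have hαt := leafα t tα tu
  have hαw := leafα w wα wu
  have hαz := leafα z zα zu
  have hut := nbru t tα tu tv
  have huw := nbru w wα wu wv
  have huz := nbru z zα zu zv
  have htα := hA.zero _ _ hαt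
  have hwα := hA.zero _ _ hαw
  have hzα := hA.zero _ _ hαz
  have htu := hA.zero _ _ hut
  have hwu := hA.zero _ _ huw
  have hzu := hA.zero _ _ huz
  have hzt := hA.zero _ _ htz
  have hwv := hA.zero _ _ hvw
  have hzw := hA.zero _ _ hwz
  -- From here on, an entry below `-1` would allow one more subtraction of a node already used, and
  -- the image of that word is too long.
  have hvt : A v t = -1 := by
    refine le_antisymm (hA.le_neg_one (Ne.symm tv) hvt') (not_lt.1 fun hlt => ?_)
    have := test (w3.replicate t 2 (by simp [tα, hαt, hut]; omega)) [2, 2, 1, 2, 3]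
      (by simp [lt, lv, lu, ha])
    revert this; decide
  have htv : A t v = -1 := by
    refine le_antisymm (hA.le_neg_one tv (hA.ne_zero_symm hvt')) (not_lt.1 fun hlt => ?_)
    have := test (w4.cons v (by simp [vα, hαv, huv, hA.diag]; omega)) [1, 2, 1, 2, 3]
      (by simp [lt, lv, lu, ha])
    revert this; decide
  have htw : A t w = -1 := by
    refine le_antisymm (hA.le_neg_one (Ne.symm wt') htw') (not_lt.1 fun hlt => ?_)
    have := test (w4.replicate w 2 (by simp [wα, hαw, huw, hvw]; omega)) [3, 3, 2, 1, 2, 3]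
      (by simp [lt, lv, lu, ha, lw])
    revert this; decide
  have hwt : A w t = -1 := by
    refine le_antisymm (hA.le_neg_one wt' (hA.ne_zero_symm htw')) (not_lt.1 fun hlt => ?_)
    have := test (w5.cons t (by simp [tα, hαt, hut, hvt, hA.diag]; omega)) [2, 3, 2, 1, 2, 3]
      (by simp [lt, lv, lu, ha, lw])
    revert this; decide
  have hvz : A v z = -1 := by
    refine le_antisymm (hA.le_neg_one (Ne.symm zv) hvz') (not_lt.1 fun hlt => ?_)
    have := test (w3.replicate z 2 (by simp [zα, hαz, huz]; omega)) [0, 0, 1, 2, 3]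
      (by simp [lz, lv, lu, ha])
    revert this; decide
  have w6 : Depth A α (vec [z, v, u, α]) :=
    hA.depth_cons w3 (z := v) (by simp) (by simp) (by simp [zα, zu, zv]) hvz'
  have hzv : A z v = -1 := by
    refine le_antisymm (hA.le_neg_one zv (hA.ne_zero_symm hvz')) (not_lt.1 fun hlt => ?_)
    have := test (w6.cons v (by simp [vα, hαv, huv, hA.diag]; omega)) [1, 0, 1, 2, 3]
      (by simp [lz, lv, lu, ha])
    revert this; decide
  have hq : Function.Injective ![α, z, u, v, t, w] := fun i j => by
    fin_cases i <;> fin_cases j <;>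
      simp [uα, uα.symm, vα, vα.symm, vu, vu.symm, tα, tα.symm, tu, tu.symm, tv, tv.symm, zα,
        zα.symm, zu, zu.symm, zv, zv.symm, zt, zt.symm, wα, wα.symm, wu, wu.symm, wv, wv.symm,
        wt', wt'.symm, wz, wz.symm]
  have hB : ∀ i j, A (![α, z, u, v, t, w] i) (![α, z, u, v, t, w] j) = CartanMatrix.E₆ i j :=
    fun i j => by
      fin_cases i <;> fin_cases j <;> simp [CartanMatrix.E₆, hA.diag, *]
  -- Sixteen steps reach the lowest weight of the 27-dimensional representation of E₆. The image
  -- cannot be lowered any further in F₄, by the length bound for each of the four labels.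
  refine h.form_of_word hα hq hB (a := 0) rfl
    (l := [5, 4, 3, 2, 1, 3, 4, 5, 0, 2, 3, 4, 1, 3, 2, 0])
    (IsWord.depth hq hB (by decide)) (by decide) (fun y hy => ?_) e he
    (fun i => by fin_cases i <;> simp) (fun i => by fin_cases i <;> simp [*])
  obtain ⟨k, rfl⟩ := e.surjective y
  rw [ha] at hy
  have := RootHasse.wordGap_typeF_nonneg he (a := 3)
    (w := k :: [3, 2, 1, 2, 0, 1, 2, 3, 3, 2, 1, 2, 0, 1, 2, 3]) (by simpa [*] using hy)
  clear hy
  revert this; revert k; decide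

/-- In type `F_4`, if some leaf is over the long end, either `f` is an isomorphism or another leaf
is over the short end. -/
lemma IsLabeling.exists_leaf_typeF (h : IsLabeling A A' f) (hα : IsLeaf A α) {e : Fin 4 ≃ I'}
    (he : ∀ i j, A' (e i) (e j) = CartanMatrix.F₄ i j) (ha : f α = e 0) :
    IsIso A A' f ∨ ∃ α', IsLeaf A α' ∧ f α' = e 3 := by
  have hA := h.left
  have hb := isBondPath_typeF he
  refine (h.exists_fold hα hb ha.symm).imp_right ?_
  rintro ⟨p, p0, hp, lp, hp1, h3, h4, h5⟩
  have test := fun {l} => h.wordGap_typeF_nonneg hα he ha (l := l)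
  have fne : ∀ {x y : I} {i j : Fin 4}, f x = e i → f y = e j → i ≠ j → x ≠ y :=
    fun hx hy hij hxy => hij (e.injective (by rw [← hx, ← hy, hxy]))
  obtain ⟨u, hu⟩ : ∃ u, u = p 1 := ⟨_, rfl⟩
  obtain ⟨v, hv⟩ : ∃ v, v = p 2 := ⟨_, rfl⟩
  have lu : f u = e 1 := by rw [hu, lp 1 (by omega)]; rfl
  have lv : f v = e 2 := by rw [hv, lp 2 (by omega)]; rfl
  have uα : u ≠ α := fne lu ha (by decide)
  have vα : v ≠ α := fne lv ha (by decide)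
  have vu : v ≠ u := fne lv lu (by decide)
  obtain ⟨hαu, huα⟩ : A α u = -1 ∧ A u α = -1 := by simpa [p0, hu] using hp1 0 (by omega)
  have hαv : A α v = 0 := by rw [← p0, hv]; exact hp.far 0 2 (by omega) (by omega)
  have huv' : A u v ≠ 0 := by rw [hu, hv]; exact hp.adj 1 (by omega)
  have hn1 := hA.le_neg_one vu.symm huv'
  have hn2 := hA.le_neg_one vu (hA.ne_zero_symm huv')
  obtain ⟨huv, hvu⟩ : A u v = -1 ∧ A v u = -1 := by
    have e1 : A' (e 1) (e 2) = -2 := he _ _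
    have e2 : A' (e 2) (e 1) = -1 := he _ _
    change A' (e 1) (e 2) ≤ A (p 1) (p 2) at h3
    change A' (e 2) (e 1) ≤ A (p 2) (p 1) at h4
    change A' (e 1) (e 2) ≠ A (p 1) (p 2) ∨ A' (e 2) (e 1) ≠ A (p 2) (p 1) at h5
    rw [e1, ← hu, ← hv] at h3
    rw [e2, ← hu, ← hv] at h4
    rw [e1, e2, ← hu, ← hv] at h5
    omega
  clear h3 h4 h5 hp1 hp lp hu hv
  obtain ⟨x, x0, hx, lx⟩ := h.exists_path_lift hα (k := 3) hb.toIsPath ha.symm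
  have hx1 : x 1 = u := hα.eq (x0 ▸ hx.ne (by omega) (by omega) (by omega)) uα
    (x0 ▸ hx.adj 0 (by omega)) (by omega)
  obtain ⟨r, hr⟩ : ∃ r, r = x 2 := ⟨_, rfl⟩
  obtain ⟨s, hs⟩ : ∃ s, s = x 3 := ⟨_, rfl⟩
  have lr : f r = e 2 := hr ▸ lx 2 (by omega)
  have ls : f s = e 3 := hs ▸ lx 3 (by omega)
  have hur : A u r ≠ 0 := by rw [hr, ← hx1]; exact hx.adj 1 (by omega)
  have hrs : A r s ≠ 0 := by rw [hr, hs]; exact hx.adj 2 (by omega)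
  have hus : A s u = 0 := by rw [hs, ← hx1]; exact hx.far' hA (by omega) (by omega)
  have hsα : A s α = 0 := by rw [hs, ← x0]; exact hx.far' hA (by omega) (by omega)
  have hαr : A α r = 0 := by rw [hr, ← x0]; exact hx.far 0 2 (by omega) (by omega)
  clear hx lx x0 hx1
  have rα : r ≠ α := fne lr ha (by decide)
  have ru : r ≠ u := fne lr lu (by decide)
  have sα : s ≠ α := fne ls ha (by decide)
  have su : s ≠ u := fne ls lu (by decide)
  have sr : s ≠ r := fne ls lr (by decide)
  refine ⟨s, ?_, ls⟩
  -- A further neighbour `y` of `s` must have the label `e 2`. This forbids a second neighbour of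
  -- `u` with that label, so the fold and the lifted path share the node `v`.
  by_contra hleaf
  obtain ⟨y, ys, yr, hsy⟩ := exists_ne_of_not_isLeaf hleaf sr.symm (hA.ne_zero_symm hrs)
  have yα : y ≠ α := fun e => hsy (e ▸ hsα)
  have yu : y ≠ u := fun e => hsy (e ▸ hus)
  have cn : Conn A α [s, r, u, α] := (((Conn.base (A := A) (α := α)).cons (z := α) (by simp)
    (by simp [uα]) (by omega)).cons (z := u) (by simp) (by simp [rα, ru]) hur).cons (z := r)
      (by simp) (by simp [sα, su, sr]) hrs
  have w4 := cn.depth hA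
  have w5 : Depth A α (vec [y, s, r, u, α]) :=
    hA.depth_cons w4 (z := s) (by simp) (by simp) (by simp [yα, yu, yr, ys]) hsy
  have ly : f y = e 2 := by
    obtain ⟨k, hk⟩ := e.surjective (f y)
    have t1 := test w5 [k, 3, 2, 1, 0] (by simp [hk, ls, lr, lu, ha])
    rw [← hk]
    congr 1
    clear hk
    revert t1; revert k; decide
  have key : ∀ t, f t = e 2 → t ≠ r → A u t = 0 := fun t lt tr => by
    by_contra hne
    have ty : t ≠ y := by
      rintro rfl
      exact su (cn.eq_of_adj hA (s := t) (by simp [yα, yu, yr, ys]) (by simp) (by simp) hsy hne)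
    have := test (hA.depth_cons w5 (z := u) (s := t) (by simp) (by simp)
      (by simp [ty, tr, fne lt ls (by decide), fne lt lu (by decide), fne lt ha (by decide)]) hne)
      [2, 2, 3, 2, 1, 0] (by simp [lt, ly, ls, lr, lu, ha])
    revert this; decide
  have hvr : v = r := by
    by_contra hne
    exact huv' (key v lv hne)
  subst hvr
  -- The double edge of F₄ allows `e 2` twice after `e 0, e 1`, while the edge from `u` to `v` is
  -- simple. The second `e 2` sits on another node, which can only be attached to `v`; a fork at `v`
  -- with labels `e 2` and `e 3` is then refuted by length.
  obtain ⟨t, tv, hvt, lt⟩ : ∃ t, t ≠ v ∧ A v t ≠ 0 ∧ f t = e 2 := by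
    obtain ⟨d, hd, hpush⟩ := (h.depth_iff α hα (vec ([2, 2, 1, 0].map e))).1
      (ha ▸ (IsWord.depth e.injective he (l := [1, 0]) (by decide)).replicate (e 2) 2
        (by simp [he, CartanMatrix.F₄]))
    have hnn := hA.nonneg α d hd
    have c1 : push f d (e 1) = 1 := by rw [hpush]; simp [vec]
    have c2 : push f d (e 2) = 2 := by rw [hpush]; simp [vec]
    have c3 : push f d (e 3) = 0 := by rw [hpush]; simp [vec]
    have c0 : push f d (e 0) = 1 := by rw [hpush]; simp [vec]
    by_cases hX : ∃ t, t ∉ ({α, u, v} : Set I) ∧ 0 < d t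
    · obtain ⟨t₀, ht₀, hdt₀⟩ := hX
      obtain ⟨x, hx, t, ht, hdx, hdt, hxt⟩ := hA.exists_boundary (by simp) hd ht₀ hdt₀
      simp only [Set.mem_insert_iff, Set.mem_singleton_iff, not_or] at hx ht
      have hdα := hd.pos hA hdx
      obtain ⟨x', hx', y', hy', -, hdy, hxy⟩ := hA.exists_boundary (X := {α}) rfl hd
        (t₀ := t) ht.1 hdt
      rw [Set.mem_singleton_iff] at hx' hy'
      subst hx'
      have hyu : y' = u := hα.eq hy' uα hxy (by omega)
      subst hyu
      have lt : f t = e 2 := by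
        obtain ⟨k, hk⟩ := e.surjective (f t)
        have t1 := le_push (f := f) hnn t
        have t2 := fun hk' => sum_le_push (f := f) hnn {x', t} (j := e 0) (by simpa [ha] using hk')
        have t3 := fun hk' => sum_le_push (f := f) hnn {y', t} (j := e 1) (by simpa [lu] using hk')
        rw [Finset.sum_pair (Ne.symm ht.1)] at t2
        rw [Finset.sum_pair (Ne.symm ht.2.1)] at t3
        rw [← hk] at t1 t2 t3 ⊢
        fin_cases k
        · have := t2 rfl
          omega
        · have := t3 rfl
          omega
        · rfl
        · have : d t ≤ 0 := c3 ▸ t1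
          omega
      refine ⟨t, ht.2.2, ?_, lt⟩
      rcases hx with rfl | rfl | rfl
      · exact absurd (hα.eq ht.1 uα hxt (by omega)) ht.2.1
      · exact absurd (key t lt ht.2.2) hxt
      · exact hxt
    · exfalso
      push Not at hX
      have h0 : ∀ x, x ∉ ({α, u, v} : Finset I) → d x = 0 := fun x hx =>
        le_antisymm (hX x (by simpa using hx)) (hnn x)
      have hS : ∀ {x : I} {k : Fin 4}, x ∈ ({α, u, v} : Finset I) → f x = e k →
          (∀ y ∈ ({α, u, v} : Finset I), f y = e k → y = x) → push f d (e k) = d x := by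
        intro x k _ hk hy
        rw [push_eq_sum {x} (by simpa using hk) fun i hi hik => ?_, Finset.sum_singleton]
        by_contra hne
        exact hi (by simpa using hy i (by_contra fun hm => hne (h0 i hm)) hik)
      have d1 := hS (x := u) (by simp) lu (by simp [ha, lv])
      have d2 := hS (x := v) (by simp) lv (by simp [ha, lu])
      have s1 := hA.le_add_wt hd v
      rw [wt_eq_sum {α, u, v} h0, Finset.sum_insert (by simp [uα.symm, vα.symm]),
          Finset.sum_pair vu.symm, if_neg vα, hA.diag, hαv, huv] at s1
      omega
  have tu := fne lt lu (by decide)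
  have tα := fne lt ha (by decide)
  have ts := fne lt ls (by decide)
  have hn3 := hA.le_neg_one sr (hA.ne_zero_symm hrs)
  have hn4 := hA.le_neg_one tv (hA.ne_zero_symm hvt)
  have w1 : Depth A α (vec [α]) := depth_singleton
  have w2 : Depth A α (vec [u, α]) :=
    hA.depth_cons w1 (z := α) (by simp) (by simp) (by simp [uα]) (by omega)
  have w3 : Depth A α (vec [v, u, α]) :=
    hA.depth_cons w2 (z := u) (by simp) (by simp) (by simp [vα, vu]) huv'
  have w4' : Depth A α (vec [t, v, u, α]) :=
    hA.depth_cons w3 (z := v) (by simp) (by simp) (by simp [tα, tu, tv]) hvt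
  have w5' : Depth A α (vec [s, t, v, u, α]) :=
    hA.depth_cons w4' (z := v) (by simp) (by simp) (by simp [sα, su, sr, ts.symm]) hrs
  have := test (w5'.cons v (by simp [vα, hαv, huv, hA.diag]; omega)) [2, 3, 2, 2, 1, 0]
    (by simp [lt, ls, lv, lu, ha])
  revert this; decide

end TypeF

/-! ### Assembly of the cases. -/

section Classification

variable {I I' : Type*} [Fintype I] [DecidableEq I] [Fintype I'] [DecidableEq I']
  {A : Matrix I I ℤ} {A' : Matrix I' I' ℤ} {α : I} {f : I → I'}

/-- The table of exceptional labelings. -/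
def IsTabulated (A : Matrix I I ℤ) (A' : Matrix I' I' ℤ) (f : I → I') : Prop :=
  (∃ m, Form A A' f (CartanMatrix.A (2 * (m + 2))) (CartanMatrix.B (m + 2))
    (fun i => min (i : ℕ) (2 * (m + 2) - 1 - i))) ∨
  Form A A' f (CartanMatrix.A 6) CartanMatrix.G₂ ![1, 0, 1, 1, 0, 1] ∨
  (∃ m, Form A A' f (CartanMatrix.A (2 * (m + 2) - 1)) (CartanMatrix.C (m + 2))
    (fun i => min (i : ℕ) (2 * (m + 2) - 2 - i))) ∨
  Form A A' f (CartanMatrix.B 3) CartanMatrix.G₂ ![1, 0, 1] ∨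
  (∃ m, Form A A' f (CartanMatrix.D (m + 3)) (CartanMatrix.B (m + 2))
    (fun i => min (i : ℕ) (m + 1))) ∨
  Form A A' f (CartanMatrix.D 4) CartanMatrix.G₂ ![1, 0, 1, 1] ∨
  Form A A' f CartanMatrix.E₆ CartanMatrix.F₄ ![3, 0, 2, 1, 2, 3]

lemma IsLabeling.tabulated_typeB (h : IsLabeling A A' f) (hα : IsLeaf A α) {b : ℕ → I'} {m : ℕ}
    (hb : IsBondPath A' b (m + 2) m) (h0 : b 0 = f α) (h1 : A' (b m) (b (m + 1)) = -2)
    (h2 : A' (b (m + 1)) (b m) = -1) : IsIso A A' f ∨ IsTabulated A A' f :=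
  (h.form_typeB hα hb h0 h1 h2).imp_right fun h => h.elim (fun h => .inl ⟨m, h⟩)
    fun h => .inr (.inr (.inr (.inr (.inl ⟨m, h.2⟩))))

lemma IsBondPath.typeF_entry (hA : IsFiniteCartan A) {b : ℕ → I} (hb : IsBondPath A b 4 1)
    (h1 : A (b 1) (b 2) = -2) (h2 : A (b 2) (b 1) = -1) (i j : Fin 4) :
    A (hb.equiv hb.cover i) (hb.equiv hb.cover j) = CartanMatrix.F₄ i j := by
  rw [IsPath.equiv_apply, IsPath.equiv_apply, hb.entry hA h1 h2 i.2 j.2]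
  fin_cases i <;> fin_cases j <;> rfl

lemma IsLabeling.tabulated_typeF (h : IsLabeling A A' f) (hα : IsLeaf A α) {e : Fin 4 ≃ I'}
    (he : ∀ i j, A' (e i) (e j) = CartanMatrix.F₄ i j) (ha : f α = e 3) :
    IsIso A A' f ∨ IsTabulated A A' f :=
  (h.form_typeF hα he ha).imp_right fun h => .inr (.inr (.inr (.inr (.inr (.inr h)))))

/-- The classification of labelings, in terms of Cartan matrices. -/
theorem IsLabeling.isIso_or_tabulated (h : IsLabeling A A' f) (hcard : 2 ≤ Fintype.card I) :
    IsIso A A' f ∨ IsTabulated A A' f := by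
  have hA' := h.right
  obtain ⟨α, hα⟩ := h.left.exists_extremal hcard
  by_cases hsl : ∀ i j, -1 ≤ A' i j
  · exact .inl (isIso_of_simplyLaced h.left hA' (h.depth_iff α hα) hsl)
  push Not at hsl
  obtain ⟨u, v, huv⟩ := hsl
  obtain ⟨b, m, j, h0, hb, hcov, hlt, hsim, hcase⟩ := hA'.exists_path_of_multiple (α := f α)
    (fun s t hs ht hs' ht' => (h.leaf α hα).eq hs ht hs' ht') (u := u) (v := v)
    (by rintro rfl; have := hA'.diag u; omega) (by omega)
  have hb : IsBondPath A' b m j := ⟨hb, hcov, hlt, hsim⟩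
  rcases hcase with ⟨rfl, rfl, h1⟩ | ⟨hj, h1⟩
  · have hcov' : ∀ x, x = b 0 ∨ x = b 1 := fun x => by
      obtain ⟨i, hi, rfl⟩ := hcov x
      interval_cases i <;> simp
    have hne : b 0 ≠ b 1 := hb.ne (by omega) (by omega) (by omega)
    rcases h1 with ⟨h1, h2⟩ | ⟨h1, h2⟩
    · exact .inl (h.isIso_typeG hα ⟨hne.symm, fun x => (hcov' x).symm, h2, h1⟩ h0.symm)
    · refine (h.form_typeG hα ⟨hne, hcov', h1, h2⟩ h0.symm).imp_right ?_
      rintro (h | h | h)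
      · exact .inr (.inl h)
      · exact .inr (.inr (.inr (.inl h)))
      · exact .inr (.inr (.inr (.inr (.inr (.inl h)))))
  -- Deciding first whether the double edge is the last one also settles rank two, where it is both
  -- the first and the last.
  · by_cases hend : j + 2 = m
    · subst hend
      rcases h1 with ⟨h1, h2⟩ | ⟨h1, h2⟩
      · exact h.tabulated_typeB hα hb h0 h1 h2
      · exact (h.form_typeC hα hb h0 h1 h2).imp_right fun h => .inr (.inr (.inl ⟨j, h⟩))
    rcases hj with rfl | hj | ⟨rfl, rfl⟩
    · rcases h1 with ⟨h1, h2⟩ | ⟨h1, h2⟩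
      · exact .inl (h.isIso_typeC hα hb (by omega) h0 h1 h2)
      -- Here `α` lies over the spin node, whose weights need not form a chain. Another leaf lies
      -- over the long end; the path is reversed to start there.
      · rcases h.exists_leaf_typeB hα hb (by omega) h0 h1 h2 with h3 | ⟨α', hα', h3⟩
        · exact .inl h3
        · obtain ⟨k, rfl⟩ : ∃ k, m = k + 2 := ⟨m - 2, by omega⟩
          have hr := hb.reverse hA'
          simp only [Nat.add_sub_cancel, Nat.sub_zero] at hr
          refine h.tabulated_typeB hα' hr h3.symm ?_ ?_
          · rw [show k + 2 - 1 - k = 1 by omega, show k + 2 - 1 - (k + 1) = 0 by omega, h2]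
          · rw [show k + 2 - 1 - k = 1 by omega, show k + 2 - 1 - (k + 1) = 0 by omega, h1]
    · exact absurd hj hend
    · rcases h1 with ⟨h1, h2⟩ | ⟨h1, h2⟩
      · rcases h.exists_leaf_typeF hα (hb.typeF_entry hA' h1 h2) h0.symm with h3 | ⟨α', hα', h3⟩
        · exact .inl h3
        · exact h.tabulated_typeF hα' (hb.typeF_entry hA' h1 h2) h3
      · exact h.tabulated_typeF hα ((hb.reverse hA').typeF_entry hA' h2 h1) h0.symm

end Classification

/-! ### From root systems to Cartan matrices. -/

section Bridge

open Module

variable {ι M N : Type*} [Finite ι] [DecidableEq ι] [AddCommGroup M] [Module ℝ M]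
  [AddCommGroup N] [Module ℝ N] {P : RootPairing ι ℝ M N} [P.IsRootSystem] [P.IsCrystallographic]

/-- The weight `ϖ_α - ∑ d_k σ_k`. -/
noncomputable def weightAt (b : P.Base) (α : b.support) (d : b.support → ℤ) : M :=
  fundWeight b α - ∑ k, (d k : ℝ) • P.root k

variable {b : P.Base} {α : b.support}

lemma weightAt_zero : weightAt b α 0 = fundWeight b α := by simp [weightAt]

lemma weightAt_add (d e : b.support → ℤ) :
    weightAt b α (d + e) = weightAt b α d - ∑ k, (e k : ℝ) • P.root k := by
  simp only [weightAt, Pi.add_apply, Int.cast_add, add_smul, Finset.sum_add_distrib]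
  abel

lemma sum_single_smul_root (i : b.support) (k : ℤ) :
    ∑ t, ((Pi.single i k : b.support → ℤ) t : ℝ) • P.root t = (k : ℝ) • P.root i := by
  rw [Finset.sum_eq_single i (fun t _ ht => by simp [ht]) (by simp), Pi.single_eq_same]

lemma weightAt_add_single (d : b.support → ℤ) (i : b.support) (k : ℤ) :
    weightAt b α (d + Pi.single i k) = weightAt b α d - (k : ℝ) • P.root i := by
  rw [weightAt_add, sum_single_smul_root]

lemma cast_cartanMatrix (i j : b.support) : (b.cartanMatrix i j : ℝ) = P.pairing i j := by
  simpa using b.algebraMap_cartanMatrixIn_apply ℤ i j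

lemma weightAt_coroot (d : b.support → ℤ) (i : b.support) :
    P.toLinearMap (weightAt b α d) (P.coroot i) = (wt b.cartanMatrix α d i : ℝ) := by
  simp only [weightAt, map_sub, map_sum, map_smul, LinearMap.sub_apply, LinearMap.sum_apply,
    LinearMap.smul_apply, fundWeight_coroot, RootPairing.root_coroot_eq_pairing, smul_eq_mul, wt]
  push_cast
  simp only [cast_cartanMatrix, eq_comm]

lemma repr_sub_weightAt (d : b.support → ℤ) (i : b.support) :
    b.toWeightBasis.repr (fundWeight b α - weightAt b α d) i = d i := by
  simp only [weightAt, sub_sub_cancel, ← b.toWeightBasis_apply]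
  rw [b.toWeightBasis.repr_sum_self]

lemma weightAt_injective : Function.Injective (weightAt b α) := fun d e h => by
  ext i
  have h1 := repr_sub_weightAt (α := α) d i
  rw [h, repr_sub_weightAt] at h1
  exact_mod_cast h1.symm

lemma mem_uIcc_cast {k n : ℤ} : (k : ℝ) ∈ Set.uIcc 0 (n : ℝ) ↔ k ∈ Set.uIcc 0 n := by
  rw [Set.mem_uIcc, Set.mem_uIcc]
  norm_cast

/-- A convex set that is stable under the simple reflections contains, along with `ϖ_α`, all weights
that can be reached from it. -/
lemma Depth.weightAt_mem {S : Set M} (hS : Convex ℝ S)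
    (hrefl : ∀ (i : b.support), ∀ x ∈ S, P.reflection i x ∈ S) (h0 : fundWeight b α ∈ S)
    {d : b.support → ℤ} (hd : Depth b.cartanMatrix α d) : weightAt b α d ∈ S := by
  induction hd with
  | zero => rwa [weightAt_zero]
  | @step d i k _ hk ih =>
    rw [weightAt_add_single]
    rw [← mem_uIcc_cast, ← weightAt_coroot, ← segment_eq_uIcc] at hk
    obtain ⟨s, t, hs, ht, hst, hk⟩ := hk
    have := hS ih (hrefl i _ ih) hs ht hst
    rw [RootPairing.reflection_apply] at this
    convert this using 1
    rw [← hk, smul_zero, zero_add, smul_sub, ← add_sub_assoc, ← add_smul, hst, one_smul, smul_smul,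
      smul_eq_mul]
    rfl

/-- The action of a word in the simple reflections. -/
noncomputable def wordAct (b : P.Base) : List b.support → M → M
  | [], x => x
  | i :: l, x => P.reflection i (wordAct b l x)

lemma wordAct_combo (l : List b.support) (s t : ℝ) (x y : M) :
    wordAct b l (s • x + t • y) = s • wordAct b l x + t • wordAct b l y := by
  induction l with
  | nil => rfl
  | cons i l ih => simp [wordAct, ih]

lemma wordAct_append (l : List b.support) (i : b.support) (x : M) :
    wordAct b (l ++ [i]) x = wordAct b l (P.reflection i x) := by
  induction l with
  | nil => rfl
  | cons j l ih => simp [wordAct, ih]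

lemma toLinearMap_reflection (i : ι) (x : M) (y : N) :
    P.toLinearMap (P.reflection i x) y = P.toLinearMap x (P.coreflection i y) := by
  simp [RootPairing.reflection_apply, RootPairing.coreflection_apply, mul_comm]

lemma fundWeight_coroot_nonneg {γ : ι} (hγ : b.flip.IsPos γ) :
    0 ≤ P.toLinearMap (fundWeight b α) (P.coroot γ) := by
  obtain ⟨g, -, hg, hγg⟩ := b.flip.exists_root_eq_sum_int γ
  have hnn : ∀ i, 0 ≤ g i := by
    rcases hg with hg | hg
    · exact hg.le
    · rw [RootPairing.Base.isPos_iff, RootPairing.Base.height_eq_sum hγg] at hγ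
      exact absurd hγ (not_lt.2 (Finset.sum_nonpos fun i _ => hg.le i))
  change P.coroot γ = ∑ j ∈ b.support, g j • P.coroot j at hγg
  rw [hγg, map_sum]
  refine Finset.sum_nonneg fun j hj => ?_
  rw [map_zsmul, fundWeight_coroot b α ⟨j, hj⟩]
  refine zsmul_nonneg ?_ (hnn j)
  split_ifs <;> norm_num

variable [P.IsReduced]

/-- The exchange condition, for the orbit of a fundamental weight. -/
lemma wordAct_exchange (l : List b.support) {γ : ι} (hγ : b.flip.IsPos γ) :
    0 ≤ P.toLinearMap (wordAct b l (fundWeight b α)) (P.coroot γ) ∨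
      ∃ l', l'.length < l.length ∧
        P.reflection γ (wordAct b l (fundWeight b α)) = wordAct b l' (fundWeight b α) := by
  induction l generalizing γ with
  | nil => exact .inl (fundWeight_coroot_nonneg hγ)
  | cons i l ih =>
    by_cases hi : γ = i
    · refine .inr ⟨l, by simp, ?_⟩
      rw [hi, wordAct, RootPairing.reflection_same]
    -- A simple reflection permutes the positive coroots other than its own.
    · have hγ' : b.flip.IsPos (P.reflectionPerm i γ) :=
        RootPairing.Base.IsPos.reflectionPerm (P := P.flip) (b := b.flip) hγ i.2 hi
      refine (ih hγ').imp (fun h => ?_) ?_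
      · rwa [wordAct, toLinearMap_reflection, ← RootPairing.coroot_reflectionPerm]
      · rintro ⟨l', hl', h⟩
        refine ⟨i :: l', by simpa using hl', ?_⟩
        rw [wordAct, wordAct, ← h, RootPairing.reflection_reflectionPerm]
        simp

/-- By induction on the length of the word, its first reflection either subtracts a nonnegative
multiple of a simple root or, by exchange, gives the same vector as a shorter word. -/
lemma repr_sub_wordAct_nonneg (l : List b.support) (i : b.support) :
    0 ≤ b.toWeightBasis.repr (fundWeight b α - wordAct b l (fundWeight b α)) i := by
  obtain ⟨n, hn⟩ : ∃ n, n = l.length := ⟨_, rfl⟩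
  induction n using Nat.strong_induction_on generalizing l with
  | _ n ih =>
    rcases l with _ | ⟨j, l⟩
    · simp [wordAct]
    · rcases wordAct_exchange (α := α) l (γ := j)
        (RootPairing.Base.isPos_of_mem_support (b := b.flip) j.2) with h | ⟨l', hl', h⟩
      · have h1 := ih l.length (by simp [hn]) l rfl
        rw [wordAct, RootPairing.reflection_apply, ← sub_add, map_add, map_smul,
          b.toWeightBasis_repr_root, Finsupp.add_apply, Finsupp.smul_apply]
        refine add_nonneg h1 (mul_nonneg h ?_)
        rw [Finsupp.single_apply]
        split_ifs <;> norm_num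
      · rw [wordAct, h]
        exact ih l'.length (by simp only [List.length_cons] at hn; omega) l' rfl

/-- The vectors whose translates by all words lie below `ϖ_α` form a convex set stable under simple
reflections; it contains `ϖ_α`, hence every weight that can be reached. -/
lemma Depth.cartanMatrix_nonneg {d : b.support → ℤ} (hd : Depth b.cartanMatrix α d)
    (i : b.support) : 0 ≤ d i := by
  have := hd.weightAt_mem (S := {x | ∀ (l : List b.support) (i : b.support),
    0 ≤ b.toWeightBasis.repr (fundWeight b α - wordAct b l x) i}) ?_ ?_ ?_ [] i
  · rw [wordAct, repr_sub_weightAt] at this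
    exact_mod_cast this
  · intro x hx y hy s t hs ht hst l i
    have : fundWeight b α - wordAct b l (s • x + t • y) =
        s • (fundWeight b α - wordAct b l x) + t • (fundWeight b α - wordAct b l y) := by
      rw [wordAct_combo, smul_sub, smul_sub]
      nth_rw 1 [← one_smul ℝ (fundWeight b α), ← hst, add_smul]
      abel
    rw [this, map_add, map_smul, map_smul]
    exact add_nonneg (mul_nonneg hs (hx l i)) (mul_nonneg ht (hy l i))
  · intro i x hx l
    rw [← wordAct_append]
    exact hx _
  · exact fun l => repr_sub_wordAct_nonneg l

-- A bound for the pairings of `ϖ_α` with all coroots defines a convex set stable under reflections,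
-- so it holds for all reachable weights. The integral pairings thus lie in a finite box, and they
-- determine `d` since the Cartan matrix is nondegenerate.
omit [P.IsReduced] in
lemma finite_depth_cartanMatrix : {d | Depth b.cartanMatrix α d}.Finite := by
  have := Fintype.ofFinite ι
  obtain ⟨C, hC⟩ : ∃ C, ∀ γ, |P.toLinearMap (fundWeight b α) (P.coroot γ)| ≤ C :=
    ⟨∑ γ, |P.toLinearMap (fundWeight b α) (P.coroot γ)|, fun γ =>
      Finset.single_le_sum (f := fun γ => |P.toLinearMap (fundWeight b α) (P.coroot γ)|)
        (fun _ _ => abs_nonneg _) (Finset.mem_univ γ)⟩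
  refine Set.Finite.of_finite_image (f := fun d i => wt b.cartanMatrix α d i)
    ((Set.finite_Icc (fun _ => -⌈C⌉) (fun _ => ⌈C⌉)).subset ?_) fun d _ e _ hde => ?_
  · rintro _ ⟨d, hd, rfl⟩
    have h1 := hd.weightAt_mem (S := {x | ∀ γ, |P.toLinearMap x (P.coroot γ)| ≤ C}) ?_ ?_ hC
    · have h2 : ∀ i, |wt b.cartanMatrix α d i| ≤ ⌈C⌉ := fun i => by
        have := (h1 i).trans (Int.le_ceil C)
        rw [weightAt_coroot] at this
        exact_mod_cast this
      exact ⟨fun i => (abs_le.1 (h2 i)).1, fun i => (abs_le.1 (h2 i)).2⟩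
    · intro x hx y hy s t hs ht hst γ
      simp only [map_add, map_smul, LinearMap.add_apply, LinearMap.smul_apply, smul_eq_mul]
      calc _ ≤ s * C + t * C := (abs_add_le _ _).trans (add_le_add
            (by rw [abs_mul, abs_of_nonneg hs]; exact mul_le_mul_of_nonneg_left (hx γ) hs)
            (by rw [abs_mul, abs_of_nonneg ht]; exact mul_le_mul_of_nonneg_left (hy γ) ht))
        _ = C := by rw [← add_mul, hst, one_mul]
    · intro i x hx γ
      rw [toLinearMap_reflection, ← RootPairing.coroot_reflectionPerm]
      exact hx _
  · have hdet := b.cartanMatrix_nondegenerate.det_ne_zero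
    have h1 : Matrix.vecMul (d - e) b.cartanMatrix = 0 := by
      ext i
      have := congrFun hde i
      simp only [wt] at this
      simp only [Matrix.vecMul, dotProduct, Pi.sub_apply, sub_mul, Finset.sum_sub_distrib,
        Pi.zero_apply]
      omega
    exact sub_eq_zero.1 (Matrix.eq_zero_of_vecMul_eq_zero hdet h1)

lemma isFiniteCartan_cartanMatrix [P.IsIrreducible] (b : P.Base) :
    IsFiniteCartan b.cartanMatrix := by
  obtain ⟨δ, hδ, hpd⟩ := b.exists_cartanMatrix_mul_diagaonal_posDef
  refine ⟨b.cartanMatrix_apply_same, b.cartanMatrix_le_zero_of_ne,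
    fun i j => b.cartanMatrix_apply_eq_zero_iff_symm.1, ⟨δ, hδ, fun i j => ?_⟩, fun v hv hv0 => ?_,
    fun p ⟨i, hi⟩ hp j => ?_, fun α d hd => hd.cartanMatrix_nonneg,
    fun α => finite_depth_cartanMatrix⟩
  · have := hpd.isHermitian.apply i j
    simpa [Matrix.mul_diagonal] using this.symm
  -- The quadratic form of the symmetrized Cartan matrix is positive at `v`, so one of its summands
  -- is; it provides the index.
  · have h1 := hpd.dotProduct_mulVec_pos hv0
    rw [Matrix.dotProduct_mulVec, ← Matrix.vecMul_vecMul, dotProduct] at h1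
    obtain ⟨i, hi⟩ : ∃ i, 0 < Matrix.vecMul (Matrix.vecMul (star v) b.cartanMatrix)
        (Matrix.diagonal δ) i * v i := by
      by_contra! hc
      exact absurd h1 (not_lt.2 (Finset.sum_nonpos fun i _ => hc i))
    rw [Matrix.vecMul_diagonal] at hi
    have hi' : 0 < ((∑ k, v k * b.cartanMatrix k i) * δ i) * v i := by
      simpa [Matrix.vecMul, dotProduct] using hi
    have hvi : 0 < v i := (hv i).lt_of_ne fun h => by rw [← h, mul_zero] at hi'; exact hi'.false
    exact ⟨i, hvi, pos_of_mul_pos_left (pos_of_mul_pos_left hi' hvi.le) (hδ i).le⟩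
  · exact b.induction_on_cartanMatrix p hi fun i j hpi hji =>
      hp i j hpi fun h => hji (b.cartanMatrix_apply_eq_zero_iff_symm.1 h)

end Bridge

/-! ### Hasse diagrams and diagram maps in terms of depth vectors. -/

section HasseDiagram

open Module

variable {ι M N : Type*} [Finite ι] [DecidableEq ι] [AddCommGroup M] [Module ℝ M]
  [AddCommGroup N] [Module ℝ N] {P : RootPairing ι ℝ M N} [P.IsRootSystem] [P.IsCrystallographic]
  {b : P.Base} {α : b.support}

lemma weightAt_mem_weightLattice (d : b.support → ℤ) : weightAt b α d ∈ weightLattice P := by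
  intro γ
  have := b.coroot_mem_span_int γ
  generalize P.coroot γ = y at this ⊢
  induction this using Submodule.span_induction with
  | mem y hy =>
    obtain ⟨i, hi, rfl⟩ := hy
    exact ⟨_, weightAt_coroot d ⟨i, hi⟩⟩
  | zero => exact ⟨0, by simp⟩
  | add y z _ _ hy hz =>
    obtain ⟨k, hk⟩ := hy
    obtain ⟨l, hl⟩ := hz
    exact ⟨k + l, by simp [hk, hl]⟩
  | smul n y _ hy =>
    obtain ⟨k, hk⟩ := hy
    exact ⟨n * k, by simp [hk]⟩

lemma Depth.reflection_mem {d : b.support → ℤ} (hd : Depth b.cartanMatrix α d) (i : b.support) :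
    ∃ e, Depth b.cartanMatrix α e ∧ P.reflection i (weightAt b α d) = weightAt b α e :=
  ⟨_, hd.reflect i, by
    rw [RootPairing.reflection_apply, weightAt_add_single, ← weightAt_coroot]
    rfl⟩

/-- Every root is obtained from a simple one by simple reflections, which permute the reachable
weights. So root strings for simple roots suffice to generate the saturated set. -/
lemma exists_weightAt_eq_sub_smul_root [P.IsReduced] (γ : ι) : ∀ d, Depth b.cartanMatrix α d →
    ∀ k : ℤ, (k : ℝ) ∈ Set.uIcc 0 (P.toLinearMap (weightAt b α d) (P.coroot γ)) →
      ∃ e, Depth b.cartanMatrix α e ∧ weightAt b α e = weightAt b α d - (k : ℝ) • P.root γ := by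
  refine b.induction_reflect (p := fun γ => ∀ d, Depth b.cartanMatrix α d → ∀ k : ℤ,
    (k : ℝ) ∈ Set.uIcc 0 (P.toLinearMap (weightAt b α d) (P.coroot γ)) →
      ∃ e, Depth b.cartanMatrix α e ∧ weightAt b α e = weightAt b α d - (k : ℝ) • P.root γ) γ
    (fun γ ih d hd k hk => ?_) (fun i hi d hd k hk => ?_) (fun γ j ih hj d hd k hk => ?_)
  · obtain ⟨e, he, h⟩ := ih d hd (-k) (by
      rw [RootPairing.coroot_reflectionPerm, RootPairing.coreflection_apply_self, map_neg] at hk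
      rw [Set.mem_uIcc] at hk ⊢
      push_cast
      rcases hk with hk | hk
      · exact .inr ⟨by linarith [hk.2], by linarith [hk.1]⟩
      · exact .inl ⟨by linarith [hk.2], by linarith [hk.1]⟩)
    refine ⟨e, he, ?_⟩
    rw [RootPairing.root_reflectionPerm, RootPairing.reflection_apply_self, h]
    simp
  · obtain ⟨t, rfl⟩ : ∃ t : b.support, t = i := ⟨⟨i, hi⟩, rfl⟩
    rw [weightAt_coroot, mem_uIcc_cast] at hk
    exact ⟨_, hd.step t k hk, weightAt_add_single d t k⟩
  · obtain ⟨e, he, h1⟩ := hd.reflection_mem ⟨j, hj⟩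
    obtain ⟨d', hd', h2⟩ := ih e he k (by
      rwa [← h1, toLinearMap_reflection, ← RootPairing.coroot_reflectionPerm])
    obtain ⟨e', he', h3⟩ := hd'.reflection_mem ⟨j, hj⟩
    refine ⟨e', he', ?_⟩
    rw [← h3, h2, ← h1, map_sub, map_smul, RootPairing.reflection_same,
      RootPairing.root_reflectionPerm]

/-- The vertices of the Hasse diagram of a fundamental weight. -/
lemma hasseVertices_fundWeight [P.IsReduced] :
    hasseVertices P (fundWeight b α) = {x | ∃ d, Depth b.cartanMatrix α d ∧ weightAt b α d = x} := by
  refine Set.Subset.antisymm (Set.sInter_subset_of_mem ⟨⟨?_, ?_⟩, 0, .zero, weightAt_zero⟩) ?_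
  · rintro _ ⟨d, -, rfl⟩
    exact weightAt_mem_weightLattice d
  · rintro _ ⟨d, hd, rfl⟩ γ k hk
    exact exists_weightAt_eq_sub_smul_root γ d hd k hk
  · rintro _ ⟨d, hd, rfl⟩ S ⟨hS, h0⟩
    induction hd with
    | zero => rwa [weightAt_zero]
    | @step d i k _ hk ih =>
      rw [weightAt_add_single]
      exact hS.2 _ ih i k (by rwa [weightAt_coroot, mem_uIcc_cast])

lemma Depth.mem_hasseVertices [P.IsReduced] {d : b.support → ℤ} (hd : Depth b.cartanMatrix α d) :
    weightAt b α d ∈ hasseVertices P (fundWeight b α) := by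
  rw [hasseVertices_fundWeight]
  exact ⟨d, hd, rfl⟩

lemma isExtremal_iff {σ : b.support} : IsExtremal b σ ↔ IsLeaf b.cartanMatrix σ := by
  refine existsUnique_congr fun τ => ?_
  change (σ ≠ τ ∧ P.pairing σ τ * P.pairing τ σ ≠ 0) ↔ _
  rw [mul_ne_zero_iff, ← cast_cartanMatrix, ← cast_cartanMatrix, Int.cast_ne_zero,
    Int.cast_ne_zero, Ne, Ne, Ne, b.cartanMatrix_apply_eq_zero_iff_symm (i := τ), and_self,
    eq_comm]

/-- Induction on depth vectors, along the edges of the Hasse diagram. -/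
lemma Depth.induction_edge {I : Type*} [Fintype I] [DecidableEq I] {A : Matrix I I ℤ} {α : I}
    {p : (I → ℤ) → Prop} (h0 : p 0) (hp : ∀ d i, Depth A α d → Depth A α (d + Pi.single i 1) →
      (p d ↔ p (d + Pi.single i 1))) {d : I → ℤ} (hd : Depth A α d) : p d := by
  induction hd with
  | zero => exact h0
  | @step d i k hd hk ih =>
    obtain ⟨n, hn⟩ : ∃ n, n = k.natAbs := ⟨_, rfl⟩
    induction n generalizing k with
    | zero =>
      rw [show k = 0 by omega, Pi.single_zero, add_zero]
      exact ih
    | succ n ihn =>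
      have hd' := hd.step i k hk
      rw [Set.mem_uIcc] at hk
      rcases lt_or_ge 0 k with hk0 | hk0
      · have hk' : k - 1 ∈ Set.uIcc 0 (wt A α d i) := Set.mem_uIcc.2 (.inl (by omega))
        have h1 : d + Pi.single i k = d + Pi.single i (k - 1) + Pi.single i 1 := by
          rw [add_assoc, ← Pi.single_add, sub_add_cancel]
        rw [h1] at hd' ⊢
        exact (hp _ i (hd.step i _ hk') hd').1 (ihn _ hk' (by omega))
      · have hk' : k + 1 ∈ Set.uIcc 0 (wt A α d i) := Set.mem_uIcc.2 (.inr (by omega))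
        have h1 : d + Pi.single i (k + 1) = d + Pi.single i k + Pi.single i 1 := by
          rw [add_assoc, ← Pi.single_add]
        have h2 := hd.step i _ hk'
        have h3 := ihn _ hk' (by omega)
        rw [h1] at h2 h3
        exact (hp _ i hd' h2).2 h3

variable {ι' M' N' : Type*} [Finite ι'] [DecidableEq ι'] [AddCommGroup M'] [Module ℝ M']
  [AddCommGroup N'] [Module ℝ N'] {P' : RootPairing ι' ℝ M' N'} [P'.IsRootSystem]
  [P'.IsCrystallographic] {b' : P'.Base} [P.IsReduced] [P'.IsReduced] {f : b.support → b'.support}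

/-- The combinatorial form of a surjective diagram map. -/
lemma IsDiagramMap.depth_iff {T : hasseVertices P (fundWeight b α) →
      hasseVertices P' (fundWeight b' (f α))}
    (hT : IsDiagramMap f (fundWeight b α) (fundWeight b' (f α)) T) (hs : Function.Surjective T)
    (d' : b'.support → ℤ) :
    Depth b'.cartanMatrix (f α) d' ↔ ∃ d, Depth b.cartanMatrix α d ∧ push f d = d' := by
  have hmem : ∀ x, x ∈ hasseVertices P' (fundWeight b' (f α)) →
      ∃ d, Depth b'.cartanMatrix (f α) d ∧ weightAt b' (f α) d = x := fun x hx => by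
    rwa [hasseVertices_fundWeight] at hx
  -- A priori the highest weight may go to a lower vertex, of depth `e`; following edges, `T` is the
  -- push-forward translated by `e`.
  obtain ⟨e, he, hTe⟩ := hmem _ (T ⟨weightAt b α 0, Depth.zero.mem_hasseVertices⟩).2
  have key : ∀ {d} (hd : Depth b.cartanMatrix α d),
      (T ⟨_, hd.mem_hasseVertices⟩ : M') = weightAt b' (f α) (e + push f d) := by
    intro d hd
    refine Depth.induction_edge (p := fun d => ∀ hd : Depth b.cartanMatrix α d,
      (T ⟨_, hd.mem_hasseVertices⟩ : M') = weightAt b' (f α) (e + push f d))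
      (fun _ => by rw [push_zero, add_zero, hTe]) (fun d i h1 h2 => ?_) hd hd
    have h3 := hT ⟨_, h1.mem_hasseVertices⟩ ⟨_, h2.mem_hasseVertices⟩ i (by
      change weightAt b α d - weightAt b α (d + Pi.single i 1) = _
      rw [weightAt_add_single]
      simp)
    have h4 : weightAt b' (f α) (e + push f (d + Pi.single i 1)) =
        weightAt b' (f α) (e + push f d) - P'.root (f i) := by
      rw [push_add_single, ← add_assoc, weightAt_add_single, Int.cast_one, one_smul]
    rw [h4]
    constructor
    · intro h _
      rw [← h h1, ← h3]
      abel
    · intro h _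
      rw [sub_eq_iff_eq_add.1 h3, h h2, add_sub_cancel]
  obtain ⟨⟨x, hx⟩, hTx⟩ := hs ⟨weightAt b' (f α) 0, Depth.zero.mem_hasseVertices⟩
  have hx' := hx
  rw [hasseVertices_fundWeight] at hx'
  obtain ⟨d₀, hd₀, rfl⟩ := hx'
  have h1 := key hd₀
  rw [hTx] at h1
  have h2 := weightAt_injective h1
  -- By surjectivity some `e + push f d₀` is zero; both summands are nonnegative.
  have he0 : e = 0 := by
    ext i
    have h3 := congrFun h2 i
    have h4 := he.cartanMatrix_nonneg i
    have h5 : 0 ≤ push f d₀ i := Finset.sum_nonneg fun t _ => by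
      split_ifs <;> simp [hd₀.cartanMatrix_nonneg]
    simp only [Pi.zero_apply, Pi.add_apply] at h3 ⊢
    omega
  simp only [he0, zero_add] at key
  constructor
  · intro hd'
    obtain ⟨⟨x, hx⟩, hTx⟩ := hs ⟨_, hd'.mem_hasseVertices⟩
    have hx' := hx
    rw [hasseVertices_fundWeight] at hx'
    obtain ⟨d, hd, rfl⟩ := hx'
    refine ⟨d, hd, weightAt_injective (α := f α) ?_⟩
    rw [← key hd, hTx]
  · rintro ⟨d, hd, rfl⟩
    obtain ⟨d', hd', h⟩ := hmem _ (T ⟨_, hd.mem_hasseVertices⟩).2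
    rw [key hd] at h
    rwa [← weightAt_injective h]

lemma isLabeling_of_isDiagramMap [P.IsIrreducible] [P'.IsIrreducible]
    (hext : ∀ α, IsExtremal b α → IsExtremal b' (f α))
    (hmap : ∀ α, IsExtremal b α → ∃ T : hasseVertices P (fundWeight b α) →
        hasseVertices P' (fundWeight b' (f α)),
      IsDiagramMap f (fundWeight b α) (fundWeight b' (f α)) T ∧ Function.Surjective T) :
    IsLabeling b.cartanMatrix b'.cartanMatrix f where
  left := isFiniteCartan_cartanMatrix b
  right := isFiniteCartan_cartanMatrix b'
  leaf α hα := isExtremal_iff.1 (hext α (isExtremal_iff.2 hα))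
  depth_iff α hα d' := by
    obtain ⟨T, hT, hs⟩ := hmap α (isExtremal_iff.2 hα)
    exact hT.depth_iff hs d'

/-- The row `D₄ → B₃` is never produced: it is the row `D_n → B_{n-1}` for `n = 4`, up to
renumbering by an automorphism of D₄. Ranks are shifted by two or three. -/
lemma IsTabulated.isFolding (h : IsTabulated b.cartanMatrix b'.cartanMatrix f) : IsFolding f := by
  rcases h with ⟨m, h⟩ | h | ⟨m, h⟩ | h | ⟨m, h⟩ | h | h
  · exact .inl ⟨m + 2, by omega, h⟩
  · exact .inr (.inl h)
  · exact .inr (.inr (.inl ⟨m + 2, by omega, h⟩))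
  · exact .inr (.inr (.inr (.inl h)))
  · exact .inr (.inr (.inr (.inr (.inl ⟨m + 3, by omega, h⟩))))
  · exact .inr (.inr (.inr (.inr (.inr (.inr (.inl h))))))
  · exact .inr (.inr (.inr (.inr (.inr (.inr (.inr h))))))

end HasseDiagram

end RootHasse

theorem mainTheorem5 {ι M N ι' M' N' : Type*} [Finite ι] [Finite ι']
    [AddCommGroup M] [Module ℝ M] [AddCommGroup N] [Module ℝ N]
    [AddCommGroup M'] [Module ℝ M'] [AddCommGroup N'] [Module ℝ N']
    (L : RootPairing ι ℝ M N) (J : RootPairing ι' ℝ M' N')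
    [L.IsRootSystem] [L.IsCrystallographic] [L.IsReduced] [L.IsIrreducible]
    [J.IsRootSystem] [J.IsCrystallographic] [J.IsReduced] [J.IsIrreducible]
    (b : L.Base) (b' : J.Base) (hrank : 2 ≤ b.support.card)
    (f : b.support → b'.support)
    (hext : ∀ α, RootHasse.IsExtremal b α → RootHasse.IsExtremal b' (f α))
    (hmap : ∀ α, RootHasse.IsExtremal b α →
      ∃ T : RootHasse.hasseVertices L (RootHasse.fundWeight b α) →
          RootHasse.hasseVertices J (RootHasse.fundWeight b' (f α)),
        RootHasse.IsDiagramMap f (RootHasse.fundWeight b α) (RootHasse.fundWeight b' (f α)) T ∧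
          Function.Surjective T) :
    RootHasse.IsDynkinIso f ∨ RootHasse.IsFolding f := by
  classical
  have h := RootHasse.isLabeling_of_isDiagramMap hext hmap
  exact (h.isIso_or_tabulated (by rwa [Fintype.card_coe])).imp_right
    RootHasse.IsTabulated.isFolding
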